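/- Let $N\ge 1$ and $k\ge 0$. Let $S_N$ act on real polynomials in $x_1,\dots,x_N$ by $(wf)(x)=f(xw)$, $(xw)_i=x_{w(i)}$, and on compositions $\alpha\in\mathbb{Z}_{\ge0}^N$ by $(w\alpha)_i=\alpha_{w^{-1}(i)}$; $(ij)$ denotes a transposition. Let $T_i=\frac{\partial}{\partial x_i}+k\sum_{j\ne i}\frac{1}{x_i-x_j}(1-(ij))$ be the Dunkl operators, put $$U_i=T_ix_i+k-k\sum_{j<i}(ij),\qquad \kappa_i(\alpha)=Nk-k\bigl(\#\{s:\alpha_s>\alpha_i\}+\#\{s<i:\alpha_s=\alpha_i\}\bigr)+\alpha_i+1,$$ and define $p_\alpha$ by $\sum_\alpha p_\alpha(x)y^\alpha=\prod_{i}\bigl\{(1-x_iy_i)^{-1}\prod_{j}(1-x_iy_j)^{-k}\bigr\}$. Write $\alpha^+$ for the nonincreasing rearrangement of $\alpha$, $|\alpha|=\sum_i\alpha_i$, and $\alpha\succ\beta$ if $\alpha\neq\beta$ and $\sum_{i\le j}\alpha_i\ge\sum_{i\le j}\beta_i$ for all $j\le N$. For a partition $\lambda$ let $\omega_\lambda$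 be the simultaneous eigenfunction, $U_i\omega_\lambda=\kappa_i(\lambda)\omega_\lambda$ for all $i$, with $\omega_\lambda\in p_\lambda+\mathrm{span}\{p_\beta:|\beta|=|\lambda|,\ \beta^+\succ\lambda\}$, and let $\omega_{w\lambda}=w\omega_\lambda$ for $w\in S_N$. The nonsymmetric Jack polynomial $\zeta_\alpha$ is the simultaneous eigenfunction, $U_i\zeta_\alpha=\kappa_i(\alpha)\zeta_\alpha$ for all $i$, with $\zeta_\alpha\in\omega_\alpha+\mathrm{span}\{\omega_\beta:\beta^+=\alpha^+,\ \beta\succ\alpha\}$. Let $I=[\ell+1,\ell+m]\subset[1,N]$ with $m\ge1$, and let $S_I$ be the group of all $w\in S_N$ fixing every point outside $I$. The skew operator is $\psi_I=\psi_m$, where $\psi_1=1$ and, for $1\le s<m$, $$\tilde\psi_{s+1}=U_{\ell+1}U_{\ell+2}\cdots U_{\ell+s}\,\psi_s,\qquad \psi_{s+1}=\tilde\psi_{s+1}-\sum_{i=\ell+1}^{\ell+s}(i,\ell+s+1)\,\tilde\psi_{s+1}\,(i,\ell+s+1).$$ **Theorem 4.12.** Suppose $\alpha$ satisfies $(>,I)$,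 that is, $\alpha_i>\alpha_j$ whenever $i,j\in I$ and $i<j$. Let $X=\mathrm{span}\{\zeta_{w\alpha}:w\in S_I\}$ and $g_{w\alpha}=w\zeta_\alpha$ for $w\in S_I$. Then $\{g_{w\alpha}:w\in S_I\}$ is a basis of $X$ (indexed by $S_I$), $\psi_I$ maps $X$ into itself, and the matrix of $\psi_I|_X$ in this basis is $$\prod_{\ell+1\le i<j\le\ell+m}\bigl(\kappa_i(\alpha)-\kappa_j(\alpha)\bigr)\;PH,$$ where $P(w_1\alpha,w_2\alpha)=\mathrm{sgn}(w_1)\,\delta_{w_1,w_2}$ is the parity matrix and $H(w_1\alpha,w_2\alpha)=\langle g_{w_1\alpha},g_{w_2\alpha}\rangle/\langle g_\alpha,g_\alpha\rangle$ is the normalized Gram matrix. Here $\langle\cdot,\cdot\rangle$ is any inner product on real polynomials (symmetric, bilinear, positive definite) for which every $T_ix_i$ is self-adjoint and $\langle wf,g\rangle=\langle f,w^{-1}g\rangle$ for all $w\in S_N$. (The matrix $(A(\gamma,\beta))$ of an operator $A$ is given by $Ag_\beta=\sum_\gamma A(\gamma,\beta)g_\gamma$.) -/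

import Mathlib

noncomputable section

namespace NSJack

open MvPolynomial

/-- Real polynomials in `N` variables `x_1, …, x_N` (indexed from `0` by `Fin N`). -/
abbrev Poly (N : ℕ) : Type := MvPolynomial (Fin N) ℝ

/-- The action of a permutation on polynomials, `(w f)(x) = f(x w)` with `(x w)_i = x_{w i}`;
on variables it is `x_i ↦ x_{w i}`. -/
def permOp {N : ℕ} (w : Equiv.Perm (Fin N)) : Module.End ℝ (Poly N) :=
  (rename w : Poly N →ₐ[ℝ] Poly N).toLinearMap

/-- Multiplication by `x_i`. -/
def mulX {N : ℕ} (i : Fin N) : Module.End ℝ (Poly N) :=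
  LinearMap.mulLeft ℝ (X i : Poly N)

theorem X_sub_X_dvd {N : ℕ} (i j : Fin N) (f : Poly N) :
    (X i - X j : Poly N) ∣ f - permOp (Equiv.swap i j) f := by
  rw [← Ideal.mem_span_singleton, ← Ideal.Quotient.eq]
  have h : (Ideal.Quotient.mkₐ ℝ (Ideal.span {(X i - X j : Poly N)})) =
      (Ideal.Quotient.mkₐ ℝ (Ideal.span {(X i - X j : Poly N)})).comp
        (rename (Equiv.swap i j)) := by
    apply MvPolynomial.algHom_ext
    intro s
    have hij : Ideal.Quotient.mk (Ideal.span {(X i - X j : Poly N)}) (X i) =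
        Ideal.Quotient.mk (Ideal.span {(X i - X j : Poly N)}) (X j) :=
      Ideal.Quotient.eq.2 (Ideal.mem_span_singleton_self _)
    simp only [Ideal.Quotient.mkₐ_eq_mk, AlgHom.comp_apply, rename_X]
    by_cases h1 : s = i
    · subst h1; simpa using hij
    · by_cases h2 : s = j
      · subst h2; simpa using hij.symm
      · rw [Equiv.swap_apply_of_ne_of_ne h1 h2]
  exact DFunLike.congr_fun h f

theorem X_sub_X_ne_zero {N : ℕ} {i j : Fin N} (h : i ≠ j) : (X i - X j : Poly N) ≠ 0 :=
  sub_ne_zero.2 fun e => h (X_injective e)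

/-- The divided difference `f ↦ (f - (i j) f) / (x_i - x_j)`, for `i ≠ j`. -/
def dividedDiff {N : ℕ} (i j : Fin N) (hij : i ≠ j) : Module.End ℝ (Poly N) where
  toFun f := (X_sub_X_dvd i j f).choose
  map_add' f g := by
    apply mul_left_cancel₀ (X_sub_X_ne_zero hij)
    rw [mul_add, ← (X_sub_X_dvd i j (f + g)).choose_spec, ← (X_sub_X_dvd i j f).choose_spec,
      ← (X_sub_X_dvd i j g).choose_spec, map_add]
    ring
  map_smul' c f := by
    apply mul_left_cancel₀ (X_sub_X_ne_zero hij)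
    rw [RingHom.id_apply, mul_smul_comm, ← (X_sub_X_dvd i j (c • f)).choose_spec,
      ← (X_sub_X_dvd i j f).choose_spec, map_smul, smul_sub]

theorem dividedDiff_spec {N : ℕ} (i j : Fin N) (hij : i ≠ j) (f : Poly N) :
    (X i - X j) * dividedDiff i j hij f = f - permOp (Equiv.swap i j) f :=
  (X_sub_X_dvd i j f).choose_spec.symm

/-- The type `A` Dunkl operator
`T_i = ∂/∂x_i + k ∑_{j ≠ i} (1 - (i j)) / (x_i - x_j)`. -/
def dunklT {N : ℕ} (k : ℝ) (i : Fin N) : Module.End ℝ (Poly N) :=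
  (pderiv i : Derivation ℝ (Poly N) (Poly N)).toLinearMap +
    k • ∑ j : Fin N, if h : i ≠ j then dividedDiff i j h else 0

/-- The operator `U_i = T_i ρ_i - k ∑_{j < i} (i j)`, where `T_i ρ_i = T_i x_i + k`. -/
def opU {N : ℕ} (k : ℝ) (i : Fin N) : Module.End ℝ (Poly N) :=
  (dunklT k i * mulX i + k • 1) -
    k • ∑ j ∈ Finset.univ.filter (fun j => j < i), permOp (Equiv.swap i j)

/-- `κ_i(α) = N k - k (#{s : α_s > α_i} + #{s : s < i, α_s = α_i}) + α_i + 1`. -/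
def kappa {N : ℕ} (k : ℝ) (α : Fin N → ℕ) (i : Fin N) : ℝ :=
  N * k - k * (((Finset.univ.filter (fun s => α i < α s)).card : ℝ) +
    ((Finset.univ.filter (fun s => s < i ∧ α s = α i)).card : ℝ)) + α i + 1

/-- The action of permutations on compositions, `(w α)_i = α_{w⁻¹ i}`. -/
def compAct {N : ℕ} (w : Equiv.Perm (Fin N)) (α : Fin N → ℕ) : Fin N → ℕ :=
  fun i => α (w⁻¹ i)

/-- Strict dominance `α ≻ β` of compositions: `α ≠ β` and every partial sum
`α_1 + ⋯ + α_j` is at least `β_1 + ⋯ + β_j`. -/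
def Dominates {N : ℕ} (α β : Fin N → ℕ) : Prop :=
  α ≠ β ∧ ∀ j : Fin N, ∑ i ∈ Finset.Iic j, β i ≤ ∑ i ∈ Finset.Iic j, α i

/-- A permutation sorting `α` into nonincreasing order. -/
def sortPerm {N : ℕ} (α : Fin N → ℕ) : Equiv.Perm (Fin N) :=
  Tuple.sort fun i => OrderDual.toDual (α i)

/-- The partition `α⁺`, the nonincreasing rearrangement of `α`. One has
`compAct (sortPerm α) (plus α) = α`. -/
def plus {N : ℕ} (α : Fin N → ℕ) : Fin N → ℕ :=
  fun i => α (sortPerm α i)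

/-- The binomial series `(1 - x_i y_j)^{-c} = ∑_n ((c)_n / n!) x_i^n y_j^n`, as a formal power
series in `y` whose coefficients are polynomials in `x`. -/
def binSeries {N : ℕ} (c : ℝ) (i j : Fin N) : MvPowerSeries (Fin N) (Poly N) :=
  fun d => if d = Finsupp.single j (d j) then
    C ((ascPochhammer ℝ (d j)).eval c / ((d j).factorial : ℝ)) * X i ^ d j else 0

/-- The generating function
`F_k(x, y) = ∏_i (1 - x_i y_i)^{-1} ∏_j (1 - x_i y_j)^{-k}`. -/
def genF (N : ℕ) (k : ℝ) : MvPowerSeries (Fin N) (Poly N) :=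
  ∏ i : Fin N, (binSeries 1 i i * ∏ j : Fin N, binSeries k i j)

/-- The polynomials `p_α`, defined by `F_k(x, y) = ∑_α p_α(x) y^α`. -/
def polyP {N : ℕ} (k : ℝ) (α : Fin N → ℕ) : Poly N :=
  MvPowerSeries.coeff (Finsupp.equivFunOnFinite.symm α) (genF N k)

/-- `f` is the simultaneous eigenfunction `ω_lam` of the `U_i` attached to the partition `lam`
(a multiple of the nonsymmetric Jack polynomial `E_lam`), normalized by
`f = p_lam + ∑ {B_β p_β : |β| = |lam|, β⁺ ≻ lam}`. -/
def IsOmega {N : ℕ} (k : ℝ) (lam : Fin N → ℕ) (f : Poly N) : Prop :=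
  (∀ i : Fin N, opU k i f = kappa k lam i • f) ∧
    f - polyP k lam ∈ Submodule.span ℝ
      (polyP k '' {β | ∑ i, β i = ∑ i, lam i ∧ Dominates (plus β) lam})

/-- `ω_lam` for a partition `lam`. -/
def omegaPart {N : ℕ} (k : ℝ) (lam : Fin N → ℕ) : Poly N :=
  Classical.epsilon (IsOmega k lam)

/-- `ω_α` for a composition `α`: `ω_{w lam} = w ω_lam` for a partition `lam`. -/
def omega {N : ℕ} (k : ℝ) (α : Fin N → ℕ) : Poly N :=
  permOp (sortPerm α) (omegaPart k (plus α))

/-- `f` is the nonsymmetric Jack polynomial with label `α`: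
`U_i f = κ_i(α) f` for all `i`, and `f = ω_α + ∑ {B_β ω_β : β⁺ = α⁺, β ≻ α}`. -/
def IsZeta {N : ℕ} (k : ℝ) (α : Fin N → ℕ) (f : Poly N) : Prop :=
  (∀ i : Fin N, opU k i f = kappa k α i • f) ∧
    f - omega k α ∈ Submodule.span ℝ (omega k '' {β | plus β = plus α ∧ Dominates β α})

/-- The nonsymmetric Jack polynomial `ζ_α`. -/
def zeta {N : ℕ} (k : ℝ) (α : Fin N → ℕ) : Poly N :=
  Classical.epsilon (IsZeta k α)

/-- The interval `I = [ℓ+1, ℓ+m]`; with indices counted from `0` it is `{i : ℓ ≤ i < ℓ + m}`. -/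
def interval (N ℓ m : ℕ) : Finset (Fin N) :=
  Finset.univ.filter fun i => ℓ ≤ (i : ℕ) ∧ (i : ℕ) < ℓ + m

/-- The group `S_I` of the permutations fixing every point outside `I`. -/
def permGroup {N : ℕ} (I : Finset (Fin N)) : Subgroup (Equiv.Perm (Fin N)) where
  carrier := {w | ∀ i, i ∉ I → w i = i}
  mul_mem' {a b} ha hb i hi := by
    rw [Equiv.Perm.mul_apply, hb i hi, ha i hi]
  one_mem' i _ := rfl
  inv_mem' {a} ha i hi := by
    rw [Equiv.Perm.inv_eq_iff_eq]
    exact (ha i hi).symm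

instance {N : ℕ} (I : Finset (Fin N)) : Fintype (permGroup I) := Fintype.ofFinite _

/-- Condition `(>, I)`. -/
def StrictOn {N : ℕ} (I : Finset (Fin N)) (α : Fin N → ℕ) : Prop :=
  ∀ i ∈ I, ∀ j ∈ I, i < j → α j < α i

/-- `X = span {ζ_{w α} : w ∈ S_I}`. -/
def spaceX {N : ℕ} (k : ℝ) (I : Finset (Fin N)) (α : Fin N → ℕ) : Submodule ℝ (Poly N) :=
  Submodule.span ℝ (Set.range fun w : permGroup I => zeta k (compAct (w : Equiv.Perm (Fin N)) α))

/-- The product `∏_{i ∈ I} U_i`, taken in increasing order of `i`. -/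
def prodU {N : ℕ} (k : ℝ) (I : Finset (Fin N)) : Module.End ℝ (Poly N) :=
  (((List.finRange N).filter fun i => i ∈ I).map (opU k)).prod

/-- The skew operator `ψ_I`, `I = [ℓ+1, ℓ+m]`, by recursion on the length of the interval: with
`ψ̃_{s+1} = U_{ℓ+1} ⋯ U_{ℓ+s} ψ_s`,
`ψ_{s+1} = ψ̃_{s+1} - ∑_{i=ℓ+1}^{ℓ+s} (i, ℓ+s+1) ψ̃_{s+1} (i, ℓ+s+1)`.
The start `ψ_1 = 1` is the case `s = 0` of the recursion from `ψ_0 = 1`. -/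
def skewOp {N : ℕ} (k : ℝ) (ℓ : ℕ) : (m : ℕ) → ℓ + m ≤ N → Module.End ℝ (Poly N)
  | 0, _ => 1
  | s + 1, h =>
    let t : Fin N := ⟨ℓ + s, h⟩
    let ψt : Module.End ℝ (Poly N) :=
      prodU k (interval N ℓ s) * skewOp k ℓ s (Nat.le_of_succ_le h)
    ψt - ∑ i ∈ interval N ℓ s, permOp (Equiv.swap i t) * ψt * permOp (Equiv.swap i t)

/-- The permissible inner products on polynomials: symmetric, positive definite, with every
`T_i x_i` self-adjoint, and `S_N`-invariant. -/
structure IsPermissible {N : ℕ} (k : ℝ) (B : LinearMap.BilinForm ℝ (Poly N)) : Prop where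
  symm : ∀ f g, B f g = B g f
  pos : ∀ f, f ≠ 0 → 0 < B f f
  selfAdjoint : ∀ (i : Fin N) f g,
    B ((dunklT k i * mulX i) f) g = B f ((dunklT k i * mulX i) g)
  invariant : ∀ (w : Equiv.Perm (Fin N)) f g, B (permOp w f) g = B f (permOp w⁻¹ g)

/-- The element `g_{w α} = w ζ_α`, `w ∈ S_I`. For `α` satisfying `(>, I)` the map `w ↦ w α` is
injective on `S_I`, so that families and matrices over `S_I α` are indexed by `S_I`. -/
def elemG {N : ℕ} (k : ℝ) (I : Finset (Fin N)) (α : Fin N → ℕ) (w : permGroup I) : Poly N :=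
  permOp (w : Equiv.Perm (Fin N)) (zeta k α)

/-- The normalized Gram matrix `H(w₁ α, w₂ α) = ⟨g_{w₁ α}, g_{w₂ α}⟩ / ‖g_α‖²`. -/
def gramH {N : ℕ} (k : ℝ) (B : LinearMap.BilinForm ℝ (Poly N)) (I : Finset (Fin N))
    (α : Fin N → ℕ) : Matrix (permGroup I) (permGroup I) ℝ :=
  Matrix.of fun w₁ w₂ => B (elemG k I α w₁) (elemG k I α w₂) / B (elemG k I α 1) (elemG k I α 1)

/-- The parity matrix `P(w₁ α, w₂ α) = sgn(w₁) δ_{w₁, w₂}`. -/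
def parityP {N : ℕ} (I : Finset (Fin N)) : Matrix (permGroup I) (permGroup I) ℝ :=
  Matrix.of fun w₁ w₂ =>
    if w₁ = w₂ then ((Equiv.Perm.sign (w₁ : Equiv.Perm (Fin N)) : ℤ) : ℝ) else 0

end NSJack

end

/-! On `X` the operators `U_i` are simultaneously diagonal, and `ψ_I` is a skew-symmetrization over
`S_I`; the two facts together force `ψ_I` to be a Vandermonde product times one skew-symmetrized
projection.

Write `A(T) = ∑_{w ∈ S_I} sgn(w) w T w⁻¹`. The recursion for `ψ_I` is a sum over coset
representatives of nested symmetric groups, and `U_{ℓ+1} ⋯ U_{ℓ+s}` commutes with the permutations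
of its own indices, so `ψ_I = A(D)` with `D = U_{ℓ+1}^{m-1} U_{ℓ+2}^{m-2} ⋯ U_{ℓ+m-1}`
(`skewOp_eq_signedSum`). Let `E_v` be the orthogonal projection onto the line of `ζ_{vα}`. The `U_i`
are self-adjoint with distinct joint spectra, so the `ζ_{vα}` are orthogonal and `D = ∑_v d_v E_v`
on `X`, where `d_v` is the staircase monomial in the permuted eigenvalues `κ(α) ∘ v⁻¹`.

For an adjacent transposition `s` in `S_I`, the plane of `ζ_{vα}` and `ζ_{svα}` is `s`-stable
(`permOp_swap_zeta`), hence `E_v + E_{sv}` commutes with `s`. As `A(sTs) = -A(T)`, this gives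
`A(E_{sv}) = -A(E_v)`, and so `A(E_v) = sgn(v) A(E_1)` (`IsPermissible.signedSum_projOn_zeta`).
Therefore `ψ_I = (∑_v sgn(v) d_v) A(E_1)` on `X`. The scalar is a Vandermonde determinant
(`sum_sgn_mul_stairScalar`), and `w E_1 w⁻¹ g_u = H(w, u) g_w`, so that `A(E_1)` has matrix `PH`.

The rest constructs the `ζ_α`. The `U_i` commute (`opU_comm`) and are triangular on the `p_γ`
(`opU_polyP_sub_mem`) with joint spectra that separate compositions (`kappa_injective`), which gives
existence of `ω` and `ζ`. The `p_γ` are independent by a positivity argument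
(`monPair_le_monPair_monToP`); this gives `ζ_α ≠ 0` and the simplicity of its joint spectrum on the
span of the `p_γ`. The condition `k ≥ 0` enters through these two facts and through the spectral gap
`lt_kappa_sub`. -/

noncomputable section

namespace NSJack

open MvPolynomial Equiv

/-! ### Dunkl operators, commutativity of the `U_i`, and their exchange relations with
transpositions -/

section Operators

variable {N : ℕ}

theorem permOp_apply (w : Perm (Fin N)) (f : Poly N) : permOp w f = rename w f := rfl

@[simp]
theorem permOp_one : (permOp (1 : Perm (Fin N))) = 1 := by
  apply LinearMap.ext
  intro f
  exact rename_id_apply f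

theorem permOp_mul (v w : Perm (Fin N)) : permOp (v * w) = permOp v * permOp w := by
  apply LinearMap.ext
  intro f
  exact (rename_rename w v f).symm

theorem permOp_mul_apply (v w : Perm (Fin N)) (f : Poly N) :
    permOp (v * w) f = permOp v (permOp w f) := by
  rw [permOp_mul]; rfl

theorem permOp_map_mul (w : Perm (Fin N)) (f g : Poly N) :
    permOp w (f * g) = permOp w f * permOp w g := map_mul (rename w) f g

@[simp]
theorem permOp_X (w : Perm (Fin N)) (i : Fin N) : permOp w (X i) = X (w i) := rename_X w i

@[simp]
theorem permOp_C (w : Perm (Fin N)) (c : ℝ) : permOp w (C c) = C c := rename_C w c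

theorem permOp_map_one (w : Perm (Fin N)) : permOp w (1 : Poly N) = 1 := permOp_C w 1

theorem permOp_inv_apply (w : Perm (Fin N)) (f : Poly N) : permOp w⁻¹ (permOp w f) = f := by
  rw [← permOp_mul_apply]; simp

theorem permOp_injective (w : Perm (Fin N)) : Function.Injective (permOp w) :=
  Function.LeftInverse.injective (permOp_inv_apply w)

theorem permOp_swap_swap (i j : Fin N) (f : Poly N) :
    permOp (swap i j) (permOp (swap i j) f) = f := by
  rw [← permOp_mul_apply]; simp

theorem eq_dividedDiff {i j : Fin N} (hij : i ≠ j) {f g : Poly N}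
    (h : (X i - X j) * g = f - permOp (swap i j) f) : dividedDiff i j hij f = g :=
  mul_left_cancel₀ (X_sub_X_ne_zero hij) ((dividedDiff_spec i j hij f).trans h.symm)

theorem permOp_dividedDiff (w : Perm (Fin N)) {i j : Fin N} (hij : i ≠ j) (f : Poly N) :
    permOp w (dividedDiff i j hij f) =
      dividedDiff (w i) (w j) (w.injective.ne hij) (permOp w f) := by
  symm
  apply eq_dividedDiff
  rw [← permOp_mul_apply, ← mul_swap_eq_swap_mul, permOp_mul_apply, ← map_sub (permOp w) f,
    ← dividedDiff_spec i j hij, permOp_map_mul]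
  simp

theorem dividedDiff_X_mul_left {i j : Fin N} (hij : i ≠ j) (f : Poly N) :
    dividedDiff i j hij (X i * f) = X i * dividedDiff i j hij f + permOp (swap i j) f := by
  apply eq_dividedDiff
  simp only [permOp_map_mul, permOp_X, swap_apply_left]
  linear_combination X i * dividedDiff_spec i j hij f

theorem dividedDiff_X_mul_right {i j : Fin N} (hij : i ≠ j) (f : Poly N) :
    dividedDiff i j hij (X j * f) = X j * dividedDiff i j hij f - permOp (swap i j) f := by
  apply eq_dividedDiff
  simp only [permOp_map_mul, permOp_X, swap_apply_right]
  linear_combination X j * dividedDiff_spec i j hij f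

theorem dividedDiff_X_mul_of_ne {i j l : Fin N} (hij : i ≠ j) (hi : l ≠ i) (hj : l ≠ j)
    (f : Poly N) : dividedDiff i j hij (X l * f) = X l * dividedDiff i j hij f := by
  apply eq_dividedDiff
  simp only [permOp_map_mul, permOp_X, swap_apply_of_ne_of_ne hi hj]
  linear_combination X l * dividedDiff_spec i j hij f

theorem dividedDiff_one {i j : Fin N} (hij : i ≠ j) : dividedDiff i j hij (1 : Poly N) = 0 := by
  apply eq_dividedDiff
  simp [permOp_map_one]

/-- The divided difference, extended by `0` to `i = j`. -/
def divDiff (i j : Fin N) : Module.End ℝ (Poly N) :=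
  if h : i ≠ j then dividedDiff i j h else 0

theorem divDiff_of_ne {i j : Fin N} (h : i ≠ j) : divDiff i j = dividedDiff i j h := dif_pos h

@[simp]
theorem divDiff_self (i : Fin N) : divDiff i i = 0 := by simp [divDiff]

theorem dunklT_apply (k : ℝ) (i : Fin N) (f : Poly N) :
    dunklT k i f = pderiv i f + k • ∑ j, divDiff i j f := by
  simp only [dunklT, LinearMap.add_apply, LinearMap.smul_apply, LinearMap.sum_apply]
  rfl

theorem permOp_divDiff (w : Perm (Fin N)) (i j : Fin N) (f : Poly N) :
    permOp w (divDiff i j f) = divDiff (w i) (w j) (permOp w f) := by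
  by_cases h : i = j
  · subst h; simp
  · rw [divDiff_of_ne h, divDiff_of_ne (w.injective.ne h), permOp_dividedDiff]

theorem permOp_pderiv (w : Perm (Fin N)) (i : Fin N) (f : Poly N) :
    permOp w (pderiv i f) = pderiv (w i) (permOp w f) :=
  (pderiv_rename w.injective i f).symm

theorem permOp_dunklT (k : ℝ) (w : Perm (Fin N)) (i : Fin N) (f : Poly N) :
    permOp w (dunklT k i f) = dunklT k (w i) (permOp w f) := by
  simp only [dunklT_apply, map_add, map_smul, map_sum, permOp_divDiff, permOp_pderiv]
  rw [← Equiv.sum_comp w (fun j => divDiff (w i) j (permOp w f))]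

theorem dunklT_X_mul_of_ne (k : ℝ) {i l : Fin N} (h : l ≠ i) (f : Poly N) :
    dunklT k i (X l * f) = X l * dunklT k i f - k • permOp (swap i l) f := by
  have h1 : ∀ j, divDiff i j (X l * f) =
      X l * divDiff i j f - if j = l then permOp (swap i l) f else 0 := by
    intro j
    by_cases hj : i = j
    · subst hj; simp [h.symm]
    · rw [divDiff_of_ne hj]
      split_ifs with hl
      · subst hl; exact dividedDiff_X_mul_right hj f
      · rw [dividedDiff_X_mul_of_ne hj h (Ne.symm hl), sub_zero]
  simp only [dunklT_apply, h1, Finset.sum_sub_distrib, Finset.sum_ite_eq', Finset.mem_univ,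
    if_true, ← Finset.mul_sum, Derivation.leibniz, pderiv_X_of_ne h, smul_eq_mul, mul_zero,
    add_zero, smul_sub, mul_add, mul_smul_comm]
  ring

theorem dunklT_X_mul_self (k : ℝ) (i : Fin N) (f : Poly N) :
    dunklT k i (X i * f) = X i * dunklT k i f + f +
      k • ∑ j ∈ Finset.univ.erase i, permOp (swap i j) f := by
  have h1 : ∀ j, divDiff i j (X i * f) =
      X i * divDiff i j f + if j = i then 0 else permOp (swap i j) f := by
    intro j
    split_ifs with hj
    · subst hj; simp
    · rw [divDiff_of_ne (Ne.symm hj), dividedDiff_X_mul_left]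
  have h2 : ∑ j, (if j = i then 0 else permOp (swap i j) f) =
      ∑ j ∈ Finset.univ.erase i, permOp (swap i j) f := by
    rw [← Finset.sum_erase_add _ _ (Finset.mem_univ i)]
    simp only [if_true, add_zero]
    refine Finset.sum_congr rfl fun j hj => if_neg (Finset.ne_of_mem_erase hj)
  simp only [dunklT_apply, h1, Finset.sum_add_distrib, h2,
    ← Finset.mul_sum, Derivation.leibniz, pderiv_X_self, smul_eq_mul, mul_one,
    smul_add, mul_add, mul_smul_comm]
  ring

theorem dunklT_one (k : ℝ) (i : Fin N) : dunklT k i (1 : Poly N) = 0 := by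
  rw [dunklT_apply, Finset.sum_eq_zero, smul_zero, add_zero, Derivation.map_one_eq_zero]
  intro j _
  by_cases hj : i = j
  · subst hj; simp
  · rw [divDiff_of_ne hj, dividedDiff_one]

theorem end_eq_zero_of_commute_mulX {Z : Module.End ℝ (Poly N)} (h1 : Z 1 = 0)
    (hX : ∀ l f, Z (X l * f) = X l * Z f) : Z = 0 := by
  apply LinearMap.ext
  intro f
  induction f using MvPolynomial.induction_on with
  | C a => rw [← mul_one (C a), ← smul_eq_C_mul, map_smul, h1]; simp
  | add p q hp hq => rw [map_add, hp, hq]; simp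
  | mul_X p l hp => rw [mul_comm, hX, hp]; simp

/-- The commutator of `T_i` and `T_j` kills `1` and commutes with multiplication by every variable,
hence vanishes on all monomials. -/
theorem dunklT_comm (k : ℝ) (i j : Fin N) (f : Poly N) :
    dunklT k i (dunklT k j f) = dunklT k j (dunklT k i f) := by
  by_cases hij : i = j
  · rw [hij]
  have key : dunklT k i * dunklT k j - dunklT k j * dunklT k i = 0 := by
    apply end_eq_zero_of_commute_mulX
    · simp [dunklT_one]
    -- The substantial case is multiplication by `x_i` or `x_j`; the second follows from the first
    -- by exchanging the roles of `i` and `j`.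
    · have main : ∀ i j : Fin N, i ≠ j → ∀ f : Poly N,
          dunklT k i (dunklT k j (X i * f)) - dunklT k j (dunklT k i (X i * f)) =
            X i * (dunklT k i (dunklT k j f) - dunklT k j (dunklT k i f)) := by
        intro i j hij f
        -- Passing `T_j` through `(i s)` alters its index only for `s = j`.
        have e1 : ∀ s, s ∈ Finset.univ.erase i →
            dunklT k j (permOp (swap i s) f) = permOp (swap i s) (dunklT k j f) +
              if s = j then permOp (swap i j) (dunklT k j f) * (-1) +
                permOp (swap i j) (dunklT k i f) else 0 := by
          intro s hs
          rw [permOp_dunklT]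
          split_ifs with h
          · subst h
            rw [permOp_dunklT, permOp_dunklT, swap_apply_right, swap_apply_left]
            ring
          · rw [swap_apply_of_ne_of_ne (Ne.symm hij) (Ne.symm h), add_zero]
        rw [dunklT_X_mul_of_ne k hij, dunklT_X_mul_self]
        simp only [map_sub, map_add, map_smul, map_sum]
        rw [dunklT_X_mul_self, dunklT_X_mul_of_ne k hij, Finset.sum_congr rfl e1,
          Finset.sum_add_distrib, Finset.sum_ite_eq', if_pos (by simp [Ne.symm hij]),
          swap_comm j i, permOp_dunklT k (swap i j) j, permOp_dunklT k (swap i j) i]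
        simp only [swap_apply_right, swap_apply_left, smul_eq_C_mul]
        ring
      intro l f
      simp only [LinearMap.sub_apply, Module.End.mul_apply]
      by_cases hi : l = i
      · subst hi; exact main l j hij f
      by_cases hj : l = j
      · subst hj
        have := main l i (Ne.symm hij) f
        linear_combination -this
      · rw [dunklT_X_mul_of_ne k hi, dunklT_X_mul_of_ne k hj]
        simp only [map_sub, map_smul]
        rw [dunklT_X_mul_of_ne k hi, dunklT_X_mul_of_ne k hj, permOp_dunklT, permOp_dunklT,
          swap_apply_of_ne_of_ne (Ne.symm hij) (Ne.symm hj),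
          swap_apply_of_ne_of_ne hij (Ne.symm hi)]
        ring
  have := LinearMap.congr_fun key f
  simpa [sub_eq_zero] using this

/-- The operator `T_i x_i`. -/
def opD (k : ℝ) (i : Fin N) : Module.End ℝ (Poly N) := dunklT k i * mulX i

theorem opD_apply (k : ℝ) (i : Fin N) (f : Poly N) : opD k i f = dunklT k i (X i * f) := rfl

theorem permOp_opD (k : ℝ) (w : Perm (Fin N)) (i : Fin N) (f : Poly N) :
    permOp w (opD k i f) = opD k (w i) (permOp w f) := by
  rw [opD_apply, permOp_dunklT, permOp_map_mul, permOp_X, opD_apply]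

/-- Moving `x_i` to the right of `T_j` costs a multiple of `(i j)`; what remains, `T_i T_j x_i x_j`,
is symmetric in `i` and `j`. -/
theorem opD_comm (k : ℝ) {i j : Fin N} (hij : i ≠ j) (f : Poly N) :
    opD k i (opD k j f) - opD k j (opD k i f) =
      k • (opD k i (permOp (swap i j) f) - opD k j (permOp (swap i j) f)) := by
  have h : ∀ i j : Fin N, i ≠ j → opD k i (opD k j f) =
      dunklT k i (dunklT k j (X i * (X j * f))) + k • opD k i (permOp (swap i j) f) := by
    intro i j hij
    have e := dunklT_X_mul_of_ne k hij (X j * f)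
    have e2 : X i * dunklT k j (X j * f) =
        dunklT k j (X i * (X j * f)) + k • (X i * permOp (swap i j) f) := by
      rw [e, permOp_map_mul, swap_comm j i]
      simp
    rw [opD_apply, opD_apply, opD_apply, e2, map_add, map_smul]
  rw [h i j hij, h j i (Ne.symm hij), dunklT_comm, mul_left_comm, swap_comm j i, smul_sub]
  ring

theorem opU_apply (k : ℝ) (i : Fin N) (f : Poly N) :
    opU k i f = opD k i f + k • f - k • ∑ j ∈ Finset.univ.filter (· < i),
      permOp (swap i j) f := by
  simp [opU, opD]

/-- Commutativity of Jucys–Murphy elements: for `s < i < j`, conjugation by `(i s)` fixes `j` and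
permutes the indices `t < j`. -/
theorem permOp_swap_sum {i j : Fin N} (hij : i < j) (f : Poly N) :
    ∑ s ∈ Finset.univ.filter (· < i), ∑ t ∈ Finset.univ.filter (· < j),
        permOp (swap i s) (permOp (swap j t) f) =
      ∑ s ∈ Finset.univ.filter (· < i), ∑ t ∈ Finset.univ.filter (· < j),
        permOp (swap j t) (permOp (swap i s) f) := by
  refine Finset.sum_congr rfl fun s hs => ?_
  have hs' : s < i := by simpa using hs
  have hsj : swap i s j = j := swap_apply_of_ne_of_ne hij.ne' (hs'.trans hij).ne'
  have hst : ∀ t, swap i s t < j ↔ t < j := by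
    intro t
    rcases eq_or_ne t i with rfl | h1
    · simp [hs'.trans hij, hij]
    rcases eq_or_ne t s with rfl | h2
    · simp [hs'.trans hij, hij]
    · rw [swap_apply_of_ne_of_ne h1 h2]
  refine Finset.sum_bij' (fun t _ => swap i s t) (fun t _ => swap i s t) ?_ ?_ ?_ ?_ ?_
  · intro t ht; simpa [hst] using ht
  · intro t ht; simpa [hst] using ht
  · intro t _; simp
  · intro t _; simp
  · intro t _
    rw [← permOp_mul_apply, ← permOp_mul_apply, mul_swap_eq_swap_mul, hsj]

/-- For `i < j` the commutator from `opD_comm` is cancelled by the single term `(j i)` of `U_j` that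
fails to commute with `T_i x_i`. The transposition sums commute among themselves. -/
theorem opU_comm (k : ℝ) (i j : Fin N) (f : Poly N) :
    opU k i (opU k j f) = opU k j (opU k i f) := by
  wlog hij : i < j generalizing i j
  · rcases eq_or_lt_of_le (not_lt.1 hij) with rfl | h
    · rfl
    · exact (this j i h).symm
  have hD : ∀ s ∈ Finset.univ.filter (· < i), opD k j (permOp (swap i s) f) =
      permOp (swap i s) (opD k j f) := by
    intro s hs
    have hs' : s < i := by simpa using hs
    rw [permOp_opD, swap_apply_of_ne_of_ne hij.ne' (hs'.trans hij).ne']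
  have hE : ∀ s ∈ Finset.univ.filter (· < j), opD k i (permOp (swap j s) f) =
      permOp (swap j s) (opD k i f) + if s = i then
        opD k i (permOp (swap i j) f) - opD k j (permOp (swap i j) f) else 0 := by
    intro s hs
    rw [permOp_opD]
    split_ifs with h
    · subst h
      rw [swap_apply_right, swap_comm j s]
      ring
    · rw [swap_apply_of_ne_of_ne hij.ne (Ne.symm h), add_zero]
  have hc := opD_comm k hij.ne f
  have hs := permOp_swap_sum hij f
  rw [Finset.sum_comm] at hs
  simp only [opU_apply, map_add, map_sub, map_smul, map_sum, Finset.sum_add_distrib,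
    Finset.sum_sub_distrib, ← Finset.smul_sum]
  rw [Finset.sum_congr rfl hD, Finset.sum_congr rfl hE, Finset.sum_add_distrib,
    Finset.sum_ite_eq', if_pos (by simpa using hij), hs]
  simp only [smul_eq_C_mul] at hc ⊢
  linear_combination hc

/-- The degenerate Hecke relation: the transposition sum of `U_j` has exactly one term, `(j i)`,
more than the conjugate of that of `U_i`. -/
theorem permOp_opU_succ (k : ℝ) {i j : Fin N} (hij : (j : ℕ) = i + 1) (f : Poly N) :
    permOp (swap i j) (opU k i f) = opU k j (permOp (swap i j) f) + k • f := by
  have hlt : i < j := by rw [Fin.lt_def]; omega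
  have hf : Finset.univ.filter (· < j) = insert i (Finset.univ.filter (· < i)) := by
    ext s
    simp only [Finset.mem_filter, Finset.mem_univ, true_and, Finset.mem_insert, Fin.lt_def,
      Fin.ext_iff]
    omega
  rw [opU_apply, opU_apply, hf, Finset.sum_insert (by simp), swap_comm j i, permOp_swap_swap]
  simp only [map_add, map_sub, map_smul, map_sum, permOp_opD, swap_apply_left]
  have : ∀ s ∈ Finset.univ.filter (· < i), permOp (swap i j) (permOp (swap i s) f) =
      permOp (swap j s) (permOp (swap i j) f) := by
    intro s hs
    have hs' : s < i := by simpa using hs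
    rw [← permOp_mul_apply, ← permOp_mul_apply, mul_swap_eq_swap_mul, swap_apply_left,
      swap_apply_of_ne_of_ne hs'.ne (hs'.trans hlt).ne]
  rw [Finset.sum_congr rfl this, smul_add]
  ring

theorem permOp_opU_succ' (k : ℝ) {i j : Fin N} (hij : (j : ℕ) = i + 1) (f : Poly N) :
    permOp (swap i j) (opU k j f) = opU k i (permOp (swap i j) f) - k • f := by
  apply permOp_injective (swap i j)
  rw [map_sub, map_smul, permOp_opU_succ k hij, permOp_swap_swap, permOp_swap_swap]
  ring

theorem permOp_opU_of_ne (k : ℝ) {i j l : Fin N} (hij : (j : ℕ) = i + 1) (hi : l ≠ i)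
    (hj : l ≠ j) (f : Poly N) :
    permOp (swap i j) (opU k l f) = opU k l (permOp (swap i j) f) := by
  rw [opU_apply, opU_apply]
  simp only [map_add, map_sub, map_smul, map_sum, permOp_opD, swap_apply_of_ne_of_ne hi hj]
  congr 2
  have hlt : ∀ s, swap i j s < l ↔ s < l := by
    intro s
    have : (l : ℕ) ≠ i := fun h => hi (Fin.ext h)
    have : (l : ℕ) ≠ j := fun h => hj (Fin.ext h)
    rcases eq_or_ne s i with rfl | h1
    · rw [swap_apply_left, Fin.lt_def, Fin.lt_def]; omega
    rcases eq_or_ne s j with rfl | h2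
    · rw [swap_apply_right, Fin.lt_def, Fin.lt_def]; omega
    · rw [swap_apply_of_ne_of_ne h1 h2]
  refine Finset.sum_bij' (fun t _ => swap i j t) (fun t _ => swap i j t) ?_ ?_ ?_ ?_ ?_
  · intro t ht; simpa [hlt] using ht
  · intro t ht; simpa [hlt] using ht
  · intro t _; simp
  · intro t _; simp
  · intro t _
    rw [← permOp_mul_apply, ← permOp_mul_apply, mul_swap_eq_swap_mul,
      swap_apply_of_ne_of_ne hi hj]

end Operators

/-! ### The polynomials `p_γ` and the action of `T_i x_i` on them -/

section GeneratingFunction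

variable {N : ℕ}

/-- The series `(1 - x_i t)^{-c}` in one variable `t`. -/
def binPS (c : ℝ) (i : Fin N) : PowerSeries (Poly N) :=
  PowerSeries.mk fun n => C ((ascPochhammer ℝ n).eval c / (n.factorial : ℝ)) * X i ^ n

theorem coeff_binPS (c : ℝ) (i : Fin N) (n : ℕ) : PowerSeries.coeff n (binPS c i) =
    C ((ascPochhammer ℝ n).eval c / (n.factorial : ℝ)) * X i ^ n := by
  simp [binPS]

theorem coeff_binPS_one (i : Fin N) (n : ℕ) :
    PowerSeries.coeff n (binPS 1 i) = (X i ^ n : Poly N) := by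
  rw [coeff_binPS, ascPochhammer_eval_one, div_self (by positivity), C_1, one_mul]

/-- A series in the single variable `y_j`. -/
def embPS (j : Fin N) (f : PowerSeries (Poly N)) : MvPowerSeries (Fin N) (Poly N) :=
  fun d => if d = Finsupp.single j (d j) then PowerSeries.coeff (d j) f else 0

theorem coeff_embPS (j : Fin N) (f : PowerSeries (Poly N)) (d : Fin N →₀ ℕ) :
    MvPowerSeries.coeff d (embPS j f) =
      if d = Finsupp.single j (d j) then PowerSeries.coeff (d j) f else 0 := rfl

theorem binSeries_eq (c : ℝ) (i j : Fin N) : binSeries c i j = embPS j (binPS c i) := by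
  funext d
  simp only [binSeries, embPS, coeff_binPS]

theorem embPS_mul (j : Fin N) (f g : PowerSeries (Poly N)) :
    embPS j (f * g) = embPS j f * embPS j g := by
  ext1 d
  rw [MvPowerSeries.coeff_mul, coeff_embPS]
  split_ifs with h
  · rw [h, Finsupp.antidiagonal_single, Finset.sum_map, PowerSeries.coeff_mul]
    simp [coeff_embPS]
  · rw [Finset.sum_eq_zero]
    rintro ⟨a, b⟩ hab
    rw [Finset.HasAntidiagonal.mem_antidiagonal] at hab
    simp only [coeff_embPS]
    by_cases ha : a = Finsupp.single j (a j)
    · by_cases hb : b = Finsupp.single j (b j)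
      · exfalso
        apply h
        simp only at hab
        rw [← hab, Finsupp.add_apply, Finsupp.single_add, ← ha, ← hb]
      · rw [if_neg hb, mul_zero]
    · rw [if_neg ha, zero_mul]

theorem embPS_one (j : Fin N) : embPS j (1 : PowerSeries (Poly N)) = 1 := by
  ext1 d
  rw [coeff_embPS, MvPowerSeries.coeff_one]
  by_cases hd : d = 0
  · subst hd; simp
  · rw [if_neg hd]
    split_ifs with h
    · rw [PowerSeries.coeff_one, if_neg]
      intro h0
      rw [h0, Finsupp.single_zero] at h
      exact hd h
    · rfl

theorem embPS_prod {ι : Type*} (s : Finset ι) (j : Fin N) (f : ι → PowerSeries (Poly N)) :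
    embPS j (∏ i ∈ s, f i) = ∏ i ∈ s, embPS j (f i) := by
  classical
  induction s using Finset.induction_on with
  | empty => simp [embPS_one]
  | insert a s ha ih => rw [Finset.prod_insert ha, Finset.prod_insert ha, embPS_mul, ih]

theorem coeff_prod_embPS (s : Finset (Fin N)) (f : Fin N → PowerSeries (Poly N))
    (d : Fin N →₀ ℕ) : MvPowerSeries.coeff d (∏ j ∈ s, embPS j (f j)) =
      if d.support ⊆ s then ∏ j ∈ s, PowerSeries.coeff (d j) (f j) else 0 := by
  induction s using Finset.induction_on generalizing d with
  | empty =>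
    rw [Finset.prod_empty, Finset.prod_empty, MvPowerSeries.coeff_one]
    simp [Finset.subset_empty]
  | insert j s hj ih =>
    rw [Finset.prod_insert hj, MvPowerSeries.coeff_mul]
    have hle : Finsupp.single j (d j) ≤ d := by
      rw [Finsupp.single_le_iff]
    have hsub : Finsupp.single j (d j) + d.erase j = d := Finsupp.single_add_erase j d
    rw [Finset.sum_eq_single (Finsupp.single j (d j), d.erase j)]
    · simp only
      rw [ih, coeff_embPS, if_pos (by simp), Finset.prod_insert hj, Finsupp.support_erase]
      simp only [Finsupp.single_eq_same, Finset.subset_insert_iff]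
      split_ifs
      · congr 1
        refine Finset.prod_congr rfl fun i hi => ?_
        rw [Finsupp.erase_ne (ne_of_mem_of_not_mem hi hj)]
      · rw [mul_zero]
    · rintro ⟨a, b⟩ hab hne
      rw [Finset.HasAntidiagonal.mem_antidiagonal] at hab
      simp only at hab ⊢
      rw [ih, coeff_embPS]
      by_cases ha : a = Finsupp.single j (a j)
      · by_cases hb : b.support ⊆ s
        · exfalso
          have hbj : b j = 0 := by
            by_contra h
            exact hj (hb (Finsupp.mem_support_iff.2 h))
          have haj : a j = d j := by rw [← hab]; simp [hbj]
          apply hne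
          have ha' : a = Finsupp.single j (d j) := by rw [← haj]; exact ha
          rw [Prod.mk.injEq]
          refine ⟨ha', ?_⟩
          apply add_left_cancel (a := a)
          rw [hab, ha', hsub]
        · rw [if_neg hb, mul_zero]
      · rw [if_neg ha, zero_mul]
    · intro h
      exact absurd (Finset.HasAntidiagonal.mem_antidiagonal.2 hsub) h

/-- The coefficient of `t^n` in `∏_i (1 - x_i t)^{-k}`. -/
def symC (k : ℝ) (n : ℕ) : Poly N := PowerSeries.coeff n (∏ i : Fin N, binPS k i)

/-- The coefficient of `t^n` in `(1 - x_j t)^{-1} ∏_i (1 - x_i t)^{-k}`. -/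
def facP (k : ℝ) (j : Fin N) (n : ℕ) : Poly N :=
  PowerSeries.coeff n (binPS 1 j * ∏ i : Fin N, binPS k i)

/-- Grouping the generating function by the `y`-variables leaves one series in each `y_j`, so
coefficients multiply. -/
theorem polyP_eq_prod (k : ℝ) (γ : Fin N → ℕ) : polyP k γ = ∏ j, facP k j (γ j) := by
  have h : genF N k = ∏ j : Fin N, embPS j (binPS 1 j * ∏ i : Fin N, binPS k i) := by
    simp only [genF, binSeries_eq, Finset.prod_mul_distrib, embPS_mul, embPS_prod]
    rw [Finset.prod_comm]
  rw [polyP, h, coeff_prod_embPS, if_pos (Finset.subset_univ _)]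
  rfl

theorem facP_eq_sum (k : ℝ) (j : Fin N) (n : ℕ) :
    facP k j n = ∑ q ∈ Finset.HasAntidiagonal.antidiagonal n, X j ^ q.1 * symC k q.2 := by
  rw [facP, PowerSeries.coeff_mul]
  simp only [coeff_binPS_one, symC]

theorem symC_zero (k : ℝ) : symC k 0 = (1 : Poly N) := by
  rw [symC, PowerSeries.coeff_zero_eq_constantCoeff_apply, map_prod]
  refine Finset.prod_eq_one fun i _ => ?_
  rw [← PowerSeries.coeff_zero_eq_constantCoeff_apply, coeff_binPS]
  simp

theorem facP_zero (k : ℝ) (j : Fin N) : facP k j 0 = 1 := by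
  simp [facP_eq_sum, symC_zero]

/-- Comes from `1 - x_j t` cancelling one factor. The inhomogeneous term is symmetric in the
variables, which is what `pair_identity` exploits. -/
theorem facP_succ (k : ℝ) (j : Fin N) (n : ℕ) :
    facP k j (n + 1) = X j * facP k j n + symC k (n + 1) := by
  rw [facP_eq_sum, Finset.Nat.antidiagonal_succ, Finset.sum_cons, Finset.sum_map, facP_eq_sum,
    Finset.mul_sum, add_comm]
  simp [pow_succ', mul_assoc]

theorem permOp_symC (k : ℝ) (w : Perm (Fin N)) (n : ℕ) : permOp w (symC k n) = symC k n := by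
  have h : ∀ i, PowerSeries.map (rename w : Poly N →ₐ[ℝ] Poly N).toRingHom (binPS k i) =
      binPS k (w i) := by
    intro i
    ext1 n
    rw [PowerSeries.coeff_map, coeff_binPS, coeff_binPS]
    simp
  have h2 : PowerSeries.map (rename w : Poly N →ₐ[ℝ] Poly N).toRingHom
      (∏ i : Fin N, binPS k i) = ∏ i : Fin N, binPS k i := by
    rw [map_prod, ← Equiv.prod_comp w (fun i => binPS k i)]
    exact Finset.prod_congr rfl fun i _ => h i
  have h3 := congrArg (PowerSeries.coeff n) h2
  rw [PowerSeries.coeff_map] at h3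
  exact h3

theorem permOp_facP (k : ℝ) (w : Perm (Fin N)) (j : Fin N) (n : ℕ) :
    permOp w (facP k j n) = facP k (w j) n := by
  simp only [facP_eq_sum, map_sum, permOp_map_mul, permOp_symC]
  simp [permOp_apply]

theorem permOp_polyP (k : ℝ) (w : Perm (Fin N)) (γ : Fin N → ℕ) :
    permOp w (polyP k γ) = polyP k (compAct w γ) := by
  rw [polyP_eq_prod, polyP_eq_prod, ← Equiv.prod_comp w (fun j => facP k j (compAct w γ j))]
  rw [permOp_apply, map_prod]
  refine Finset.prod_congr rfl fun j _ => ?_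
  rw [← permOp_apply, permOp_facP]
  simp [compAct]

theorem binPS_isHomogeneous (c : ℝ) (i : Fin N) (n : ℕ) :
    (PowerSeries.coeff n (binPS c i)).IsHomogeneous n := by
  rw [coeff_binPS]
  simpa using (isHomogeneous_C (Fin N) _).mul (isHomogeneous_X_pow (R := ℝ) i n)

theorem isHomogeneous_coeff_mul {f g : PowerSeries (Poly N)}
    (hf : ∀ n, (PowerSeries.coeff n f).IsHomogeneous n)
    (hg : ∀ n, (PowerSeries.coeff n g).IsHomogeneous n) (n : ℕ) :
    (PowerSeries.coeff n (f * g)).IsHomogeneous n := by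
  rw [PowerSeries.coeff_mul]
  refine IsHomogeneous.sum _ _ _ fun q hq => ?_
  rw [← Finset.HasAntidiagonal.mem_antidiagonal.1 hq]
  exact (hf _).mul (hg _)

theorem isHomogeneous_coeff_prod {ι : Type*} (s : Finset ι) {f : ι → PowerSeries (Poly N)}
    (hf : ∀ i n, (PowerSeries.coeff n (f i)).IsHomogeneous n) (n : ℕ) :
    (PowerSeries.coeff n (∏ i ∈ s, f i)).IsHomogeneous n := by
  classical
  induction s using Finset.induction_on generalizing n with
  | empty =>
    rw [Finset.prod_empty, PowerSeries.coeff_one]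
    split_ifs with h
    · subst h; exact isHomogeneous_one _ _
    · exact isHomogeneous_zero _ _ _
  | insert a s ha ih =>
    rw [Finset.prod_insert ha]
    exact isHomogeneous_coeff_mul (hf a) ih n

theorem symC_isHomogeneous (k : ℝ) (n : ℕ) : (symC k n : Poly N).IsHomogeneous n :=
  isHomogeneous_coeff_prod _ (binPS_isHomogeneous k) n

theorem facP_isHomogeneous (k : ℝ) (j : Fin N) (n : ℕ) : (facP k j n).IsHomogeneous n :=
  isHomogeneous_coeff_mul (binPS_isHomogeneous 1 j)
    (isHomogeneous_coeff_prod _ (binPS_isHomogeneous k)) n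

theorem polyP_isHomogeneous (k : ℝ) (γ : Fin N → ℕ) :
    (polyP k γ).IsHomogeneous (∑ i, γ i) := by
  rw [polyP_eq_prod]
  exact IsHomogeneous.prod _ _ _ fun j _ => facP_isHomogeneous k j _

/-- The coefficientwise partial derivative of a power series over the polynomials. -/
def pderivPS (i : Fin N) (f : PowerSeries (Poly N)) : PowerSeries (Poly N) :=
  PowerSeries.mk fun n => pderiv i (PowerSeries.coeff n f)

theorem pderivPS_mul (i : Fin N) (f g : PowerSeries (Poly N)) :
    pderivPS i (f * g) = pderivPS i f * g + f * pderivPS i g := by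
  ext1 n
  simp only [pderivPS, PowerSeries.coeff_mk, PowerSeries.coeff_mul, map_add, map_sum,
    Derivation.leibniz, smul_eq_mul]
  rw [← Finset.sum_add_distrib]
  refine Finset.sum_congr rfl fun q _ => ?_
  ring

theorem pderivPS_binPS_of_ne (k : ℝ) {i l : Fin N} (h : l ≠ i) : pderivPS i (binPS k l) = 0 := by
  ext1 n
  simp [pderivPS, coeff_binPS, Derivation.leibniz_pow, pderiv_X_of_ne h]

theorem pderivPS_prod_of_notMem (k : ℝ) (i : Fin N) (s : Finset (Fin N)) (hi : i ∉ s) :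
    pderivPS i (∏ l ∈ s, binPS k l) = 0 := by
  induction s using Finset.induction_on with
  | empty =>
    ext1 n
    simp only [Finset.prod_empty, pderivPS, PowerSeries.coeff_mk, PowerSeries.coeff_one]
    split_ifs <;> simp
  | insert a s ha ih =>
    rw [Finset.mem_insert, not_or] at hi
    rw [Finset.prod_insert ha, pderivPS_mul, ih hi.2, pderivPS_binPS_of_ne k (Ne.symm hi.1)]
    simp

theorem one_sub_mul_binPS_one (i : Fin N) :
    (1 - PowerSeries.C (X i) * PowerSeries.X) * binPS 1 i = (1 : PowerSeries (Poly N)) := by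
  ext1 n
  rw [sub_mul, one_mul, mul_assoc, map_sub, PowerSeries.coeff_C_mul, coeff_binPS_one]
  cases n with
  | zero => simp
  | succ n => simp [PowerSeries.coeff_succ_X_mul, coeff_binPS_one, PowerSeries.coeff_one, pow_succ']

theorem one_sub_mul_pderivPS_binPS (k : ℝ) (i : Fin N) :
    (1 - PowerSeries.C (X i) * PowerSeries.X) * pderivPS i (binPS k i) =
      PowerSeries.C (C k : Poly N) * (PowerSeries.X * binPS k i) := by
  ext1 n
  rw [sub_mul, one_mul, mul_assoc, map_sub, PowerSeries.coeff_C_mul, PowerSeries.coeff_C_mul]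
  cases n with
  | zero => simp [pderivPS, coeff_binPS]
  | succ n =>
    rw [PowerSeries.coeff_succ_X_mul, PowerSeries.coeff_succ_X_mul]
    simp only [pderivPS, PowerSeries.coeff_mk, coeff_binPS, Derivation.leibniz, pderiv_C,
      Derivation.leibniz_pow, pderiv_X_self, smul_eq_mul, mul_one,
      ascPochhammer_succ_eval, Nat.factorial_succ, Nat.add_sub_cancel]
    have hf : (n.factorial : ℝ) ≠ 0 := by positivity
    have hn : (n : ℝ) + 1 ≠ 0 := by positivity
    have e1 : (C ((ascPochhammer ℝ n).eval k * (k + n) / ((n + 1) * n.factorial : ℕ)) : Poly N) *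
        ((n + 1 : ℕ) : Poly N) = C ((ascPochhammer ℝ n).eval k / n.factorial) * C (k + n) := by
      rw [← map_natCast C, ← map_mul, ← map_mul]
      congr 1
      push_cast
      field_simp
    have e2 : (X i : Poly N) * ((n : Poly N) * X i ^ (n - 1)) = (n : Poly N) * X i ^ n := by
      cases n with
      | zero => simp
      | succ n => rw [Nat.add_sub_cancel]; ring
    have e3 : (C (k + (n : ℝ)) : Poly N) = C k + (n : Poly N) := by simp
    rw [e3] at e1
    simp only [nsmul_eq_mul] at e2 ⊢
    linear_combination X i ^ n * e1 - C ((ascPochhammer ℝ n).eval k / n.factorial) * e2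

theorem pderivPS_binPS_self (k : ℝ) (i : Fin N) :
    pderivPS i (binPS k i) =
      PowerSeries.C (C k : Poly N) * (PowerSeries.X * (binPS 1 i * binPS k i)) := by
  linear_combination binPS 1 i * one_sub_mul_pderivPS_binPS k i -
    pderivPS i (binPS k i) * one_sub_mul_binPS_one i

theorem pderivPS_prod (k : ℝ) (i : Fin N) :
    pderivPS i (∏ l : Fin N, binPS k l) =
      PowerSeries.C (C k : Poly N) * (PowerSeries.X * (binPS 1 i * ∏ l : Fin N, binPS k l)) := by
  rw [← Finset.mul_prod_erase _ _ (Finset.mem_univ i), pderivPS_mul,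
    pderivPS_prod_of_notMem k i _ (by simp), pderivPS_binPS_self]
  ring

/-- Logarithmic differentiation of `∏_l (1 - x_l t)^{-k}` in `x_i` gives the factor `k t (1 - x_i
t)⁻¹`. -/
theorem pderiv_symC_succ (k : ℝ) (i : Fin N) (n : ℕ) :
    pderiv i (symC k (n + 1)) = C k * facP k i n := by
  have h := congrArg (PowerSeries.coeff (n + 1)) (pderivPS_prod k i)
  rw [PowerSeries.coeff_C_mul, PowerSeries.coeff_succ_X_mul] at h
  rw [pderivPS, PowerSeries.coeff_mk] at h
  exact h

theorem dividedDiff_facP_zero (k : ℝ) {i l : Fin N} (h : i ≠ l) :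
    dividedDiff i l h (facP k i 0) = 0 := by
  rw [facP_zero, dividedDiff_one]

theorem dividedDiff_facP (k : ℝ) {i l : Fin N} (h : i ≠ l) (n : ℕ) :
    (X i - X l) * dividedDiff i l h (facP k i n) = facP k i n - facP k l n := by
  rw [dividedDiff_spec, permOp_facP, swap_apply_left]

theorem dividedDiff_facP_comm (k : ℝ) {i l : Fin N} (h : i ≠ l) (n : ℕ) :
    dividedDiff l i h.symm (facP k l n) = dividedDiff i l h (facP k i n) := by
  apply mul_left_cancel₀ (X_sub_X_ne_zero h)
  linear_combination -dividedDiff_facP k h.symm n - dividedDiff_facP k h n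

theorem dividedDiff_facP_succ (k : ℝ) {i l : Fin N} (h : i ≠ l) (n : ℕ) :
    dividedDiff i l h (facP k i (n + 1)) = X l * dividedDiff i l h (facP k i n) + facP k i n := by
  apply eq_dividedDiff
  rw [permOp_facP, swap_apply_left, facP_succ, facP_succ]
  linear_combination X l * dividedDiff_facP k h n

theorem pderiv_facP_of_ne (k : ℝ) {i l : Fin N} (h : i ≠ l) (n : ℕ) :
    pderiv i (facP k l n) = C k * dividedDiff i l h (facP k i n) := by
  induction n with
  | zero => rw [dividedDiff_facP_zero, facP_zero, Derivation.map_one_eq_zero, mul_zero]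
  | succ n ih =>
    rw [facP_succ, map_add, Derivation.leibniz, pderiv_X_of_ne (Ne.symm h), pderiv_symC_succ, ih,
      dividedDiff_facP_succ]
    simp only [smul_eq_mul]
    ring

/-- Euler's identity for homogeneous polynomials trades the derivative in `x_i` for those in the
other variables, which are divided differences. -/
theorem X_mul_pderiv_facP_self (k : ℝ) (i : Fin N) (n : ℕ) :
    X i * pderiv i (facP k i n) = (n : Poly N) * facP k i n -
      C k * ∑ l ∈ Finset.univ.erase i, X l * divDiff i l (facP k i n) := by
  have h := (facP_isHomogeneous k i n).sum_X_mul_pderiv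
  rw [← Finset.add_sum_erase _ _ (Finset.mem_univ i), nsmul_eq_mul] at h
  rw [eq_sub_iff_add_eq, ← h, Finset.mul_sum]
  congr 1
  refine Finset.sum_congr rfl fun l hl => ?_
  have hl' := Finset.ne_of_mem_erase hl
  rw [divDiff_of_ne hl'.symm, pderiv_facP_of_ne k hl', dividedDiff_facP_comm k hl'.symm]
  ring

/-- Induction moving one unit from `q` to `p`: each move changes the left side by a multiple of `x -
y`, because `a (n+1) - x a n` and `b (n+1) - y b n` agree. It performs the division by `x_i - x_j`
explicitly, with products `a_u b_v` as the outcome. -/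
theorem pair_identity {R : Type*} [CommRing R] (x y : R) (a b : ℕ → R) (ha : a 0 = 1)
    (hb : b 0 = 1) (hab : ∀ n, a (n + 1) - x * a n = b (n + 1) - y * b n) (q p : ℕ) :
    x * a p * a q + y * b p * b q - y * (a p * b q + b p * a q) =
      (x - y) * (∑ t ∈ Finset.range (q + 1), a (p + q - t) * b t -
        ∑ t ∈ Finset.range q, a t * b (p + q - t)) := by
  induction q generalizing p with
  | zero => simp [ha, hb]; ring
  | succ q ih =>
    have h := ih (p + 1)
    rw [Finset.sum_range_succ, Finset.sum_range_succ (fun t => a t * b (p + (q + 1) - t))]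
    have e1 : p + 1 + q = p + (q + 1) := by ring
    have e2 : p + (q + 1) - (q + 1) = p := by omega
    have e3 : p + (q + 1) - q = p + 1 := by omega
    rw [e1] at h
    rw [e2, e3]
    have hp := hab p
    have hq := hab q
    linear_combination h + (b (q + 1) - a (q + 1)) * hp - (b (p + 1) - a (p + 1)) * hq

theorem derivation_prod {ι : Type*} [DecidableEq ι] (D : Derivation ℝ (Poly N) (Poly N))
    (s : Finset ι) (f : ι → Poly N) :
    D (∏ j ∈ s, f j) = ∑ j ∈ s, D (f j) * ∏ l ∈ s.erase j, f l := by
  induction s using Finset.induction_on with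
  | empty => simp
  | insert a s ha ih =>
    rw [Finset.prod_insert ha, Derivation.leibniz, Finset.sum_insert ha, ih,
      Finset.erase_insert ha, smul_eq_mul, smul_eq_mul, add_comm, Finset.mul_sum]
    congr 1
    · ring
    · refine Finset.sum_congr rfl fun j hj => ?_
      have hja : a ≠ j := fun h => ha (h ▸ hj)
      rw [Finset.erase_insert_of_ne hja, Finset.prod_insert (by simp [ha])]
      ring

/-- The composition `γ` with the entries at `i` and `j` replaced by `u` and `v`. -/
def setPair (γ : Fin N → ℕ) (i j : Fin N) (u v : ℕ) : Fin N → ℕ :=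
  Function.update (Function.update γ i u) j v

theorem setPair_left (γ : Fin N → ℕ) {i j : Fin N} (h : i ≠ j) (u v : ℕ) :
    setPair γ i j u v i = u := by
  simp [setPair, h]

theorem setPair_right (γ : Fin N → ℕ) (i j : Fin N) (u v : ℕ) :
    setPair γ i j u v j = v := by
  simp [setPair]

theorem setPair_of_ne (γ : Fin N → ℕ) {i j l : Fin N} (hi : l ≠ i) (hj : l ≠ j) (u v : ℕ) :
    setPair γ i j u v l = γ l := by
  simp [setPair, hi, hj]

theorem prod_eq_pair_mul (f : Fin N → Poly N) {i j : Fin N} (h : i ≠ j) :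
    ∏ l, f l = f i * f j * ∏ l ∈ (Finset.univ.erase i).erase j, f l := by
  rw [mul_assoc, Finset.mul_prod_erase _ _ (by simp [h.symm]),
    Finset.mul_prod_erase _ _ (Finset.mem_univ i)]

theorem polyP_setPair (k : ℝ) (γ : Fin N → ℕ) {i j : Fin N} (h : i ≠ j) (u v : ℕ) :
    polyP k (setPair γ i j u v) = facP k i u * facP k j v *
      ∏ l ∈ (Finset.univ.erase i).erase j, facP k l (γ l) := by
  rw [polyP_eq_prod, prod_eq_pair_mul _ h, setPair_left γ h, setPair_right]
  congr 1
  refine Finset.prod_congr rfl fun l hl => ?_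
  simp only [Finset.mem_erase, Finset.mem_univ, and_true] at hl
  rw [setPair_of_ne γ hl.2 hl.1]

/-- The contribution of the pair `i, j` to `T_i x_i p_γ`. -/
def pairTerm (k : ℝ) (γ : Fin N → ℕ) (i j : Fin N) : Poly N :=
  ∑ t ∈ Finset.range (min (γ i) (γ j) + 1), polyP k (setPair γ i j (γ i + γ j - t) t) -
    ∑ t ∈ Finset.range (min (γ i) (γ j)), polyP k (setPair γ i j t (γ i + γ j - t))

theorem pairTerm_spec (k : ℝ) (γ : Fin N → ℕ) {i j : Fin N} (h : i ≠ j) :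
    (X i - X j) * pairTerm k γ i j =
      (X i * facP k i (γ i) * facP k i (γ j) + X j * facP k j (γ i) * facP k j (γ j) -
        X j * (facP k i (γ i) * facP k j (γ j) + facP k j (γ i) * facP k i (γ j))) *
      ∏ l ∈ (Finset.univ.erase i).erase j, facP k l (γ l) := by
  have key := pair_identity (X i : Poly N) (X j) (facP k i) (facP k j) (facP_zero k i)
    (facP_zero k j) (fun n => by rw [facP_succ, facP_succ]; ring)
  simp only [pairTerm, polyP_setPair k γ h, ← Finset.sum_mul, ← sub_mul]
  rw [← mul_assoc]
  congr 1
  rcases le_total (γ i) (γ j) with hle | hle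
  · rw [min_eq_left hle, add_comm (γ i) (γ j), ← key]
    ring
  · rw [min_eq_right hle, ← key]

/-- Both the derivative and the divided differences split into contributions of pairs `i, j`, the
other factors of `p_γ` being spectators; each pair is then evaluated by `pair_identity`. -/
theorem opD_polyP (k : ℝ) (i : Fin N) (γ : Fin N → ℕ) :
    opD k i (polyP k γ) = ((γ i : ℝ) + 1) • polyP k γ +
      k • ∑ j ∈ Finset.univ.erase i, pairTerm k γ i j := by
  set R : Fin N → Poly N := fun j => ∏ l ∈ (Finset.univ.erase i).erase j, facP k l (γ l) with hR
  have hp : ∀ j, i ≠ j → polyP k γ = facP k i (γ i) * facP k j (γ j) * R j := by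
    intro j hj
    rw [polyP_eq_prod, prod_eq_pair_mul _ hj]
  have hder : X i * pderiv i (polyP k γ) = (γ i : Poly N) * polyP k γ + C k * ∑ j ∈ Finset.univ.erase i,
      (X i * facP k i (γ i) * divDiff i j (facP k i (γ j)) -
        X j * divDiff i j (facP k i (γ i)) * facP k j (γ j)) * R j := by
    have h0 : polyP k γ = facP k i (γ i) * ∏ l ∈ Finset.univ.erase i, facP k l (γ l) := by
      rw [polyP_eq_prod, Finset.mul_prod_erase _ (fun l => facP k l (γ l)) (Finset.mem_univ i)]
    rw [polyP_eq_prod, derivation_prod, ← Finset.add_sum_erase _ _ (Finset.mem_univ i), mul_add,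
      ← mul_assoc, X_mul_pderiv_facP_self, sub_mul, mul_assoc, ← h0, polyP_eq_prod,
      sub_add, sub_eq_add_neg]
    congr 1
    rw [mul_assoc, Finset.sum_mul, Finset.mul_sum, Finset.mul_sum, Finset.mul_sum,
      ← Finset.sum_sub_distrib, ← Finset.sum_neg_distrib]
    refine Finset.sum_congr rfl fun j hj => ?_
    have hj' : i ≠ j := (Finset.ne_of_mem_erase hj).symm
    rw [divDiff_of_ne hj', pderiv_facP_of_ne k hj',
      ← Finset.mul_prod_erase (Finset.univ.erase i) _ hj,
      ← Finset.mul_prod_erase (Finset.univ.erase j) _ (a := i) (by simp [hj']),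
      Finset.erase_right_comm (a := j) (b := i)]
    simp only [hR]
    ring
  -- Checked after multiplication by `x_i - x_j`, where every divided difference becomes an ordinary
  -- difference.
  have hpair : ∀ j ∈ Finset.univ.erase i, pairTerm k γ i j =
      (X i * facP k i (γ i) * divDiff i j (facP k i (γ j)) -
        X j * divDiff i j (facP k i (γ i)) * facP k j (γ j)) * R j +
      divDiff i j (X i * polyP k γ) := by
    intro j hj
    have hj' : i ≠ j := (Finset.ne_of_mem_erase hj).symm
    apply mul_left_cancel₀ (X_sub_X_ne_zero hj')
    have hRs : permOp (swap i j) (R j) = R j := by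
      simp only [hR]
      rw [permOp_apply, map_prod]
      refine Finset.prod_congr rfl fun l hl => ?_
      simp only [Finset.mem_erase, Finset.mem_univ, and_true] at hl
      rw [← permOp_apply, permOp_facP, swap_apply_of_ne_of_ne hl.2 hl.1]
    rw [pairTerm_spec k γ hj', divDiff_of_ne hj', mul_add (X i - X j), dividedDiff_spec, hp j hj']
    simp only [permOp_map_mul, permOp_X, permOp_facP, hRs, swap_apply_left, swap_apply_right]
    linear_combination -X i * facP k i (γ i) * R j * dividedDiff_facP k hj' (γ j) +
      X j * facP k j (γ j) * R j * dividedDiff_facP k hj' (γ i)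
  have hsum : ∑ j, divDiff i j (X i * polyP k γ) =
      ∑ j ∈ Finset.univ.erase i, divDiff i j (X i * polyP k γ) := by
    rw [← Finset.add_sum_erase _ _ (Finset.mem_univ i)]
    simp
  rw [opD_apply, dunklT_apply, Derivation.leibniz, pderiv_X_self, smul_eq_mul, smul_eq_mul, hder,
    hsum, Finset.sum_congr rfl hpair, Finset.sum_add_distrib]
  simp only [smul_eq_C_mul, map_add, map_natCast, map_one]
  ring

end GeneratingFunction

/-! ### Linear independence of the `p_γ` by positivity -/

section Independence

variable {N : ℕ}

/-- The power sum `x_1^r + ⋯ + x_N^r`. -/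
def powSum (N r : ℕ) : Poly N := ∑ j, X j ^ r

/-- Newton's identity, obtained from Euler's identity and `pderiv_symC_succ`. -/
theorem natCast_mul_symC (k : ℝ) (n : ℕ) : ((n + 1 : ℕ) : Poly N) * symC k (n + 1) =
    C k * ∑ q ∈ Finset.HasAntidiagonal.antidiagonal n, powSum N (q.1 + 1) * symC k q.2 := by
  have h := (symC_isHomogeneous (N := N) k (n + 1)).sum_X_mul_pderiv
  rw [nsmul_eq_mul] at h
  rw [← h]
  simp only [pderiv_symC_succ, facP_eq_sum, powSum, Finset.sum_mul, Finset.mul_sum]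
  rw [Finset.sum_comm]
  refine Finset.sum_congr rfl fun q _ => Finset.sum_congr rfl fun j _ => ?_
  ring

/-- Newton's identity for `(1 - x_j t)⁻¹ ∏_i (1 - x_i t)^{-k}`: the operator `t d/dt` applied to its
logarithm has coefficients `x_j^r + k (x_1^r + ⋯ + x_N^r)`. -/
theorem natCast_mul_facP (k : ℝ) (j : Fin N) (n : ℕ) : (n : Poly N) * facP k j n =
    ∑ r ∈ Finset.range n, (X j ^ (r + 1) + C k * powSum N (r + 1)) * facP k j (n - (r + 1)) := by
  induction n with
  | zero => simp
  | succ n ih =>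
    have hs : ∑ q ∈ Finset.HasAntidiagonal.antidiagonal n, powSum N (q.1 + 1) * symC k q.2 =
        powSum N (n + 1) + ∑ r ∈ Finset.range n, powSum N (r + 1) * symC k (n - r) := by
      rw [Finset.Nat.sum_antidiagonal_eq_sum_range_succ (fun a b => powSum N (a + 1) * symC k b),
        Finset.sum_range_succ, Nat.sub_self, symC_zero]
      ring
    have h1 : ∀ r ∈ Finset.range n, (X j ^ (r + 1) + C k * powSum N (r + 1)) *
        facP k j (n + 1 - (r + 1)) =
        X j * ((X j ^ (r + 1) + C k * powSum N (r + 1)) * facP k j (n - (r + 1))) +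
          (X j ^ (r + 1) * symC k (n - r) + C k * (powSum N (r + 1) * symC k (n - r))) := by
      intro r hr
      have hr' : r < n := Finset.mem_range.1 hr
      obtain ⟨m, rfl⟩ := Nat.exists_eq_add_of_lt hr'
      have e1 : r + m + 1 + 1 - (r + 1) = m + 1 := by omega
      have e2 : r + m + 1 - (r + 1) = m := by omega
      have e3 : r + m + 1 - r = m + 1 := by omega
      rw [e1, e2, e3, facP_succ]
      ring
    have h2 : facP k j n = X j ^ n + ∑ r ∈ Finset.range n, X j ^ r * symC k (n - r) := by
      rw [facP_eq_sum, Finset.Nat.sum_antidiagonal_eq_sum_range_succ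
        (fun a b => X j ^ a * symC k b), Finset.sum_range_succ, Nat.sub_self, symC_zero]
      ring
    have h3 := natCast_mul_symC (N := N) k n
    rw [hs] at h3
    rw [Finset.sum_range_succ, Finset.sum_congr rfl h1, Finset.sum_add_distrib, ← Finset.mul_sum,
      ← ih, Finset.sum_add_distrib, ← Finset.mul_sum, Nat.sub_self, facP_zero, facP_succ]
    have h4 : ∑ r ∈ Finset.range n, X j ^ (r + 1) * symC k (n - r) =
        X j * ∑ r ∈ Finset.range n, X j ^ r * symC k (n - r) := by
      rw [Finset.mul_sum]
      refine Finset.sum_congr rfl fun r _ => ?_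
      ring
    rw [h4]
    have e3 : ((n + 1 : ℕ) : Poly N) = (n : Poly N) + 1 := by simp
    rw [e3] at h3 ⊢
    linear_combination h3 + X j * h2

/-- The linear map `x^d ↦ p_d`. -/
def monToP (N : ℕ) (k : ℝ) : Poly N →ₗ[ℝ] Poly N :=
  (basisMonomials (Fin N) ℝ).constr ℝ fun d => polyP k d

/-- The adjoint of multiplication by `x_j^r` for the inner product making the monomials
orthonormal. -/
def lowerX (j : Fin N) (r : ℕ) : Poly N →ₗ[ℝ] Poly N :=
  (basisMonomials (Fin N) ℝ).constr ℝ fun d =>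
    if r ≤ d j then monomial (d - Finsupp.single j r) 1 else 0

/-- The inner product making the monomials orthonormal. -/
def monPair (N : ℕ) : Poly N →ₗ[ℝ] Poly N →ₗ[ℝ] ℝ :=
  (basisMonomials (Fin N) ℝ).constr ℝ fun d => lcoeff ℝ d

theorem monToP_monomial (k : ℝ) (d : Fin N →₀ ℕ) : monToP N k (monomial d 1) = polyP k d := by
  have := (basisMonomials (Fin N) ℝ).constr_basis ℝ (fun d => polyP k (d : Fin N → ℕ)) d
  rwa [coe_basisMonomials] at this

theorem lowerX_monomial (j : Fin N) (r : ℕ) (d : Fin N →₀ ℕ) : lowerX j r (monomial d 1) =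
    if r ≤ d j then monomial (d - Finsupp.single j r) 1 else 0 := by
  have := (basisMonomials (Fin N) ℝ).constr_basis ℝ
    (fun d => if r ≤ d j then monomial (d - Finsupp.single j r) (1 : ℝ) else 0) d
  rwa [coe_basisMonomials] at this

theorem monPair_monomial (d : Fin N →₀ ℕ) (g : Poly N) :
    monPair N (monomial d 1) g = coeff d g := by
  have := (basisMonomials (Fin N) ℝ).constr_basis ℝ (fun d => lcoeff ℝ d) d
  rw [coe_basisMonomials] at this
  exact LinearMap.congr_fun this g

theorem degree_eq_of_mem_support {n : ℕ} {f : Poly N} (hf : f.IsHomogeneous n)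
    {d : Fin N →₀ ℕ} (hd : d ∈ f.support) : d.degree = n := by
  by_contra h
  exact mem_support_iff.1 hd (hf.coeff_eq_zero h)

theorem linearMap_eq_of_isHomogeneous {M : Type*} [AddCommGroup M] [Module ℝ M]
    (L L' : Poly N →ₗ[ℝ] M) {n : ℕ}
    (h : ∀ d : Fin N →₀ ℕ, ∑ i, d i = n → L (monomial d 1) = L' (monomial d 1))
    {f : Poly N} (hf : f.IsHomogeneous n) : L f = L' f := by
  rw [f.as_sum, map_sum, map_sum]
  refine Finset.sum_congr rfl fun d hd => ?_
  have hd' : ∑ i, d i = n := by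
    rw [← Finsupp.degree_eq_sum]
    exact degree_eq_of_mem_support hf hd
  have e : monomial d (coeff d f) = coeff d f • monomial d (1 : ℝ) := by
    rw [smul_monomial, smul_eq_mul, mul_one]
  rw [e, map_smul, map_smul, h d hd']

theorem lowerX_isHomogeneous (j : Fin N) (r : ℕ) {n : ℕ} {f : Poly N} (hf : f.IsHomogeneous n) :
    (lowerX j r f).IsHomogeneous (n - r) := by
  rw [f.as_sum, map_sum]
  refine IsHomogeneous.sum _ _ _ fun d hd => ?_
  have hd' : d.degree = n := degree_eq_of_mem_support hf hd
  have e : monomial d (coeff d f) = coeff d f • monomial d (1 : ℝ) := by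
    rw [smul_monomial, smul_eq_mul, mul_one]
  rw [e, map_smul, lowerX_monomial]
  split_ifs with h
  · rw [smul_monomial]
    apply isHomogeneous_monomial
    have hle : Finsupp.single j r ≤ d := by simpa using h
    have := congrArg Finsupp.degree (tsub_add_cancel_of_le hle)
    rw [map_add, hd', Finsupp.degree_single] at this
    omega
  · rw [smul_zero]; exact isHomogeneous_zero _ _ _

theorem monPair_X_pow_mul (j : Fin N) (r : ℕ) (f g : Poly N) :
    monPair N f (X j ^ r * g) = monPair N (lowerX j r f) g := by
  have : ((monPair N).flip (X j ^ r * g)) = (monPair N).flip g ∘ₗ lowerX j r := by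
    apply (basisMonomials (Fin N) ℝ).ext
    intro d
    rw [coe_basisMonomials]
    simp only [LinearMap.flip_apply, LinearMap.comp_apply, lowerX_monomial]
    rw [monPair_monomial, X_pow_eq_monomial, coeff_monomial_mul']
    simp only [Finsupp.single_le_iff, one_mul]
    split_ifs
    · rw [monPair_monomial]
    · simp
  exact LinearMap.congr_fun this f

theorem monPair_self (f : Poly N) : monPair N f f = ∑ d ∈ f.support, coeff d f ^ 2 := by
  have h : monPair N f f = ∑ d ∈ f.support, monPair N (monomial d (coeff d f)) f := by
    rw [← LinearMap.sum_apply, ← map_sum, ← f.as_sum]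
  rw [h]
  refine Finset.sum_congr rfl fun d _ => ?_
  have e : monomial d (coeff d f) = coeff d f • monomial d (1 : ℝ) := by
    rw [smul_monomial, smul_eq_mul, mul_one]
  rw [e, map_smul, LinearMap.smul_apply, monPair_monomial, smul_eq_mul, sq]

theorem monPair_self_nonneg (f : Poly N) : 0 ≤ monPair N f f := by
  rw [monPair_self]; positivity

theorem eq_zero_of_monPair_self_nonpos {f : Poly N} (h : monPair N f f ≤ 0) : f = 0 := by
  rw [monPair_self] at h
  have h0 := le_antisymm h (by positivity)
  rw [Finset.sum_eq_zero_iff_of_nonneg (fun _ _ => sq_nonneg _)] at h0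
  ext d
  by_contra hd
  exact hd (by simpa using h0 d (mem_support_iff.2 hd))

/-- Newton's identity is applied to each factor of `p_d` in turn, and the weights `d_j` add up to
`n`. Lowering the exponent of `x_j` by more than `d_j` gives zero, so `r` may run over the same
range for all `j`. -/
theorem polyP_euler (k : ℝ) (d : Fin N →₀ ℕ) {n : ℕ} (hd : ∑ i, d i = n) :
    (n : ℝ) • polyP k d = ∑ j, ∑ r ∈ Finset.range n,
      (X j ^ (r + 1) + C k * powSum N (r + 1)) *
        monToP N k (lowerX j (r + 1) (monomial d 1)) := by
  have hle : ∀ j, d j ≤ n := fun j => by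
    rw [← hd]; exact Finset.single_le_sum (fun _ _ => Nat.zero_le _) (Finset.mem_univ j)
  have key : ∀ j, ∑ r ∈ Finset.range n, (X j ^ (r + 1) + C k * powSum N (r + 1)) *
        monToP N k (lowerX j (r + 1) (monomial d 1)) = (d j : ℝ) • polyP k d := by
    intro j
    have h0 : polyP k d = facP k j (d j) * ∏ l ∈ Finset.univ.erase j, facP k l (d l) := by
      rw [polyP_eq_prod, Finset.mul_prod_erase _ (fun l => facP k l (d l)) (Finset.mem_univ j)]
    rw [h0, smul_eq_C_mul, map_natCast, ← mul_assoc, natCast_mul_facP, Finset.sum_mul]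
    symm
    apply Finset.sum_subset_zero_on_sdiff (Finset.range_mono (hle j))
    · intro r hr
      simp only [Finset.mem_sdiff, Finset.mem_range, not_lt] at hr
      rw [lowerX_monomial, if_neg (by omega), map_zero, mul_zero]
    · intro r hr
      rw [Finset.mem_range] at hr
      rw [lowerX_monomial, if_pos (by omega), monToP_monomial, polyP_eq_prod,
        ← Finset.mul_prod_erase _ _ (Finset.mem_univ j), mul_assoc]
      congr 2
      · simp
      · refine Finset.prod_congr rfl fun l hl => ?_
        have : j ≠ l := (Finset.ne_of_mem_erase hl).symm
        simp [this]
  rw [Finset.sum_congr rfl fun j _ => key j, ← Finset.sum_smul]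
  congr 1
  rw [← hd]
  simp

theorem monToP_euler (k : ℝ) {n : ℕ} {f : Poly N} (hf : f.IsHomogeneous n) :
    (n : ℝ) • monToP N k f = ∑ j, ∑ r ∈ Finset.range n,
      (X j ^ (r + 1) + C k * powSum N (r + 1)) * monToP N k (lowerX j (r + 1) f) := by
  have := linearMap_eq_of_isHomogeneous ((n : ℝ) • monToP N k) (∑ j, ∑ r ∈ Finset.range n,
      LinearMap.mulLeft ℝ (X j ^ (r + 1) + C k * powSum N (r + 1)) ∘ₗ monToP N k ∘ₗ
        lowerX j (r + 1)) (n := n) (fun d hd => by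
      simpa [monToP_monomial] using polyP_euler k d hd) hf
  simpa using this

theorem sum_X_pow_mul_lowerX {n : ℕ} {f : Poly N} (hf : f.IsHomogeneous n) :
    ∑ j, ∑ r ∈ Finset.range n, X j ^ (r + 1) * lowerX j (r + 1) f = (n : ℝ) • f := by
  have := linearMap_eq_of_isHomogeneous (∑ j, ∑ r ∈ Finset.range n,
      LinearMap.mulLeft ℝ (X j ^ (r + 1)) ∘ₗ lowerX j (r + 1)) ((n : ℝ) • LinearMap.id)
      (n := n) (fun d hd => by
    have hle : ∀ j, d j ≤ n := fun j => by
      rw [← hd]; exact Finset.single_le_sum (fun _ _ => Nat.zero_le _) (Finset.mem_univ j)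
    have h1 : ∀ j, ∑ r ∈ Finset.range n,
        X j ^ (r + 1) * lowerX j (r + 1) (monomial d 1) = (d j : ℝ) • monomial d 1 := by
      intro j
      have h2 : ∀ r ∈ Finset.range n, X j ^ (r + 1) * lowerX j (r + 1) (monomial d 1) =
          if r < d j then monomial d 1 else 0 := by
        intro r _
        rw [lowerX_monomial]
        split_ifs with h3 h4 h4
        · rw [X_pow_eq_monomial, monomial_mul, mul_one,
            add_tsub_cancel_of_le (Finsupp.single_le_iff.2 h3)]
        · omega
        · omega
        · rw [mul_zero]
      rw [Finset.sum_congr rfl h2, ← Finset.sum_filter]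
      have h3 : (Finset.range n).filter (· < d j) = Finset.range (d j) := by
        ext r
        have := hle j
        simp only [Finset.mem_filter, Finset.mem_range]
        omega
      rw [h3, Finset.sum_const, Finset.card_range, Nat.cast_smul_eq_nsmul]
    simp only [LinearMap.sum_apply, LinearMap.comp_apply, LinearMap.mulLeft_apply, h1,
      LinearMap.smul_apply, LinearMap.id_apply]
    rw [← Finset.sum_smul, ← hd]
    simp) hf
  simpa using this

/-- Let `P` be the map `x^d ↦ p_d` and `L_{j,r}` the adjoint of multiplication by `x_j^r`. By
`monToP_euler`, `n ⟨f, P f⟩` equals `∑_{j,r} ⟨L_{j,r} f, P L_{j,r} f⟩` plus `k` times a sum of forms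
`⟨S, P S⟩`, while `n ⟨f, f⟩ = ∑_{j,r} ⟨L_{j,r} f, L_{j,r} f⟩`. Induction on the degree compares the
first sums and shows that the second kind of term is nonnegative. -/
theorem monPair_le_monPair_monToP {k : ℝ} (hk : 0 ≤ k) (n : ℕ) {f : Poly N}
    (hf : f.IsHomogeneous n) : monPair N f f ≤ monPair N f (monToP N k f) := by
  induction n using Nat.strong_induction_on generalizing f with
  | _ n ih =>
  rcases Nat.eq_zero_or_pos n with rfl | hn
  · apply le_of_eq
    have h : monToP N k f = f := by
      refine linearMap_eq_of_isHomogeneous (monToP N k) LinearMap.id (n := 0) (fun d hd => ?_) hf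
      have : d = 0 := by
        ext i
        have := Finset.sum_eq_zero_iff.1 hd i (Finset.mem_univ i)
        simpa using this
      subst this
      rw [monToP_monomial, polyP_eq_prod]
      simp [facP_zero]
    rw [h]
  -- `S r` is the adjoint of multiplication by the power sum of degree `r + 1`, applied to `f`.
  · set S : ℕ → Poly N := fun r => ∑ j, lowerX j (r + 1) f with hS
    have h1 : (n : ℝ) * monPair N f (monToP N k f) =
        ∑ j, ∑ r ∈ Finset.range n,
          monPair N (lowerX j (r + 1) f) (monToP N k (lowerX j (r + 1) f)) +
        k * ∑ r ∈ Finset.range n, monPair N (S r) (monToP N k (S r)) := by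
      rw [← smul_eq_mul, ← map_smul, monToP_euler k hf]
      simp only [add_mul, Finset.sum_add_distrib, map_add, map_sum, monPair_X_pow_mul]
      congr 1
      have h2 : ∀ r (g : Poly N), monPair N f (C k * powSum N (r + 1) * g) =
          k * monPair N (S r) g := by
        intro r g
        rw [mul_assoc, ← smul_eq_C_mul, map_smul, smul_eq_mul, powSum, Finset.sum_mul, map_sum, hS]
        simp only [monPair_X_pow_mul, map_sum, LinearMap.sum_apply]
      simp only [h2]
      rw [Finset.sum_comm, Finset.mul_sum]
      refine Finset.sum_congr rfl fun r _ => ?_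
      rw [← Finset.mul_sum, ← map_sum, ← map_sum]
    have h3 : (n : ℝ) * monPair N f f = ∑ j, ∑ r ∈ Finset.range n,
          monPair N (lowerX j (r + 1) f) (lowerX j (r + 1) f) := by
      rw [← smul_eq_mul, ← map_smul, ← sum_X_pow_mul_lowerX hf]
      simp only [map_sum, monPair_X_pow_mul]
    have hpos : (0 : ℝ) < n := by exact_mod_cast hn
    refine le_of_mul_le_mul_left ?_ hpos
    rw [h1, h3]
    have h4 : ∀ j, ∀ r ∈ Finset.range n,
        monPair N (lowerX j (r + 1) f) (lowerX j (r + 1) f) ≤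
          monPair N (lowerX j (r + 1) f) (monToP N k (lowerX j (r + 1) f)) := fun j r _ =>
      ih (n - (r + 1)) (by omega) (lowerX_isHomogeneous j (r + 1) hf)
    have h5 : ∀ r ∈ Finset.range n, 0 ≤ monPair N (S r) (monToP N k (S r)) := fun r _ =>
      (monPair_self_nonneg _).trans (ih (n - (r + 1)) (by omega)
        (IsHomogeneous.sum _ _ _ fun j _ => lowerX_isHomogeneous j (r + 1) hf))
    have h6 := Finset.sum_le_sum fun j (_ : j ∈ Finset.univ) => Finset.sum_le_sum (h4 j)
    have h7 := mul_nonneg hk (Finset.sum_nonneg h5)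
    linarith

theorem homogeneousComponent_monToP (k : ℝ) (n : ℕ) (f : Poly N) :
    homogeneousComponent n (monToP N k f) = monToP N k (homogeneousComponent n f) := by
  have : homogeneousComponent n ∘ₗ monToP N k = monToP N k ∘ₗ homogeneousComponent n := by
    apply (basisMonomials (Fin N) ℝ).ext
    intro d
    rw [coe_basisMonomials]
    simp only [LinearMap.comp_apply, monToP_monomial]
    rw [homogeneousComponent_of_mem (polyP_isHomogeneous k d),
      homogeneousComponent_of_mem (isHomogeneous_monomial (n := ∑ i, d i) 1
        (Finsupp.degree_eq_sum d))]
    split_ifs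
    · rw [monToP_monomial]
    · simp
  exact LinearMap.congr_fun this f

theorem monToP_injective {k : ℝ} (hk : 0 ≤ k) : Function.Injective (monToP N k) := by
  rw [injective_iff_map_eq_zero]
  intro f hf
  have h : ∀ n, homogeneousComponent n f = 0 := by
    intro n
    apply eq_zero_of_monPair_self_nonpos
    refine (monPair_le_monPair_monToP hk n (homogeneousComponent_isHomogeneous n f)).trans ?_
    rw [← homogeneousComponent_monToP, hf]
    simp
  rw [← sum_homogeneousComponent f]
  exact Finset.sum_eq_zero fun n _ => h n

theorem linearIndependent_polyP {k : ℝ} (hk : 0 ≤ k) :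
    LinearIndependent ℝ (polyP k : (Fin N → ℕ) → Poly N) := by
  have h := (basisMonomials (Fin N) ℝ).linearIndependent.map' (monToP N k)
    (LinearMap.ker_eq_bot.2 (monToP_injective hk))
  have h2 := h.comp _ (Finsupp.equivFunOnFinite (α := Fin N) (M := ℕ)).symm.injective
  have e : (polyP k : (Fin N → ℕ) → Poly N) = (monToP N k ∘ basisMonomials (Fin N) ℝ) ∘
      (Finsupp.equivFunOnFinite (α := Fin N) (M := ℕ)).symm := by
    funext γ
    simp [monToP_monomial]
  rw [e]
  exact h2

end Independence

/-! ### Sorting, the eigenvalues `κ`, dominance, and generation by adjacent transpositions -/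

section Compositions

variable {N : ℕ}

theorem compAct_apply (w : Perm (Fin N)) (α : Fin N → ℕ) (i : Fin N) :
    compAct w α i = α (w⁻¹ i) := rfl

theorem compAct_apply_apply (w : Perm (Fin N)) (α : Fin N → ℕ) (i : Fin N) :
    compAct w α (w i) = α i := by
  simp [compAct]

@[simp]
theorem compAct_one (α : Fin N → ℕ) : compAct 1 α = α := by
  funext i
  simp [compAct]

theorem sum_compAct (w : Perm (Fin N)) (α : Fin N → ℕ) :
    ∑ i, compAct w α i = ∑ i, α i := Equiv.sum_comp w⁻¹ α

/-- The sort is stable, ties being broken by position. This is exactly the order counted in `κ`. -/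
theorem sortPerm_lt_iff (α : Fin N → ℕ) (a b : Fin N) : a < b ↔
    α (sortPerm α b) < α (sortPerm α a) ∨
      (α (sortPerm α a) = α (sortPerm α b) ∧ sortPerm α a < sortPerm α b) := by
  have h := (Tuple.eq_sort_iff (f := fun i => OrderDual.toDual (α i)) (σ := sortPerm α)).1 rfl
  have hlt : ∀ a b, a < b → α (sortPerm α b) < α (sortPerm α a) ∨
      (α (sortPerm α a) = α (sortPerm α b) ∧ sortPerm α a < sortPerm α b) := by
    intro a b hab
    have h1 : α (sortPerm α b) ≤ α (sortPerm α a) := h.1 hab.le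
    rcases h1.lt_or_eq with h2 | h2
    · exact Or.inl h2
    · exact Or.inr ⟨h2.symm, h.2 a b hab (congrArg OrderDual.toDual h2.symm)⟩
  refine ⟨hlt a b, fun hab => ?_⟩
  rcases lt_trichotomy a b with h1 | h1 | h1
  · exact h1
  · subst h1; simp at hab
  · rcases hlt b a h1 with h2 | ⟨h2, h3⟩ <;> rcases hab with h4 | ⟨h4, h5⟩
    · omega
    · omega
    · omega
    · exact absurd h5 (not_lt.2 h3.le)

theorem plus_antitone (α : Fin N → ℕ) : Antitone (plus α) := by
  have h := (Tuple.eq_sort_iff (f := fun i => OrderDual.toDual (α i)) (σ := sortPerm α)).1 rfl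
  exact fun a b hab => h.1 hab

theorem compAct_sortPerm_plus (α : Fin N → ℕ) : compAct (sortPerm α) (plus α) = α := by
  funext i
  simp [compAct, plus]

theorem plus_eq_of_antitone {α μ : Fin N → ℕ} {w : Perm (Fin N)} (hμ : Antitone μ)
    (h : μ = α ∘ w) : plus α = μ := by
  rw [h] at hμ ⊢
  exact Tuple.unique_antitone (f := α) (plus_antitone α) hμ

theorem plus_of_antitone {α : Fin N → ℕ} (h : Antitone α) : plus α = α :=
  plus_eq_of_antitone (w := 1) h rfl

theorem plus_compAct (w : Perm (Fin N)) (α : Fin N → ℕ) : plus (compAct w α) = plus α := by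
  apply plus_eq_of_antitone (w := w * sortPerm α) (plus_antitone α)
  funext i
  simp [compAct, plus]

theorem sum_plus (α : Fin N → ℕ) : ∑ i, plus α i = ∑ i, α i := Equiv.sum_comp (sortPerm α) α

theorem sum_eq_of_plus_eq {α β : Fin N → ℕ} (h : plus α = plus β) : ∑ i, α i = ∑ i, β i := by
  rw [← sum_plus, h, sum_plus]

/-- The two counts in `κ` together enumerate the positions that precede the given one in the stable
sort, so they add up to its rank. -/
theorem kappa_eq (k : ℝ) (α : Fin N → ℕ) (r : Fin N) :
    kappa k α (sortPerm α r) = N * k - k * (r : ℕ) + plus α r + 1 := by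
  have hd : Disjoint (Finset.univ.filter fun s => α (sortPerm α r) < α s)
      (Finset.univ.filter fun s => s < sortPerm α r ∧ α s = α (sortPerm α r)) := by
    rw [Finset.disjoint_left]
    intro s h1 h2
    simp only [Finset.mem_filter, Finset.mem_univ, true_and] at h1 h2
    omega
  have hu : (Finset.univ.filter fun s => α (sortPerm α r) < α s) ∪
      (Finset.univ.filter fun s => s < sortPerm α r ∧ α s = α (sortPerm α r)) =
      (Finset.Iio r).map (sortPerm α).toEmbedding := by
    ext s
    obtain ⟨a, rfl⟩ := (sortPerm α).surjective s
    simp only [Finset.mem_union, Finset.mem_filter, Finset.mem_univ, true_and, Finset.mem_map,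
      Finset.mem_Iio, Equiv.coe_toEmbedding, EmbeddingLike.apply_eq_iff_eq, exists_eq_right]
    rw [sortPerm_lt_iff α a r]
    tauto
  have hc := congrArg Finset.card hu
  rw [Finset.card_union_of_disjoint hd, Finset.card_map, Fin.card_Iio] at hc
  rw [kappa, ← Nat.cast_add, hc, plus]

theorem kappa_of_antitone (k : ℝ) {μ : Fin N → ℕ} (hμ : Antitone μ) (r : Fin N) :
    kappa k μ r = N * k - k * (r : ℕ) + μ r + 1 := by
  have h1 : sortPerm μ = 1 := by
    have : Tuple.sort (fun i => OrderDual.toDual (μ i)) = Equiv.refl _ :=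
      Tuple.sort_eq_refl_iff_monotone.2 fun a b hab => hμ hab
    exact this
  have := kappa_eq k μ r
  rwa [h1, plus_of_antitone hμ] at this

theorem kappa_sortPerm (k : ℝ) (α : Fin N → ℕ) (r : Fin N) :
    kappa k α (sortPerm α r) = kappa k (plus α) r := by
  rw [kappa_eq, kappa_of_antitone k (plus_antitone α)]

theorem kappa_antitone {k : ℝ} (hk : 0 ≤ k) {μ : Fin N → ℕ} (hμ : Antitone μ) :
    Antitone (kappa k μ) := by
  intro a b hab
  rw [kappa_of_antitone k hμ, kappa_of_antitone k hμ]
  have h1 : (μ b : ℝ) ≤ μ a := by exact_mod_cast hμ hab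
  have h2 : k * (a : ℕ) ≤ k * (b : ℕ) :=
    mul_le_mul_of_nonneg_left (by exact_mod_cast hab) hk
  linarith

/-- Sorting the values of `κ` decreasingly yields `κ` of the partition, from which its parts can be
read off. -/
theorem plus_eq_of_kappa_eq {k : ℝ} (hk : 0 ≤ k) {α β : Fin N → ℕ} (w : Perm (Fin N))
    (h : kappa k β = kappa k α ∘ w) : plus β = plus α := by
  have h1 : Antitone (kappa k α ∘ (w * sortPerm β)) := by
    have : kappa k α ∘ (w * sortPerm β) = kappa k (plus β) := by
      funext r
      rw [← kappa_sortPerm, h]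
      rfl
    rw [this]
    exact kappa_antitone hk (plus_antitone β)
  have h2 : Antitone (kappa k α ∘ sortPerm α) := by
    have : kappa k α ∘ sortPerm α = kappa k (plus α) := funext fun r => kappa_sortPerm k α r
    rw [this]
    exact kappa_antitone hk (plus_antitone α)
  have h3 := Tuple.unique_antitone h1 h2
  funext r
  have h4 : kappa k (plus β) r = kappa k (plus α) r := by
    rw [← kappa_sortPerm, ← kappa_sortPerm, h]
    exact congrFun h3 r
  rw [kappa_of_antitone k (plus_antitone β), kappa_of_antitone k (plus_antitone α)] at h4
  have h5 : (plus β r : ℝ) = plus α r := by linarith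
  exact_mod_cast h5

/-- For `k = 0` the entries are visible directly. For `k > 0` the values of `κ` are distinct, so
they also determine the sorting permutation. -/
theorem kappa_injective {k : ℝ} (hk : 0 ≤ k) :
    Function.Injective (kappa k : (Fin N → ℕ) → Fin N → ℝ) := by
  intro α β h
  have hp : plus β = plus α := plus_eq_of_kappa_eq hk 1 h.symm
  rcases hk.eq_or_lt with rfl | hk'
  · funext i
    have := congrFun h i
    simp only [kappa, mul_zero, zero_mul, sub_zero, zero_add, add_left_inj, Nat.cast_inj] at this
    exact this
  · have hinj : Function.Injective (kappa k (plus α)) := by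
      have : StrictAnti (kappa k (plus α)) := by
        intro a b hab
        rw [kappa_of_antitone k (plus_antitone α), kappa_of_antitone k (plus_antitone α)]
        have h1 : (plus α b : ℝ) ≤ plus α a := by exact_mod_cast plus_antitone α hab.le
        have h2 : k * (a : ℕ) < k * (b : ℕ) :=
          mul_lt_mul_of_pos_left (by exact_mod_cast hab) hk'
        linarith
      exact this.injective
    funext i
    obtain ⟨a, rfl⟩ := (sortPerm α).surjective i
    obtain ⟨b, hb⟩ := (sortPerm β).surjective (sortPerm α a)
    have h1 : kappa k (plus α) a = kappa k (plus α) b := by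
      rw [← kappa_sortPerm, h, ← hb, kappa_sortPerm, hp]
    have h2 := hinj h1
    subst h2
    have h3 := congrFun hp a
    simp only [plus] at h3
    rw [← h3, hb]

/-- If `w` preserves the order of the positions carrying equal entries of `α`, then the
eigenvalues of `w α` are the permuted eigenvalues of `α`. -/
theorem kappa_compAct (k : ℝ) (α : Fin N → ℕ) (w : Perm (Fin N))
    (hw : ∀ a b, α a = α b → (a < b ↔ w a < w b)) (i : Fin N) :
    kappa k (compAct w α) (w i) = kappa k α i := by
  have h1 : (Finset.univ.filter fun s => α i < compAct w α s) =
      (Finset.univ.filter fun s => α i < α s).map w.toEmbedding := by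
    ext s
    obtain ⟨a, rfl⟩ := w.surjective s
    simp [compAct_apply_apply]
  have h2 : (Finset.univ.filter fun s => s < w i ∧ compAct w α s = α i) =
      (Finset.univ.filter fun s => s < i ∧ α s = α i).map w.toEmbedding := by
    ext s
    obtain ⟨a, rfl⟩ := w.surjective s
    simp only [Finset.mem_filter, Finset.mem_univ, true_and, Finset.mem_map, compAct_apply_apply,
      Equiv.coe_toEmbedding, EmbeddingLike.apply_eq_iff_eq, exists_eq_right]
    constructor
    · rintro ⟨h3, h4⟩
      exact ⟨(hw a i h4).2 h3, h4⟩
    · rintro ⟨h3, h4⟩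
      exact ⟨(hw a i h4).1 h3, h4⟩
  simp only [kappa, compAct_apply_apply, h1, h2, Finset.card_map]

/-- A larger entry wins at least `1` from the entry and at least `k` from the rank. The gap keeps
adjacent transpositions from fixing the line of a `ζ` in `permOp_swap_zeta`. -/
theorem lt_kappa_sub {k : ℝ} (hk : 0 ≤ k) (α : Fin N → ℕ) {i j : Fin N} (h : α j < α i) :
    k < kappa k α i - kappa k α j := by
  obtain ⟨a, rfl⟩ := (sortPerm α).surjective i
  obtain ⟨b, rfl⟩ := (sortPerm α).surjective j
  have hab : a < b := (sortPerm_lt_iff α a b).2 (Or.inl h)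
  rw [kappa_eq, kappa_eq]
  have h1 : (plus α b : ℝ) + 1 ≤ plus α a := by exact_mod_cast h
  have h2 : ((a : ℕ) : ℝ) + 1 ≤ (b : ℕ) := by exact_mod_cast hab
  nlinarith

theorem Dominates.trans {α β γ : Fin N → ℕ} (h1 : Dominates α β) (h2 : Dominates β γ) :
    Dominates α γ := by
  refine ⟨fun h => h1.1 ?_, fun j => (h2.2 j).trans (h1.2 j)⟩
  subst h
  funext i
  induction i using WellFoundedLT.induction with
  | _ i ih =>
    have e : ∀ f : Fin N → ℕ, ∑ l ∈ Finset.Iic i, f l = ∑ l ∈ Finset.Iio i, f l + f i := by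
      intro f
      rw [← Finset.Iio_insert, Finset.sum_insert (by simp), add_comm]
    have h3 := le_antisymm (h2.2 i) (h1.2 i)
    have h4 : ∑ l ∈ Finset.Iio i, α l = ∑ l ∈ Finset.Iio i, β l :=
      Finset.sum_congr rfl fun l hl => ih l (Finset.mem_Iio.1 hl)
    rw [e, e, h4] at h3
    omega

/-- The sum of all partial sums of `α`. -/
def partialSums (α : Fin N → ℕ) : ℕ := ∑ j, ∑ i ∈ Finset.Iic j, α i

theorem Dominates.partialSums_lt {α β : Fin N → ℕ} (h : Dominates α β) :
    partialSums β < partialSums α := by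
  refine (Finset.sum_le_sum fun j _ => h.2 j).lt_of_ne fun he => ?_
  have h1 := (Finset.sum_eq_sum_iff_of_le fun j _ => h.2 j).1 he
  have h2 : Dominates β α := ⟨h.1.symm, fun j => (h1 j (Finset.mem_univ j)).ge⟩
  exact (h.trans h2).1 rfl

/-- Exchange argument: members of `B` beyond `j` contribute at most `μ j` each, and the equally many
indices up to `j` missing from `B` contribute at least `μ j` each. -/
theorem sum_le_sum_Iic_of_antitone {μ : Fin N → ℕ} (hμ : Antitone μ) (B : Finset (Fin N))
    (j : Fin N) (hB : B.card = (Finset.Iic j).card) :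
    ∑ i ∈ B, μ i ≤ ∑ i ∈ Finset.Iic j, μ i := by
  rw [← Finset.sum_inter_add_sum_sdiff B (Finset.Iic j),
    ← Finset.sum_inter_add_sum_sdiff (Finset.Iic j) B, Finset.inter_comm]
  apply Nat.add_le_add_left
  have hc : (B \ Finset.Iic j).card = (Finset.Iic j \ B).card := by
    have h1 := Finset.card_sdiff_add_card_inter B (Finset.Iic j)
    have h2 := Finset.card_sdiff_add_card_inter (Finset.Iic j) B
    rw [Finset.inter_comm] at h2
    omega
  calc ∑ i ∈ B \ Finset.Iic j, μ i ≤ (B \ Finset.Iic j).card • μ j :=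
        Finset.sum_le_card_nsmul _ _ _ fun i hi => hμ (by
          simp only [Finset.mem_sdiff, Finset.mem_Iic, not_le] at hi
          exact hi.2.le)
    _ = (Finset.Iic j \ B).card • μ j := by rw [hc]
    _ ≤ ∑ i ∈ Finset.Iic j \ B, μ i := Finset.card_nsmul_le_sum _ _ _ fun i hi => hμ (by
          simp only [Finset.mem_sdiff, Finset.mem_Iic] at hi
          exact hi.1)

theorem sum_le_sum_plus (β : Fin N → ℕ) (B : Finset (Fin N)) (j : Fin N)
    (hB : B.card = (Finset.Iic j).card) : ∑ i ∈ B, β i ≤ ∑ i ∈ Finset.Iic j, plus β i := by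
  have h : ∑ i ∈ B, β i = ∑ i ∈ B.map (sortPerm β)⁻¹.toEmbedding, plus β i := by
    rw [Finset.sum_map]
    simp [plus]
  rw [h]
  exact sum_le_sum_Iic_of_antitone (plus_antitone β) _ j (by rw [Finset.card_map, hB])

theorem sum_setPair (γ : Fin N → ℕ) {i j : Fin N} (h : i ≠ j) (u v : ℕ) (A : Finset (Fin N))
    (F : ℕ → ℤ) : ∑ l ∈ A, F (setPair γ i j u v l) = ∑ l ∈ A, F (γ l) +
      (if i ∈ A then F u - F (γ i) else 0) + (if j ∈ A then F v - F (γ j) else 0) := by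
  have e : ∀ l, F (setPair γ i j u v l) = F (γ l) + (if l = i then F u - F (γ i) else 0) +
      (if l = j then F v - F (γ j) else 0) := by
    intro l
    rcases eq_or_ne l i with rfl | h1
    · rw [setPair_left γ h]; simp [h]
    rcases eq_or_ne l j with rfl | h2
    · rw [setPair_right]; simp [h.symm]
    · rw [setPair_of_ne γ h1 h2]; simp [h1, h2]
  simp only [e, Finset.sum_add_distrib, Finset.sum_ite_eq']

theorem setPair_comm (γ : Fin N → ℕ) {i j : Fin N} (h : i ≠ j) (u v : ℕ) :
    setPair γ i j u v = setPair γ j i v u := by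
  unfold setPair
  exact Function.update_comm h u v γ

theorem sum_setPair_univ (γ : Fin N → ℕ) {i j : Fin N} (h : i ≠ j) {u v : ℕ}
    (huv : u + v = γ i + γ j) : ∑ l, setPair γ i j u v l = ∑ l, γ l := by
  have := sum_setPair γ h u v Finset.univ (fun n => (n : ℤ))
  simp only [Finset.mem_univ, if_true] at this
  zify at huv ⊢
  rw [this]
  linarith

/-- Spreading two entries apart with fixed sum raises the partition in dominance; it is a genuine
change because the sum of squares grows. -/
theorem plus_setPair_dominates (γ : Fin N → ℕ) {i j : Fin N} (h : i ≠ j) {u v : ℕ}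
    (huv : u + v = γ i + γ j) (hi : γ i < u) (hj : γ j < u) :
    Dominates (plus (setPair γ i j u v)) (plus γ) := by
  constructor
  · intro he
    have hsq : ∀ α : Fin N → ℕ, ∑ l, ((plus α l : ℕ) : ℤ) ^ 2 = ∑ l, ((α l : ℕ) : ℤ) ^ 2 :=
      fun α => Equiv.sum_comp (sortPerm α) fun l => ((α l : ℕ) : ℤ) ^ 2
    have h1 := hsq (setPair γ i j u v)
    rw [he, hsq, sum_setPair γ h u v Finset.univ (fun n => (n : ℤ) ^ 2)] at h1
    simp only [Finset.mem_univ, if_true] at h1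
    zify at huv hi hj
    have hv : (v : ℤ) = γ i + γ j - u := by linarith
    rw [hv] at h1
    nlinarith
  · intro m
    set A := (Finset.Iic m).map (sortPerm γ).toEmbedding with hA
    have hAs : ∑ l ∈ A, γ l = ∑ l ∈ Finset.Iic m, plus γ l := by
      rw [hA, Finset.sum_map]; rfl
    have hAc : A.card = (Finset.Iic m).card := by rw [hA, Finset.card_map]
    rw [← hAs]
    -- `A` holds the positions of the largest entries of `γ`. Only if it contains `j` but not `i`
    -- can its sum drop, and then `j` is traded for `i`.
    by_cases hc : i ∉ A ∧ j ∈ A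
    · refine le_trans ?_ (sum_le_sum_plus (setPair γ i j u v) (insert i (A.erase j)) m ?_)
      · have h1 := sum_setPair γ h u v (A.erase j) (fun n => (n : ℤ))
        rw [if_neg (by simp [hc.1]), if_neg (by simp)] at h1
        rw [Finset.sum_insert (by simp [hc.1]), setPair_left γ h, ← Finset.add_sum_erase A _ hc.2]
        zify at huv hi hj ⊢
        rw [h1]
        linarith
      · rw [Finset.card_insert_of_notMem (by simp [hc.1]), Finset.card_erase_of_mem hc.2, ← hAc]
        have := Finset.card_pos.2 ⟨j, hc.2⟩
        omega
    · refine le_trans ?_ (sum_le_sum_plus (setPair γ i j u v) A m hAc)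
      have h1 := sum_setPair γ h u v A (fun n => (n : ℤ))
      zify at huv hi hj ⊢
      rw [h1]
      split_ifs with h2 h3 h3
      · linarith
      · linarith
      · exact absurd ⟨h2, h3⟩ hc
      · linarith

theorem compAct_swap_eq_setPair (γ : Fin N → ℕ) {i j : Fin N} (h : i ≠ j) :
    compAct (swap i j) γ = setPair γ i j (γ j) (γ i) := by
  funext l
  rw [compAct, swap_inv]
  rcases eq_or_ne l i with rfl | h1
  · rw [setPair_left γ h, swap_apply_left]
  rcases eq_or_ne l j with rfl | h2
  · rw [setPair_right, swap_apply_right]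
  · rw [setPair_of_ne γ h1 h2, swap_apply_of_ne_of_ne h1 h2]

theorem setPair_self (γ : Fin N → ℕ) (i j : Fin N) : setPair γ i j (γ i) (γ j) = γ := by
  simp [setPair]

theorem compAct_swap_dominates (γ : Fin N → ℕ) {i j : Fin N} (h : i < j) (hγ : γ i < γ j) :
    Dominates (compAct (swap i j) γ) γ := by
  constructor
  · intro he
    have := congrFun he i
    rw [compAct, swap_inv, swap_apply_left] at this
    omega
  · intro m
    rw [compAct_swap_eq_setPair γ h.ne]
    have h1 := sum_setPair γ h.ne (γ j) (γ i) (Finset.Iic m) (fun n => (n : ℤ))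
    zify at hγ ⊢
    rw [h1]
    simp only [Finset.mem_Iic]
    split_ifs with h2 h3 h3
    · linarith
    · linarith
    · exact absurd (h.le.trans h3) h2
    · linarith

/-- A subgroup containing the adjacent transpositions inside the fibres of `c` contains all
permutations preserving `c`, when the fibres are convex. -/
theorem mem_of_comp_eq {τ : Type*} (c : Fin N → τ)
    (hc : ∀ a b d : Fin N, a ≤ b → b ≤ d → c a = c d → c b = c a)
    (H : Subgroup (Perm (Fin N)))
    (hH : ∀ i j : Fin N, (j : ℕ) = i + 1 → c i = c j → swap i j ∈ H)
    {w : Perm (Fin N)} (hw : ∀ i, c (w i) = c i) : w ∈ H := by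
  have hswap : ∀ n : ℕ, ∀ i j : Fin N, (j : ℕ) = i + 1 + n → c i = c j → swap i j ∈ H := by
    intro n
    induction n with
    | zero => exact fun i j hij h => hH i j hij h
    | succ n ih =>
      intro i j hij h
      have hm : (i : ℕ) + 1 < N := by have := j.2; omega
      set m : Fin N := ⟨i + 1, hm⟩ with hmdef
      have h1 : c m = c i := hc i m j (by rw [Fin.le_def, hmdef]; simp)
        (by rw [Fin.le_def, hmdef]; simp only; omega) h
      have h2 := hH i m rfl h1.symm
      have h3 := ih m j (by rw [hmdef]; simp only; omega) (h1.trans h)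
      have hmi : j ≠ i := fun e => by rw [e] at hij; omega
      have hmj : j ≠ m := fun e => by rw [e, hmdef] at hij; simp only at hij; omega
      have e : swap i j = swap i m * swap m j * (swap i m)⁻¹ := by
        rw [mul_swap_eq_swap_mul, mul_assoc, mul_inv_cancel, mul_one, swap_apply_right,
          swap_apply_of_ne_of_ne hmi hmj]
      rw [e]
      exact H.mul_mem (H.mul_mem h2 h3) (H.inv_mem h2)
  have hswap' : ∀ i j : Fin N, i ≠ j → c i = c j → swap i j ∈ H := by
    intro i j hij h
    rcases lt_or_gt_of_ne hij with h1 | h1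
    · exact hswap (j - i - 1) i j (by rw [Fin.lt_def] at h1; omega) h
    · rw [swap_comm]
      exact hswap (i - j - 1) j i (by rw [Fin.lt_def] at h1; omega) h.symm
  induction hn : w.support.card using Nat.strong_induction_on generalizing w with
  | _ n ih =>
  by_cases h1 : w = 1
  · rw [h1]; exact H.one_mem
  · obtain ⟨i, hi⟩ : ∃ i, w i ≠ i := by
      by_contra! hcon
      exact h1 (Equiv.ext hcon)
    have h2 := hswap' i (w i) (Ne.symm hi) (hw i).symm
    have h3 := ih _ (hn ▸ Perm.card_support_swap_mul hi) (w := swap i (w i) * w) (fun l => by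
      rw [Perm.mul_apply]
      rcases eq_or_ne (w l) i with e | e
      · rw [e, swap_apply_left, hw, ← e, hw]
      rcases eq_or_ne (w l) (w i) with e' | e'
      · rw [e', swap_apply_right, w.injective e']
      · rw [swap_apply_of_ne_of_ne e e', hw]) rfl
    have h4 := H.mul_mem h2 h3
    rwa [← mul_assoc, swap_mul_self, one_mul] at h4

end Compositions

/-! ### Joint eigenvectors of triangular commuting families -/

section Triangular

variable {ι J V M : Type*} [AddCommGroup V] [Module ℝ V] [LinearOrder M]

/-- A vector that is a joint eigenvector of a commuting family modulo an invariant subspace, on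
which the family is triangular with other eigenvalues, can be corrected to an eigenvector. -/
theorem exists_joint_eigenvector (U : J → Module.End ℝ V)
    (hU : ∀ i j v, U i (U j v) = U j (U i v)) (p : ι → V) (κ : ι → J → ℝ) (μ : ι → M)
    (S : Finset ι) (htri : ∀ γ ∈ S, ∀ j, U j (p γ) - κ γ j • p γ ∈
      Submodule.span ℝ (p '' {β | β ∈ S ∧ μ γ < μ β}))
    (c : J → ℝ) (hc : ∀ γ ∈ S, κ γ ≠ c) (v : V)
    (hv : ∀ j, U j v - c j • v ∈ Submodule.span ℝ (p '' (S : Set ι))) :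
    ∃ f, (∀ j, U j f = c j • f) ∧ f - v ∈ Submodule.span ℝ (p '' (S : Set ι)) := by
  classical
  induction hn : S.card using Nat.strong_induction_on generalizing S v with
  | _ n ih =>
  rcases S.eq_empty_or_nonempty with rfl | hS
  · refine ⟨v, fun j => ?_, by simp⟩
    have := hv j
    simpa [sub_eq_zero] using this
  -- By minimality `p γ` occurs in no triangular remainder, so `U i - κ γ i` sends the span of `S`
  -- into that of `S.erase γ`.
  · obtain ⟨γ, hγ, hmin⟩ := S.exists_min_image μ hS
    obtain ⟨j, hj⟩ := Function.ne_iff.1 (hc γ hγ)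
    have hj' : c j - κ γ j ≠ 0 := sub_ne_zero.2 hj.symm
    have hsub : ∀ β ∈ S, {δ | δ ∈ S ∧ μ β < μ δ} ⊆ {δ | δ ∈ S.erase γ ∧ μ β < μ δ} := by
      intro β hβ δ hδ
      refine ⟨Finset.mem_erase.2 ⟨?_, hδ.1⟩, hδ.2⟩
      rintro rfl
      exact absurd hδ.2 (not_lt.2 (hmin β hβ))
    have hlow : ∀ x ∈ Submodule.span ℝ (p '' (S : Set ι)), ∀ i,
        U i x - κ γ i • x ∈ Submodule.span ℝ (p '' ((S.erase γ : Finset ι) : Set ι)) := by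
      intro x hx i
      induction hx using Submodule.span_induction with
      | mem x hx =>
        obtain ⟨β, hβ, rfl⟩ := hx
        have h1 : U i (p β) - κ β i • p β ∈
            Submodule.span ℝ (p '' ((S.erase γ : Finset ι) : Set ι)) :=
          Submodule.span_mono (Set.image_mono fun δ hδ => (hsub β hβ hδ).1) (htri β hβ i)
        by_cases hβγ : β = γ
        · subst hβγ; exact h1
        · have h2 : p β ∈ Submodule.span ℝ (p '' ((S.erase γ : Finset ι) : Set ι)) :=
            Submodule.subset_span ⟨β, by simpa [hβγ] using hβ, rfl⟩
          have e : U i (p β) - κ γ i • p β =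
              (U i (p β) - κ β i • p β) + (κ β i - κ γ i) • p β := by
            rw [sub_smul]; abel
          rw [e]
          exact add_mem h1 (Submodule.smul_mem _ _ h2)
      | zero => simp
      | add x y _ _ hx hy =>
        have e : U i (x + y) - κ γ i • (x + y) =
            (U i x - κ γ i • x) + (U i y - κ γ i • y) := by
          rw [map_add, smul_add]; abel
        rw [e]
        exact add_mem hx hy
      | smul a x _ hx =>
        have e : U i (a • x) - κ γ i • (a • x) = a • (U i x - κ γ i • x) := by
          rw [map_smul, smul_sub, smul_comm]
        rw [e]
        exact Submodule.smul_mem _ _ hx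
    -- Applying `U j - κ γ j` removes the label `γ` from the error; the scalar normalizes so that
    -- `v` changes only by an element of the span.
    set v' : V := (c j - κ γ j)⁻¹ • (U j v - κ γ j • v) with hv'
    have hv'v : v' - v ∈ Submodule.span ℝ (p '' (S : Set ι)) := by
      have e : v' - v = (c j - κ γ j)⁻¹ • (U j v - c j • v) := by
        apply smul_right_injective V hj'
        simp only [hv', smul_sub, smul_smul, mul_inv_cancel₀ hj', one_smul,
          mul_inv_cancel_left₀ hj']
        rw [sub_smul]
        abel
      rw [e]
      exact Submodule.smul_mem _ _ (hv j)
    obtain ⟨f, hf, hfv⟩ := ih (S.erase γ).card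
      (by rw [← hn]; exact Finset.card_erase_lt_of_mem hγ) (S.erase γ)
      (fun β hβ i => Submodule.span_mono
        (Set.image_mono (hsub β (Finset.mem_of_mem_erase hβ)))
        (htri β (Finset.mem_of_mem_erase hβ) i))
      (fun β hβ => hc β (Finset.mem_of_mem_erase hβ)) v' (fun i => by
        have e : U i v' - c i • v' = (c j - κ γ j)⁻¹ •
            (U j (U i v - c i • v) - κ γ j • (U i v - c i • v)) := by
          simp only [hv', map_smul, map_sub, smul_sub, hU i j v, smul_comm (c i)]
          rw [smul_comm (κ γ j) (c i)]
          abel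
        rw [e]
        exact Submodule.smul_mem _ _ (hlow _ (hv i) j)) rfl
    refine ⟨f, hf, ?_⟩
    have e : f - v = (f - v') + (v' - v) := by abel
    rw [e]
    exact add_mem (Submodule.span_mono
      (Set.image_mono (by exact_mod_cast Finset.erase_subset γ S)) hfv) hv'v

/-- Provides coordinate functionals on all of `V` without requiring `p` to span. -/
theorem exists_coordinates {p : ι → V} (hp : LinearIndependent ℝ p) :
    ∃ g : V →ₗ[ℝ] ι →₀ ℝ, ∀ β, g (p β) = Finsupp.single β 1 := by
  obtain ⟨g, hg⟩ := LinearMap.exists_leftInverse_of_injective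
    (Finsupp.linearCombination ℝ p) (LinearMap.ker_eq_bot.2 hp)
  refine ⟨g, fun β => ?_⟩
  have := LinearMap.congr_fun hg (Finsupp.single β 1)
  simpa using this

theorem coordinates_eq_zero {p : ι → V} {g : V →ₗ[ℝ] ι →₀ ℝ}
    (hg : ∀ β, g (p β) = Finsupp.single β 1) {S : Set ι} {x : V}
    (hx : x ∈ Submodule.span ℝ (p '' S)) {γ : ι} (hγ : γ ∉ S) : g x γ = 0 := by
  induction hx using Submodule.span_induction with
  | mem x hx =>
    obtain ⟨β, hβ, rfl⟩ := hx
    rw [hg, Finsupp.single_eq_of_ne]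
    rintro rfl
    exact hγ hβ
  | zero => simp
  | add x y _ _ hx hy => rw [map_add, Finsupp.add_apply, hx, hy, add_zero]
  | smul a x _ hx => rw [map_smul, Finsupp.smul_apply, hx, smul_zero]

/-- Take a label of least `μ` in the expansion of `f`: no remainder of another term reaches it, so
comparing its coefficient in `U j f` and in `c j • f` identifies the eigenvalues. -/
theorem exists_label_of_eigenvector (U : J → Module.End ℝ V) {p : ι → V} {κ : ι → J → ℝ}
    (μ : ι → M) {g : V →ₗ[ℝ] ι →₀ ℝ} (hg : ∀ β, g (p β) = Finsupp.single β 1)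
    (htri : ∀ γ j, U j (p γ) - κ γ j • p γ ∈ Submodule.span ℝ (p '' {β | μ γ < μ β}))
    {c : J → ℝ} {f : V} (hf : f ∈ Submodule.span ℝ (Set.range p)) (hf0 : f ≠ 0)
    (hc : ∀ j, U j f = c j • f) : ∃ γ, κ γ = c ∧ g f γ ≠ 0 := by
  obtain ⟨a, rfl⟩ := (Finsupp.mem_span_range_iff_exists_finsupp).1 hf
  have hga : g (a.sum fun i b => b • p i) = a := by
    rw [Finsupp.sum, map_sum]
    simp only [map_smul, hg, Finsupp.smul_single, smul_eq_mul, mul_one]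
    exact a.sum_single
  have ha : a.support.Nonempty := by
    rw [Finsupp.support_nonempty_iff]
    rintro rfl
    simp at hf0
  obtain ⟨γ, hγ, hmin⟩ := a.support.exists_min_image μ ha
  refine ⟨γ, ?_, by rw [hga]; exact Finsupp.mem_support_iff.1 hγ⟩
  funext j
  have h1 := congrArg (fun x => g x γ) (hc j)
  simp only [map_smul, Finsupp.smul_apply, hga, smul_eq_mul] at h1
  have h2 : g (U j (a.sum fun i b => b • p i)) γ = κ γ j * a γ := by
    rw [Finsupp.sum, map_sum, map_sum, Finsupp.finsetSum_apply]
    rw [Finset.sum_eq_single_of_mem γ hγ]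
    · rw [map_smul, map_smul, Finsupp.smul_apply]
      have h3 := coordinates_eq_zero hg (htri γ j) (γ := γ) (by simp)
      rw [map_sub, map_smul, hg, Finsupp.sub_apply, Finsupp.smul_apply,
        Finsupp.single_eq_same, smul_eq_mul, mul_one, sub_eq_zero] at h3
      rw [h3, smul_eq_mul, mul_comm]
    · intro β hβ hne
      have h3 := coordinates_eq_zero hg (htri β j) (γ := γ) (by simpa using hmin β hβ)
      rw [map_sub, map_smul, hg, Finsupp.sub_apply, Finsupp.smul_apply,
        Finsupp.single_eq_of_ne hne.symm, smul_zero, sub_zero] at h3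
      rw [map_smul, map_smul, Finsupp.smul_apply, h3, smul_zero]
  rw [h2] at h1
  exact mul_right_cancel₀ (Finsupp.mem_support_iff.1 hγ) h1

end Triangular

/-! ### Triangularity of the `U_i` and construction of `ω` and `ζ` -/

section Jack

variable {N : ℕ}

/-- A numerical statistic increasing along the triangularity order. -/
def level (γ : Fin N → ℕ) : ℕ ×ₗ ℕ := toLex (partialSums (plus γ), partialSums γ)

/-- The order for which the operators `U_i` are triangular in the basis `p_γ`. -/
def Above (β γ : Fin N → ℕ) : Prop :=
  ∑ i, β i = ∑ i, γ i ∧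
    (Dominates (plus β) (plus γ) ∨ (plus β = plus γ ∧ Dominates β γ))

theorem Above.level_lt {β γ : Fin N → ℕ} (h : Above β γ) : level γ < level β := by
  rw [level, level, Prod.Lex.toLex_lt_toLex]
  rcases h.2 with h1 | ⟨h1, h2⟩
  · exact Or.inl h1.partialSums_lt
  · exact Or.inr ⟨by rw [h1], h2.partialSums_lt⟩

theorem above_setPair (γ : Fin N → ℕ) {i j : Fin N} (h : i ≠ j) {u v : ℕ}
    (huv : u + v = γ i + γ j) (hu : u < min (γ i) (γ j) ∨ v < min (γ i) (γ j)) :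
    Above (setPair γ i j u v) γ := by
  refine ⟨sum_setPair_univ γ h huv, Or.inl ?_⟩
  rw [lt_min_iff, lt_min_iff] at hu
  rcases hu with hu | hu
  · rw [setPair_comm γ h]
    exact plus_setPair_dominates γ h.symm (by omega) (by omega) (by omega)
  · exact plus_setPair_dominates γ h huv (by omega) (by omega)

/-- Only the summand `t = min (γ i) (γ j)` keeps the two entries up to order; every other summand
spreads them apart and so lies above `γ`. -/
theorem pairTerm_sub_mem (k : ℝ) (γ : Fin N → ℕ) {i j : Fin N} (h : i ≠ j) :
    pairTerm k γ i j - (if γ i < γ j then polyP k (compAct (swap i j) γ) else polyP k γ) ∈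
      Submodule.span ℝ (polyP k '' {β | Above β γ}) := by
  have hhead : polyP k (setPair γ i j (γ i + γ j - min (γ i) (γ j)) (min (γ i) (γ j))) =
      if γ i < γ j then polyP k (compAct (swap i j) γ) else polyP k γ := by
    split_ifs with h1
    · rw [min_eq_left h1.le, Nat.add_sub_cancel_left, compAct_swap_eq_setPair γ h]
    · rw [min_eq_right (not_lt.1 h1), Nat.add_sub_cancel, setPair_self]
  rw [pairTerm, Finset.sum_range_succ, hhead, add_sub_right_comm, add_sub_cancel_right]
  refine sub_mem (sum_mem fun t ht => ?_) (sum_mem fun t ht => ?_) <;>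
  · rw [Finset.mem_range] at ht
    have ht' := lt_min_iff.1 ht
    refine Submodule.subset_span ⟨_, above_setPair γ h (by omega) ?_, rfl⟩
    first | exact Or.inr ht | exact Or.inl ht

theorem above_swap (γ : Fin N → ℕ) {i j : Fin N} (h : i < j) (hγ : γ i < γ j) :
    Above (compAct (swap i j) γ) γ :=
  ⟨sum_compAct _ _, Or.inr ⟨plus_compAct _ _, compAct_swap_dominates γ h hγ⟩⟩

/-- For each `j ≠ i` the head of the pair term, the transposition in `U_i` (present if `j < i`) and
the share of `j` in `κ_i` are compared. They cancel, except for a transposition bringing a larger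
entry to the left, which lies above `γ`. -/
theorem opU_polyP_sub_mem (k : ℝ) (i : Fin N) (γ : Fin N → ℕ) :
    opU k i (polyP k γ) - kappa k γ i • polyP k γ ∈
      Submodule.span ℝ (polyP k '' {β | Above β γ}) := by
  have hN : (N : ℝ) = 1 + ∑ j ∈ Finset.univ.erase i, (1 : ℝ) := by
    rw [Finset.sum_const, Finset.card_erase_of_mem (Finset.mem_univ i), Finset.card_univ,
      Fintype.card_fin, nsmul_eq_mul, mul_one, Nat.cast_sub (by have := i.2; omega)]
    ring
  -- The constant `N k` is distributed as one `k` plus one for each `j ≠ i`, so that `κ_i` can be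
  -- matched pair by pair.
  have hκ : kappa k γ i • polyP k γ = ((γ i : ℝ) + 1) • polyP k γ + k • polyP k γ +
      k • ∑ j ∈ Finset.univ.erase i, ((1 : ℝ) - (if γ i < γ j then 1 else 0) -
        (if j < i ∧ γ j = γ i then 1 else 0)) • polyP k γ := by
    rw [← Finset.sum_smul, smul_smul, ← add_smul, ← add_smul]
    congr 1
    rw [kappa, Finset.card_filter, Finset.card_filter, ← Finset.add_sum_erase _ _
      (Finset.mem_univ i), ← Finset.add_sum_erase _ (fun s => if s < i ∧ γ s = γ i then 1 else 0)
      (Finset.mem_univ i), hN]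
    simp only [lt_irrefl, if_false, false_and, zero_add, Finset.sum_sub_distrib]
    push_cast
    ring
  have hs : ∑ j ∈ Finset.univ.filter (· < i), permOp (swap i j) (polyP k γ) =
      ∑ j ∈ Finset.univ.erase i, if j < i then polyP k (compAct (swap i j) γ) else 0 := by
    rw [← Finset.sum_filter]
    refine Finset.sum_congr ?_ fun j _ => permOp_polyP k _ γ
    ext j
    simp only [Finset.mem_filter, Finset.mem_univ, true_and, Finset.mem_erase, and_true]
    exact ⟨fun h => ⟨h.ne, h⟩, fun h => h.2⟩
  have hmain : opU k i (polyP k γ) - kappa k γ i • polyP k γ =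
      k • ∑ j ∈ Finset.univ.erase i, (pairTerm k γ i j -
        (if j < i then polyP k (compAct (swap i j) γ) else 0) -
        ((1 : ℝ) - (if γ i < γ j then 1 else 0) -
        (if j < i ∧ γ j = γ i then 1 else 0)) • polyP k γ) := by
    rw [hκ, opU_apply, opD_polyP, hs]
    simp only [Finset.sum_sub_distrib, smul_sub]
    abel
  rw [hmain]
  refine Submodule.smul_mem _ _ (sum_mem fun j hj => ?_)
  have hj' : i ≠ j := (Finset.ne_of_mem_erase hj).symm
  have hp := pairTerm_sub_mem k γ hj'
  rcases lt_trichotomy (γ i) (γ j) with h | h | h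
  · rw [if_pos h] at hp
    have hne : ¬ (j < i ∧ γ j = γ i) := fun h' => h.ne' h'.2
    rw [if_pos h, if_neg hne]
    rcases lt_or_gt_of_ne hj' with hij | hij
    · rw [if_neg (not_lt.2 hij.le)]
      have h1 : polyP k (compAct (swap i j) γ) ∈
          Submodule.span ℝ (polyP k '' {β | Above β γ}) :=
        Submodule.subset_span ⟨_, above_swap γ hij h, rfl⟩
      simpa using add_mem hp h1
    · rw [if_pos hij]
      simpa using hp
  · rw [if_neg h.not_lt] at hp
    have h1 : compAct (swap i j) γ = γ := by
      rw [compAct_swap_eq_setPair γ hj', ← h]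
      nth_rw 2 [h]
      exact setPair_self γ i j
    rw [if_neg h.not_lt, h1]
    rcases lt_or_gt_of_ne hj' with hij | hij
    · simpa [not_lt.2 hij.le] using hp
    · simpa [hij, h.symm] using hp
  · rw [if_neg h.not_gt] at hp
    have hne : ¬ (j < i ∧ γ j = γ i) := fun h' => h.ne h'.2
    rw [if_neg h.not_gt, if_neg hne]
    rcases lt_or_gt_of_ne hj' with hij | hij
    · rw [if_neg (not_lt.2 hij.le)]
      simpa using hp
    · rw [if_pos hij]
      have h1 : polyP k (compAct (swap i j) γ) ∈
          Submodule.span ℝ (polyP k '' {β | Above β γ}) := by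
        rw [swap_comm]
        exact Submodule.subset_span ⟨_, above_swap γ hij h, rfl⟩
      have := sub_mem hp h1
      simp only [sub_zero, one_smul]
      rwa [sub_right_comm] at this

theorem opU_polyP_triangular (k : ℝ) (γ : Fin N → ℕ) (i : Fin N) :
    opU k i (polyP k γ) - kappa k γ i • polyP k γ ∈
      Submodule.span ℝ (polyP k '' {β | level γ < level β}) :=
  Submodule.span_mono (Set.image_mono fun _ h => h.level_lt) (opU_polyP_sub_mem k i γ)

theorem not_dominates_plus (β : Fin N → ℕ) : ¬ Dominates β (plus β) := by
  intro h
  have h1 : partialSums β ≤ partialSums (plus β) :=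
    Finset.sum_le_sum fun j _ => sum_le_sum_plus β _ j rfl
  exact absurd h.partialSums_lt (not_lt.2 h1)

theorem not_dominates_self (β : Fin N → ℕ) : ¬ Dominates β β := fun h => h.1 rfl

theorem finite_sum_eq (N n : ℕ) : {β : Fin N → ℕ | ∑ i, β i = n}.Finite := by
  refine (Finset.piAntidiag Finset.univ n).finite_toSet.subset fun β hβ => ?_
  simpa using hβ

/-- The labels with `β⁺ ≻ lam` of the same degree form a finite set closed upwards, avoiding the
eigenvalues of `lam`. A rearrangement of `lam` never dominates `lam`, so the error of `p_lam`
already lies in their span. -/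
theorem exists_isOmega {k : ℝ} (hk : 0 ≤ k) {lam : Fin N → ℕ} (hlam : Antitone lam) :
    ∃ f, IsOmega k lam f := by
  have hfin : {β : Fin N → ℕ | ∑ i, β i = ∑ i, lam i ∧ Dominates (plus β) lam}.Finite :=
    (finite_sum_eq N _).subset fun β hβ => hβ.1
  have hpl := plus_of_antitone hlam
  obtain ⟨f, hf, hfv⟩ := exists_joint_eigenvector (opU k) (opU_comm k) (polyP k) (kappa k) level
    hfin.toFinset (fun γ hγ j => by
      rw [Set.Finite.mem_toFinset] at hγ
      refine Submodule.span_mono (Set.image_mono fun β hβ => ?_) (opU_polyP_sub_mem k j γ)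
      refine ⟨?_, hβ.level_lt⟩
      rw [Set.Finite.mem_toFinset]
      refine ⟨hβ.1.trans hγ.1, ?_⟩
      rcases hβ.2 with h | h
      · exact h.trans hγ.2
      · rw [h.1]; exact hγ.2)
    (kappa k lam) (fun γ hγ h => by
      rw [Set.Finite.mem_toFinset] at hγ
      have h1 := hγ.2
      rw [kappa_injective hk h, hpl] at h1
      exact not_dominates_self _ h1)
    (polyP k lam) (fun j => by
      rw [Set.Finite.coe_toFinset]
      refine Submodule.span_mono (Set.image_mono fun β hβ => ?_) (opU_polyP_sub_mem k j lam)
      refine ⟨hβ.1, ?_⟩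
      rcases hβ.2 with h | h
      · rwa [hpl] at h
      · rw [hpl] at h
        exact absurd (h.1 ▸ h.2) (not_dominates_plus β))
  rw [Set.Finite.coe_toFinset] at hfv
  exact ⟨f, hf, hfv⟩

theorem omegaPart_spec {k : ℝ} (hk : 0 ≤ k) {lam : Fin N → ℕ} (hlam : Antitone lam) :
    IsOmega k lam (omegaPart k lam) :=
  Classical.epsilon_spec (exists_isOmega hk hlam)

theorem permOp_mem_span_polyP (k : ℝ) (w : Perm (Fin N)) {S : Set (Fin N → ℕ)}
    (hS : ∀ β ∈ S, compAct w β ∈ S) {f : Poly N} (hf : f ∈ Submodule.span ℝ (polyP k '' S)) :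
    permOp w f ∈ Submodule.span ℝ (polyP k '' S) := by
  have h : Submodule.span ℝ (polyP k '' S) ≤
      (Submodule.span ℝ (polyP k '' S)).comap (permOp w) := by
    rw [Submodule.span_le]
    rintro _ ⟨β, hβ, rfl⟩
    rw [SetLike.mem_coe, Submodule.mem_comap, permOp_polyP]
    exact Submodule.subset_span ⟨_, hS β hβ, rfl⟩
  exact h hf

/-- Here `κ_i = κ_j + k`, so the exchange relations make `ω - (i j) ω` a joint eigenvector with the
two eigenvalues swapped. If nonzero, its label would rearrange to `lam`, yet it is a combination of
`p_β` with `β⁺ ≻ lam`. -/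
theorem permOp_adjacent_omegaPart {k : ℝ} (hk : 0 ≤ k) {lam : Fin N → ℕ} (hlam : Antitone lam)
    {i j : Fin N} (hij : (j : ℕ) = i + 1) (h : lam i = lam j) :
    permOp (swap i j) (omegaPart k lam) = omegaPart k lam := by
  have hne : i ≠ j := fun e => by rw [e] at hij; omega
  obtain ⟨hev, hsp⟩ := omegaPart_spec hk hlam
  set ω := omegaPart k lam
  set S := {β : Fin N → ℕ | ∑ i, β i = ∑ i, lam i ∧ Dominates (plus β) lam} with hS
  have hs : permOp (swap i j) (polyP k lam) = polyP k lam := by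
    rw [permOp_polyP, compAct_swap_eq_setPair lam hne, ← h]
    nth_rw 2 [h]
    rw [setPair_self]
  have hfS : ω - permOp (swap i j) ω ∈ Submodule.span ℝ (polyP k '' S) := by
    have h1 := permOp_mem_span_polyP k (swap i j) (S := S)
      (fun β hβ => ⟨by rw [sum_compAct, hβ.1], by rw [plus_compAct]; exact hβ.2⟩) hsp
    have e : ω - permOp (swap i j) ω =
        (ω - polyP k lam) - permOp (swap i j) (ω - polyP k lam) := by
      rw [map_sub, hs]; abel
    rw [e]
    exact sub_mem hsp h1
  have hκ : kappa k lam i = kappa k lam j + k := by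
    rw [kappa_of_antitone k hlam, kappa_of_antitone k hlam, h, hij]
    push_cast
    ring
  have hfe : ∀ l, opU k l (ω - permOp (swap i j) ω) =
      (kappa k lam ∘ swap i j) l • (ω - permOp (swap i j) ω) := by
    intro l
    rw [map_sub, Function.comp_apply]
    rcases eq_or_ne l i with rfl | hi
    · have h1 := permOp_opU_succ' k hij ω
      rw [hev, map_smul] at h1
      rw [hev, swap_apply_left, eq_add_of_sub_eq h1.symm, hκ, smul_sub, add_smul]
      abel
    rcases eq_or_ne l j with rfl | hj
    · have h1 := permOp_opU_succ k hij ω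
      rw [hev, map_smul] at h1
      rw [hev, swap_apply_right, ← sub_eq_of_eq_add h1, hκ, smul_sub, add_smul, add_smul]
      abel
    · rw [← permOp_opU_of_ne k hij hi hj, hev, map_smul, swap_apply_of_ne_of_ne hi hj, smul_sub]
  by_contra hcon
  have hf0 : ω - permOp (swap i j) ω ≠ 0 := fun e => hcon (sub_eq_zero.1 e).symm
  obtain ⟨g, hg⟩ := exists_coordinates (linearIndependent_polyP (N := N) hk)
  obtain ⟨γ, hγ, hgγ⟩ := exists_label_of_eigenvector (opU k) level hg (opU_polyP_triangular k)
    (Submodule.span_mono (Set.image_subset_range _ _) hfS) hf0 hfe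
  have hγS : γ ∈ S := by
    by_contra hcon'
    exact hgγ (coordinates_eq_zero hg hfS hcon')
  have h2 := hγS.2
  rw [plus_eq_of_kappa_eq hk _ hγ, plus_of_antitone hlam] at h2
  exact not_dominates_self _ h2

theorem permOp_omegaPart {k : ℝ} (hk : 0 ≤ k) {lam : Fin N → ℕ} (hlam : Antitone lam)
    {w : Perm (Fin N)} (hw : ∀ i, lam (w i) = lam i) :
    permOp w (omegaPart k lam) = omegaPart k lam := by
  let H : Subgroup (Perm (Fin N)) :=
    { carrier := {w | permOp w (omegaPart k lam) = omegaPart k lam}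
      mul_mem' := fun {a b} ha hb => by
        simp only [Set.mem_ofPred_eq] at ha hb ⊢
        rw [permOp_mul_apply, hb, ha]
      one_mem' := by simp
      inv_mem' := fun {a} ha => by
        simp only [Set.mem_ofPred_eq] at ha ⊢
        conv_lhs => rw [← ha]
        rw [permOp_inv_apply] }
  exact mem_of_comp_eq lam
    (fun a b d hab hbd h => le_antisymm (hlam hab) (h ▸ hlam hbd)) H
    (fun i j hij h => permOp_adjacent_omegaPart hk hlam hij h) hw

/-- The sorting permutation of `w α` and `w` times that of `α` differ by an element stabilizing the
partition, which fixes `ω` of the partition. -/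
theorem permOp_omega {k : ℝ} (hk : 0 ≤ k) (w : Perm (Fin N)) (α : Fin N → ℕ) :
    permOp w (omega k α) = omega k (compAct w α) := by
  rw [omega, omega, plus_compAct, ← permOp_mul_apply]
  set v := sortPerm (compAct w α) with hv
  have h : permOp (v⁻¹ * (w * sortPerm α)) (omegaPart k (plus α)) = omegaPart k (plus α) := by
    apply permOp_omegaPart hk (plus_antitone α)
    intro i
    have h1 := compAct_sortPerm_plus (compAct w α)
    rw [plus_compAct, ← hv] at h1
    have h2 := congrFun h1 (w (sortPerm α i))
    rw [compAct_apply_apply, compAct_apply] at h2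
    exact h2
  rw [permOp_mul_apply] at h
  apply permOp_injective v⁻¹
  rw [h, permOp_inv_apply]

/-- Transporting the eigenvalue equation of the partition gives `U_i` with its transposition sum
taken over the `t` preceding `i` in the sorted order instead of `t < i`. The two sums differ only in
transpositions moving a larger entry left. -/
theorem opU_omega_sub_mem {k : ℝ} (hk : 0 ≤ k) (i : Fin N) (α : Fin N → ℕ) :
    opU k i (omega k α) - kappa k α i • omega k α ∈
      Submodule.span ℝ (omega k '' {β | plus β = plus α ∧ Dominates β α}) := by
  obtain ⟨r, hr⟩ := (sortPerm α).surjective i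
  have h1 := congrArg (permOp (sortPerm α)) ((omegaPart_spec hk (plus_antitone α)).1 r)
  rw [opU_apply] at h1
  simp only [map_add, map_sub, map_smul, map_sum, permOp_opD, hr, ← kappa_sortPerm] at h1
  have h2 : ∑ s ∈ Finset.univ.filter (· < r),
      permOp (sortPerm α) (permOp (swap r s) (omegaPart k (plus α))) =
      ∑ t ∈ Finset.univ.filter (fun t => α i < α t ∨ (α t = α i ∧ t < i)),
        permOp (swap i t) (omega k α) := by
    refine Finset.sum_bij' (fun s _ => sortPerm α s) (fun t _ => (sortPerm α)⁻¹ t) ?_ ?_ ?_ ?_ ?_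
    · intro s hs
      simpa [← hr, ← sortPerm_lt_iff] using hs
    · intro t ht
      obtain ⟨s, rfl⟩ := (sortPerm α).surjective t
      simpa [← hr, ← sortPerm_lt_iff] using ht
    · intro s _; simp
    · intro t _; simp
    · intro s _
      rw [← permOp_mul_apply, mul_swap_eq_swap_mul, permOp_mul_apply, hr, omega]
  rw [h2] at h1
  have h3 : opU k i (omega k α) - kappa k α i • omega k α = k • ∑ t,
      ((if α i < α t ∨ (α t = α i ∧ t < i) then permOp (swap i t) (omega k α) else 0) -
        (if t < i then permOp (swap i t) (omega k α) else 0)) := by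
    rw [opU_apply, Finset.sum_sub_distrib, ← Finset.sum_filter, ← Finset.sum_filter, smul_sub]
    have h4 : kappa k α i • omega k α = kappa k α i • permOp (sortPerm α)
      (omegaPart k (plus α)) := rfl
    rw [h4, ← h1]
    simp only [omega]
    abel
  rw [h3]
  refine Submodule.smul_mem _ _ (sum_mem fun t _ => ?_)
  have hmem : ∀ a b : Fin N, a < b → α a < α b → omega k (compAct (swap a b) α) ∈
      Submodule.span ℝ (omega k '' {β | plus β = plus α ∧ Dominates β α}) := fun a b hab h =>
    Submodule.subset_span ⟨_, ⟨plus_compAct _ _, compAct_swap_dominates α hab h⟩, rfl⟩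
  rw [permOp_omega hk]
  split_ifs with h4 h5 h5
  · simp
  · rcases h4 with h4 | h4
    · rw [sub_zero]
      refine hmem i t ((not_lt.1 h5).lt_of_ne ?_) h4
      rintro rfl
      exact lt_irrefl _ h4
    · exact absurd h4.2 h5
  · have h6 : α t < α i := by
      by_contra h7
      rcases (not_lt.1 h7).lt_or_eq with h8 | h8
      · exact h4 (Or.inl h8)
      · exact h4 (Or.inr ⟨h8.symm, h5⟩)
    rw [zero_sub, swap_comm]
    exact neg_mem (hmem t i h5 h6)
  · simp

theorem exists_isZeta {k : ℝ} (hk : 0 ≤ k) (α : Fin N → ℕ) : ∃ f, IsZeta k α f := by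
  have hfin : {β : Fin N → ℕ | plus β = plus α ∧ Dominates β α}.Finite :=
    (finite_sum_eq N (∑ i, α i)).subset fun β hβ => sum_eq_of_plus_eq hβ.1
  obtain ⟨f, hf, hfv⟩ := exists_joint_eigenvector (opU k) (opU_comm k) (omega k) (kappa k)
    partialSums hfin.toFinset (fun γ hγ j => by
      rw [Set.Finite.mem_toFinset] at hγ
      refine Submodule.span_mono (Set.image_mono fun β hβ => ?_) (opU_omega_sub_mem hk j γ)
      refine ⟨?_, hβ.2.partialSums_lt⟩
      rw [Set.Finite.mem_toFinset]
      exact ⟨hβ.1.trans hγ.1, hβ.2.trans hγ.2⟩)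
    (kappa k α) (fun γ hγ h => by
      rw [Set.Finite.mem_toFinset] at hγ
      have h1 := hγ.2
      rw [kappa_injective hk h] at h1
      exact not_dominates_self _ h1)
    (omega k α) (fun j => by
      rw [Set.Finite.coe_toFinset]
      exact opU_omega_sub_mem hk j α)
  rw [Set.Finite.coe_toFinset] at hfv
  exact ⟨f, hf, hfv⟩

theorem zeta_spec {k : ℝ} (hk : 0 ≤ k) (α : Fin N → ℕ) : IsZeta k α (zeta k α) :=
  Classical.epsilon_spec (exists_isZeta hk α)

theorem omega_sub_polyP_mem {k : ℝ} (hk : 0 ≤ k) (α : Fin N → ℕ) :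
    omega k α - polyP k α ∈
      Submodule.span ℝ (polyP k '' {β | Dominates (plus β) (plus α)}) := by
  have h1 := (omegaPart_spec hk (plus_antitone α)).2
  have h2 := permOp_mem_span_polyP k (sortPerm α)
    (S := {β | ∑ i, β i = ∑ i, plus α i ∧ Dominates (plus β) (plus α)})
    (fun β hβ => ⟨by rw [sum_compAct, hβ.1], by rw [plus_compAct]; exact hβ.2⟩) h1
  rw [map_sub, permOp_polyP, compAct_sortPerm_plus] at h2
  exact Submodule.span_mono (Set.image_mono fun β hβ => hβ.2) h2

theorem omega_mem_span {k : ℝ} (hk : 0 ≤ k) (α : Fin N → ℕ) :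
    omega k α ∈ Submodule.span ℝ (Set.range (polyP k)) := by
  rw [← sub_add_cancel (omega k α) (polyP k α)]
  exact add_mem (Submodule.span_mono (Set.image_subset_range _ _) (omega_sub_polyP_mem hk α))
    (Submodule.subset_span ⟨α, rfl⟩)

theorem zeta_mem_span {k : ℝ} (hk : 0 ≤ k) (α : Fin N → ℕ) :
    zeta k α ∈ Submodule.span ℝ (Set.range (polyP k)) := by
  rw [← sub_add_cancel (zeta k α) (omega k α)]
  refine add_mem (Submodule.span_le.2 ?_ (zeta_spec hk α).2) (omega_mem_span hk α)
  rintro _ ⟨β, _, rfl⟩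
  exact omega_mem_span hk β

/-- The coefficient of `p_α` in `ζ_α` is `1`: for `β⁺ = α⁺`, the only `p_γ` with `γ⁺ = α⁺` in `ω_β`
is `p_β`. -/
theorem zeta_ne_zero {k : ℝ} (hk : 0 ≤ k) (α : Fin N → ℕ) : zeta k α ≠ 0 := by
  obtain ⟨g, hg⟩ := exists_coordinates (linearIndependent_polyP (N := N) hk)
  have hω : ∀ β, plus β = plus α → g (omega k β) α = g (polyP k β) α := by
    intro β hβ
    have := coordinates_eq_zero hg (omega_sub_polyP_mem hk β) (γ := α) (by
      rw [Set.mem_ofPred_eq, hβ]; exact not_dominates_self _)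
    rwa [map_sub, Finsupp.sub_apply, sub_eq_zero] at this
  have h1 : ∀ x ∈ Submodule.span ℝ (omega k '' {β | plus β = plus α ∧ Dominates β α}),
      g x α = 0 := by
    intro x hx
    induction hx using Submodule.span_induction with
    | mem x hx =>
      obtain ⟨β, hβ, rfl⟩ := hx
      rw [hω β hβ.1, hg, Finsupp.single_eq_of_ne]
      rintro rfl
      exact not_dominates_self _ hβ.2
    | zero => simp
    | add x y _ _ hx hy => rw [map_add, Finsupp.add_apply, hx, hy, add_zero]
    | smul a x _ hx => rw [map_smul, Finsupp.smul_apply, hx, smul_zero]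
  have h2 := h1 _ (zeta_spec hk α).2
  rw [map_sub, Finsupp.sub_apply, hω α rfl, hg, Finsupp.single_eq_same, sub_eq_zero] at h2
  intro h0
  rw [h0] at h2
  simp at h2

/-- A joint eigenvector of the `U_i` with the eigenvalues of `ζ_γ` is a multiple of `ζ_γ`. -/
theorem exists_smul_zeta {k : ℝ} (hk : 0 ≤ k) (γ : Fin N → ℕ) {f : Poly N}
    (hf : f ∈ Submodule.span ℝ (Set.range (polyP k)))
    (hev : ∀ i, opU k i f = kappa k γ i • f) : ∃ a : ℝ, f = a • zeta k γ := by
  obtain ⟨g, hg⟩ := exists_coordinates (linearIndependent_polyP (N := N) hk)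
  -- The eigenvalues of a nonzero joint eigenvector determine a label with nonzero coordinate, and
  -- injectivity of `κ` makes that label `γ`.
  have key : ∀ h ∈ Submodule.span ℝ (Set.range (polyP k)),
      (∀ i, opU k i h = kappa k γ i • h) → g h γ = 0 → h = 0 := by
    intro h hh hhe h0
    by_contra hne
    obtain ⟨δ, hδ, hgδ⟩ := exists_label_of_eigenvector (opU k) level hg
      (opU_polyP_triangular k) hh hne hhe
    rw [kappa_injective hk hδ] at hgδ
    exact hgδ h0
  have hz : g (zeta k γ) γ ≠ 0 := fun h0 =>
    zeta_ne_zero hk γ (key _ (zeta_mem_span hk γ) (zeta_spec hk γ).1 h0)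
  refine ⟨g f γ / g (zeta k γ) γ, sub_eq_zero.1 (key _ ?_ ?_ ?_)⟩
  · exact sub_mem hf (Submodule.smul_mem _ _ (zeta_mem_span hk γ))
  · intro i
    rw [map_sub, map_smul, hev, (zeta_spec hk γ).1, smul_sub, smul_comm]
  · rw [map_sub, map_smul, Finsupp.sub_apply, Finsupp.smul_apply, smul_eq_mul,
      div_mul_cancel₀ _ hz, sub_self]

theorem permOp_zeta_mem_span {k : ℝ} (hk : 0 ≤ k) (w : Perm (Fin N)) (α : Fin N → ℕ) :
    permOp w (zeta k α) ∈ Submodule.span ℝ (Set.range (polyP k)) := by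
  have := zeta_mem_span hk α
  rw [← Set.image_univ] at this ⊢
  exact permOp_mem_span_polyP k w (fun _ _ => Set.mem_univ _) this

end Jack

/-! ### The group `S_I`, `ψ_I` as a skew-symmetrization, and the Vandermonde sum -/

section Interval

variable {N : ℕ}

theorem mem_interval {ℓ m : ℕ} {i : Fin N} :
    i ∈ interval N ℓ m ↔ ℓ ≤ (i : ℕ) ∧ (i : ℕ) < ℓ + m := by
  simp [interval]

theorem interval_succ {ℓ s : ℕ} (h : ℓ + s < N) :
    interval N ℓ (s + 1) = insert ⟨ℓ + s, h⟩ (interval N ℓ s) := by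
  ext i
  simp only [mem_interval, Finset.mem_insert, Fin.ext_iff]
  omega

theorem notMem_interval {ℓ s : ℕ} (h : ℓ + s < N) : (⟨ℓ + s, h⟩ : Fin N) ∉ interval N ℓ s := by
  simp [mem_interval]

theorem mem_permGroup {I : Finset (Fin N)} {w : Perm (Fin N)} :
    w ∈ permGroup I ↔ ∀ i, i ∉ I → w i = i := Iff.rfl

theorem apply_mem_of_mem_permGroup {I : Finset (Fin N)} {w : Perm (Fin N)} (hw : w ∈ permGroup I)
    {i : Fin N} (hi : i ∈ I) : w i ∈ I := by
  by_contra h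
  exact h (by rwa [w.injective (hw _ h)])

theorem swap_mem_permGroup {I : Finset (Fin N)} {i j : Fin N} (hi : i ∈ I) (hj : j ∈ I) :
    swap i j ∈ permGroup I := fun _ hl =>
  swap_apply_of_ne_of_ne (fun h => hl (h ▸ hi)) (fun h => hl (h ▸ hj))

theorem permGroup_interval_induction {ℓ m : ℕ} {P : Perm (Fin N) → Prop} (one : P 1)
    (step : ∀ i ∈ interval N ℓ m, ∀ j ∈ interval N ℓ m, (j : ℕ) = i + 1 →
      ∀ w ∈ permGroup (interval N ℓ m), P w → P (swap i j * w))
    {w : Perm (Fin N)} (hw : w ∈ permGroup (interval N ℓ m)) : P w := by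
  set S : Set (Perm (Fin N)) := {s | ∃ i ∈ interval N ℓ m, ∃ j ∈ interval N ℓ m,
    (j : ℕ) = i + 1 ∧ s = swap i j}
  have hSG : Subgroup.closure S ≤ permGroup (interval N ℓ m) := by
    rw [Subgroup.closure_le]
    rintro _ ⟨i, hi, j, hj, _, rfl⟩
    exact swap_mem_permGroup hi hj
  have hmem : w ∈ Subgroup.closure S := by
    -- The colouring makes `I` a single convex fibre and every other point a fibre of its own.
    apply mem_of_comp_eq (fun i => if i ∈ interval N ℓ m then none else some i)
    · intro a b d hab hbd h
      rw [Fin.le_def] at hab hbd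
      by_cases ha : a ∈ interval N ℓ m <;> by_cases hd : d ∈ interval N ℓ m
      · have hb : b ∈ interval N ℓ m := by
          rw [mem_interval] at ha hd ⊢
          omega
        simp [ha, hb]
      · simp [ha, hd] at h
      · simp [ha, hd] at h
      · simp only [ha, hd, if_false, Option.some.injEq] at h
        subst h
        rw [le_antisymm (Fin.le_def.2 hbd) (Fin.le_def.2 hab)]
    · intro i j hij h
      have hne : i ≠ j := fun e => by rw [e] at hij; omega
      apply Subgroup.subset_closure
      by_cases hi : i ∈ interval N ℓ m <;> by_cases hj : j ∈ interval N ℓ m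
      · exact ⟨i, hi, j, hj, hij, rfl⟩
      · simp [hi, hj] at h
      · simp [hi, hj] at h
      · simp only [hi, hj, if_false, Option.some.injEq] at h
        exact absurd h hne
    · intro i
      by_cases hi : i ∈ interval N ℓ m
      · simp [hi, apply_mem_of_mem_permGroup hw hi]
      · rw [hw i hi]
  induction hmem using Subgroup.closure_induction_left with
  | one => exact one
  | mul_left x hx y hy ih =>
    obtain ⟨i, hi, j, hj, hij, rfl⟩ := hx
    exact step i hi j hj hij y (hSG hy) (ih (hSG hy))
  | inv_mul_cancel x hx y hy ih =>
    obtain ⟨i, hi, j, hj, hij, rfl⟩ := hx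
    rw [swap_inv]
    exact step i hi j hj hij y (hSG hy) (ih (hSG hy))

theorem prodU_zero (k : ℝ) (ℓ : ℕ) : prodU k (interval N ℓ 0) = 1 := by
  have : interval N ℓ 0 = ∅ := by
    ext i
    simp [mem_interval]
  simp [prodU, this]

theorem prodU_succ (k : ℝ) {ℓ s : ℕ} (h : ℓ + s < N) :
    prodU k (interval N ℓ (s + 1)) = prodU k (interval N ℓ s) * opU k ⟨ℓ + s, h⟩ := by
  have hl : (List.finRange N).filter (fun i => i ∈ interval N ℓ (s + 1)) =
      (List.finRange N).filter (fun i => i ∈ interval N ℓ s) ++ [⟨ℓ + s, h⟩] := by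
    have hs : ∀ t, ((List.finRange N).filter fun i => i ∈ interval N ℓ t).Pairwise (· < ·) :=
      fun t => (List.pairwise_lt_finRange N).filter _
    have h2 : ((List.finRange N).filter (fun i => i ∈ interval N ℓ s) ++
        [(⟨ℓ + s, h⟩ : Fin N)]).Pairwise (· < ·) := by
      rw [List.pairwise_append]
      refine ⟨hs s, List.pairwise_singleton _ _, ?_⟩
      intro a ha b hb
      rw [List.mem_singleton] at hb
      subst hb
      simp only [List.mem_filter, decide_eq_true_eq, mem_interval] at ha
      rw [Fin.lt_def]
      exact ha.2.2
    refine List.Perm.eq_of_pairwise (fun a b _ _ h1 h2 => absurd h1 h2.asymm) (hs _) h2 ?_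
    rw [List.perm_ext_iff_of_nodup ((List.nodup_finRange N).filter _)
      (h2.imp fun h => h.ne)]
    intro a
    simp [interval_succ h, or_comm]
  rw [prodU, hl, List.map_append, List.prod_append]
  simp [prodU]

/-- The correction terms `± k` of the two exchange relations cancel in the product `U_i U_j`, and
the other factors commute with `(i j)`. -/
theorem commute_swap_prodU (k : ℝ) {ℓ s : ℕ} (hs : ℓ + s ≤ N) {i j : Fin N}
    (hij : (j : ℕ) = i + 1) (hout : (j : ℕ) < ℓ ∨ ℓ + s ≤ (i : ℕ) ∨
      (ℓ ≤ (i : ℕ) ∧ (j : ℕ) < ℓ + s)) :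
    Commute (permOp (swap i j)) (prodU k (interval N ℓ s)) := by
  induction s using Nat.strong_induction_on with
  | _ s ih =>
  have hU : ∀ l : Fin N, l ≠ i → l ≠ j → Commute (permOp (swap i j)) (opU k l) :=
    fun l hi hj => LinearMap.ext fun f => permOp_opU_of_ne k hij hi hj f
  rcases s with _ | s
  · rw [prodU_zero]; exact Commute.one_right _
  · rw [prodU_succ k hs]
    by_cases hjt : (j : ℕ) = ℓ + s
    -- When the last factor is `U_j`, the factor `U_i` is peeled off with it.
    · rcases s with _ | s
      · omega
      · rw [prodU_succ k (by omega), mul_assoc]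
        have ei : (⟨ℓ + s, by omega⟩ : Fin N) = i := Fin.ext (by simp only; omega)
        have ej : (⟨ℓ + (s + 1), hs⟩ : Fin N) = j := Fin.ext (by simp only; omega)
        rw [ei, ej]
        refine (ih s (by omega) (by omega) (by omega)).mul_right ?_
        apply LinearMap.ext
        intro f
        have h1 := permOp_opU_succ k hij (opU k j f)
        rw [permOp_opU_succ' k hij f, map_sub, map_smul, sub_add_cancel] at h1
        simp only [Module.End.mul_apply]
        rw [h1, opU_comm]
    · refine (ih s (by omega) (by omega) (by omega)).mul_right (hU _ ?_ ?_)
      · intro e; rw [← e] at hij hout; simp only at hij hout; omega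
      · intro e; rw [← e] at hjt; exact hjt rfl

theorem commute_permOp_prodU (k : ℝ) {ℓ s : ℕ} (hs : ℓ + s ≤ N) {w : Perm (Fin N)}
    (hw : w ∈ permGroup (interval N ℓ s)) :
    Commute (permOp w) (prodU k (interval N ℓ s)) := by
  refine permGroup_interval_induction (P := fun w => Commute (permOp w)
    (prodU k (interval N ℓ s))) ?_ ?_ hw
  · rw [permOp_one]; exact Commute.one_left _
  · intro i hi j hj hij v _ hv
    rw [permOp_mul]
    rw [mem_interval] at hi hj
    exact (commute_swap_prodU k hs hij (Or.inr (Or.inr ⟨hi.1, hj.2⟩))).mul_left hv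

/-- The sign of a permutation, as a real number. -/
def sgn (w : Perm (Fin N)) : ℝ := ((Perm.sign w : ℤ) : ℝ)

@[simp]
theorem sgn_one : sgn (1 : Perm (Fin N)) = 1 := by simp [sgn]

theorem sgn_mul (v w : Perm (Fin N)) : sgn (v * w) = sgn v * sgn w := by simp [sgn]

theorem sgn_inv (w : Perm (Fin N)) : sgn w⁻¹ = sgn w := by simp [sgn]

theorem sgn_swap {i j : Fin N} (h : i ≠ j) : sgn (swap i j) = -1 := by
  simp [sgn, Perm.sign_swap h]

theorem sgn_mul_self (w : Perm (Fin N)) : sgn w * sgn w = 1 := by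
  have h := sgn_mul w w⁻¹
  rw [mul_inv_cancel, sgn_one, sgn_inv] at h
  exact h.symm

/-- The signed conjugate `sgn(w) w T w⁻¹`. -/
def signedConj (T : Module.End ℝ (Poly N)) (w : Perm (Fin N)) : Module.End ℝ (Poly N) :=
  sgn w • (permOp w * T * permOp w⁻¹)

/-- The skew-symmetrization `∑_{w ∈ S_I} sgn(w) w T w⁻¹` of an operator. -/
def signedSum (I : Finset (Fin N)) (T : Module.End ℝ (Poly N)) : Module.End ℝ (Poly N) :=
  ∑ w : permGroup I, signedConj T w

theorem signedConj_mul (T : Module.End ℝ (Poly N)) (v w : Perm (Fin N)) :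
    signedConj T (v * w) = sgn v • (permOp v * signedConj T w * permOp v⁻¹) := by
  simp only [signedConj, sgn_mul, permOp_mul, mul_inv_rev, mul_smul, mul_smul_comm,
    smul_mul_assoc, mul_assoc]

theorem signedConj_conj (T : Module.End ℝ (Poly N)) (v w : Perm (Fin N)) :
    signedConj (permOp v * T * permOp v⁻¹) w = sgn v • signedConj T (w * v) := by
  simp only [signedConj, sgn_mul, permOp_mul, mul_inv_rev, smul_smul, mul_assoc]
  rw [mul_left_comm, sgn_mul_self, mul_one]

/-- Reindexing the sum by right multiplication with `v`. -/
theorem signedSum_conj (I : Finset (Fin N)) (T : Module.End ℝ (Poly N)) {v : Perm (Fin N)}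
    (hv : v ∈ permGroup I) :
    signedSum I (permOp v * T * permOp v⁻¹) = sgn v • signedSum I T := by
  simp only [signedSum, signedConj_conj, ← Finset.smul_sum]
  congr 1
  exact Equiv.sum_comp (Equiv.mulRight (⟨v, hv⟩ : permGroup I))
    (fun w : permGroup I => signedConj T w)

theorem signedSum_add (I : Finset (Fin N)) (T T' : Module.End ℝ (Poly N)) :
    signedSum I (T + T') = signedSum I T + signedSum I T' := by
  simp only [signedSum, signedConj, mul_add, add_mul, smul_add, Finset.sum_add_distrib]

/-- The operator `U_{ℓ+1}^{m-1} U_{ℓ+2}^{m-2} ⋯ U_{ℓ+m-1}`. -/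
def stairU (N : ℕ) (k : ℝ) (ℓ : ℕ) : ℕ → Module.End ℝ (Poly N)
  | 0 => 1
  | s + 1 => prodU k (interval N ℓ s) * stairU N k ℓ s

theorem sum_permGroup {A : Type*} [AddCommMonoid A] (I : Finset (Fin N))
    [DecidablePred (· ∈ permGroup I)] (F : Perm (Fin N) → A) :
    ∑ w : permGroup I, F w = ∑ w ∈ Finset.univ.filter (· ∈ permGroup I), F w :=
  (Finset.sum_subtype _ (fun w => by simp) F).symm

/-- Coset decomposition with respect to the stabilizer of the new point `t`: an element `u` lies in
the coset of `(u t, t)`, where `u t = t` gives the identity coset. -/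
theorem sum_permGroup_interval_succ {A : Type*} [AddCommMonoid A] {ℓ s : ℕ} (h : ℓ + s < N)
    (F : Perm (Fin N) → A) :
    ∑ w : permGroup (interval N ℓ (s + 1)), F w =
      ∑ w : permGroup (interval N ℓ s), F w + ∑ i ∈ interval N ℓ s,
        ∑ w : permGroup (interval N ℓ s), F (swap i ⟨ℓ + s, h⟩ * w) := by
  classical
  set t : Fin N := ⟨ℓ + s, h⟩ with ht
  have htI : t ∉ interval N ℓ s := notMem_interval h
  have e : ∑ w : permGroup (interval N ℓ s), F w =
      ∑ w : permGroup (interval N ℓ s), F (swap t t * w) := by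
    have h1 : swap t t = 1 := swap_self t
    simp only [h1, one_mul]
  rw [e, ← Finset.sum_insert (f := fun i => ∑ w : permGroup (interval N ℓ s),
    F (swap i t * w)) htI, ← interval_succ h]
  have e2 : ∀ i, ∑ w : permGroup (interval N ℓ s), F (swap i t * w) =
      ∑ w ∈ Finset.univ.filter (· ∈ permGroup (interval N ℓ s)), F (swap i t * w) :=
    fun i => sum_permGroup _ fun w => F (swap i t * w)
  simp only [e2]
  rw [sum_permGroup, ← Finset.sum_product']
  symm
  have htI' : t ∈ interval N ℓ (s + 1) := by simp [interval_succ h, ht]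
  have hsub : ∀ i, i ∈ interval N ℓ s → i ∈ interval N ℓ (s + 1) := fun i hi => by
    rw [interval_succ h]; exact Finset.mem_insert_of_mem hi
  refine Finset.sum_bij' (fun q _ => swap q.1 t * q.2) (fun u _ => (u t, swap (u t) t * u))
    ?_ ?_ ?_ ?_ ?_
  · rintro ⟨i, w⟩ hq
    simp only [Finset.mem_product, Finset.mem_filter, Finset.mem_univ, true_and] at hq ⊢
    exact mul_mem (swap_mem_permGroup hq.1 htI') (fun l hl => hq.2 l fun h' => hl (hsub l h'))
  · intro u hu
    simp only [Finset.mem_product, Finset.mem_filter, Finset.mem_univ, true_and] at hu ⊢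
    refine ⟨apply_mem_of_mem_permGroup hu htI', fun l hl => ?_⟩
    rw [Perm.mul_apply]
    by_cases hlt : l = t
    · rw [hlt, swap_apply_left]
    · have hl' : l ∉ interval N ℓ (s + 1) := by
        rw [interval_succ h, Finset.mem_insert, not_or]; exact ⟨hlt, hl⟩
      rw [hu l hl', swap_apply_of_ne_of_ne _ hlt]
      intro h'
      exact hl' (h' ▸ apply_mem_of_mem_permGroup hu htI')
  · rintro ⟨i, w⟩ hq
    simp only [Finset.mem_product, Finset.mem_filter, Finset.mem_univ, true_and] at hq
    simp [hq.2 t htI, ← mul_assoc]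
  · intro u _
    simp [← mul_assoc]
  · rintro ⟨i, w⟩ _
    rfl

theorem signedSum_interval_succ {ℓ s : ℕ} (h : ℓ + s < N) (T : Module.End ℝ (Poly N)) :
    signedSum (interval N ℓ (s + 1)) T = signedSum (interval N ℓ s) T -
      ∑ i ∈ interval N ℓ s, permOp (swap i ⟨ℓ + s, h⟩) * signedSum (interval N ℓ s) T *
        permOp (swap i ⟨ℓ + s, h⟩) := by
  rw [signedSum, sum_permGroup_interval_succ h, sub_eq_add_neg, ← Finset.sum_neg_distrib]
  congr 1
  refine Finset.sum_congr rfl fun i hi => ?_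
  have hne : i ≠ ⟨ℓ + s, h⟩ := fun e => notMem_interval h (e ▸ hi)
  simp only [signedSum, Finset.mul_sum, Finset.sum_mul, ← Finset.sum_neg_distrib]
  refine Finset.sum_congr rfl fun w _ => ?_
  rw [signedConj_mul, sgn_swap hne, swap_inv]
  exact neg_one_smul ℝ (permOp (swap i ⟨ℓ + s, h⟩) * signedConj T w *
    permOp (swap i ⟨ℓ + s, h⟩))

theorem prodU_mul_signedSum (k : ℝ) {ℓ s : ℕ} (hs : ℓ + s ≤ N) (T : Module.End ℝ (Poly N)) :
    prodU k (interval N ℓ s) * signedSum (interval N ℓ s) T =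
      signedSum (interval N ℓ s) (prodU k (interval N ℓ s) * T) := by
  simp only [signedSum, Finset.mul_sum]
  refine Finset.sum_congr rfl fun w _ => ?_
  have := (commute_permOp_prodU k hs w.2).eq
  simp only [signedConj, mul_smul_comm, ← mul_assoc, this]

/-- The recursion for `ψ` is the coset decomposition of the signed sum, and the product of the `U_i`
may be moved inside because it commutes with the smaller group. -/
theorem skewOp_eq_signedSum (k : ℝ) {ℓ s : ℕ} (hs : ℓ + s ≤ N) :
    skewOp k ℓ s hs = signedSum (interval N ℓ s) (stairU N k ℓ s) := by
  induction s with
  | zero =>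
    have huniq : ∀ w : permGroup (interval N ℓ 0), w = 1 := by
      intro w
      apply Subtype.ext
      apply Equiv.ext
      intro i
      exact w.2 i (by simp [mem_interval])
    rw [signedSum, Fintype.sum_eq_single 1 (fun w hw => absurd (huniq w) hw)]
    simp [skewOp, stairU, signedConj]
  | succ s ih =>
    rw [stairU, signedSum_interval_succ hs, ← prodU_mul_signedSum k (Nat.le_of_succ_le hs),
      ← ih (Nat.le_of_succ_le hs)]
    rfl

/-- The eigenvalue of `stairU` on a joint eigenvector of the `U_i` with eigenvalues `a`. -/
def stairScalar (ℓ m : ℕ) (a : Fin N → ℝ) : ℝ := ∏ i ∈ interval N ℓ m, a i ^ (ℓ + m - 1 - i)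

theorem stairScalar_succ {ℓ s : ℕ} (h : ℓ + s < N) (a : Fin N → ℝ) :
    stairScalar ℓ (s + 1) a = (∏ i ∈ interval N ℓ s, a i) * stairScalar ℓ s a := by
  rw [stairScalar, interval_succ h, Finset.prod_insert (notMem_interval h), stairScalar,
    ← Finset.prod_mul_distrib]
  have e : ℓ + (s + 1) - 1 - (ℓ + s) = 0 := by omega
  simp only [e, pow_zero, one_mul]
  refine Finset.prod_congr rfl fun i hi => ?_
  rw [mem_interval] at hi
  rw [← pow_succ']
  congr 1
  omega

theorem prodU_apply_eigenvector (k : ℝ) {ℓ s : ℕ} (hs : ℓ + s ≤ N) {a : Fin N → ℝ} {f : Poly N}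
    (hf : ∀ i, opU k i f = a i • f) :
    prodU k (interval N ℓ s) f = (∏ i ∈ interval N ℓ s, a i) • f := by
  induction s with
  | zero =>
    rw [prodU_zero, Finset.prod_eq_one (fun i hi => by simp [mem_interval] at hi; omega)]
    simp
  | succ s ih =>
    rw [prodU_succ k hs, Module.End.mul_apply, hf, map_smul, ih (by omega), interval_succ hs,
      Finset.prod_insert (notMem_interval hs), smul_smul]

theorem stairU_apply_eigenvector (k : ℝ) {ℓ s : ℕ} (hs : ℓ + s ≤ N) {a : Fin N → ℝ} {f : Poly N}
    (hf : ∀ i, opU k i f = a i • f) : stairU N k ℓ s f = stairScalar ℓ s a • f := by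
  induction s with
  | zero =>
    rw [stairU, stairScalar,
      Finset.prod_eq_one (fun i hi => by simp [mem_interval] at hi; omega)]
    simp
  | succ s ih =>
    rw [stairU, Module.End.mul_apply, ih (by omega), map_smul,
      prodU_apply_eigenvector k (by omega) hf, stairScalar_succ hs, smul_smul, mul_comm]

/-- The interval as a copy of `Fin m`. -/
def intervalEquiv {ℓ m : ℕ} (h : ℓ + m ≤ N) : Fin m ≃ {i // i ∈ interval N ℓ m} where
  toFun r := ⟨⟨ℓ + r, by omega⟩, by rw [mem_interval]; simp⟩
  invFun i := ⟨(i : Fin N) - ℓ, by have := mem_interval.1 i.2; omega⟩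
  left_inv r := by ext; simp
  right_inv i := by
    have := mem_interval.1 i.2
    ext
    simp only
    omega

/-- The group of the interval as a copy of the symmetric group. -/
def permGroupEquiv {ℓ m : ℕ} (h : ℓ + m ≤ N) : Perm (Fin m) ≃ permGroup (interval N ℓ m) :=
  (intervalEquiv h).permCongr.trans (Perm.subtypeEquivSubtypePerm (· ∈ interval N ℓ m))

theorem coe_permGroupEquiv {ℓ m : ℕ} (h : ℓ + m ≤ N) (σ : Perm (Fin m)) :
    (permGroupEquiv h σ : Perm (Fin N)) = Perm.ofSubtype ((intervalEquiv h).permCongr σ) := rfl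

theorem sgn_permGroupEquiv {ℓ m : ℕ} (h : ℓ + m ≤ N) (σ : Perm (Fin m)) :
    sgn (permGroupEquiv h σ : Perm (Fin N)) = ((Perm.sign σ : ℤ) : ℝ) := by
  rw [sgn, coe_permGroupEquiv, Perm.sign_ofSubtype, Perm.sign_permCongr]

theorem permGroupEquiv_apply {ℓ m : ℕ} (h : ℓ + m ≤ N) (σ : Perm (Fin m)) (r : Fin m) :
    (permGroupEquiv h σ : Perm (Fin N)) (intervalEquiv h r) = intervalEquiv h (σ r) := by
  rw [coe_permGroupEquiv, Perm.ofSubtype_apply_coe, permCongr_apply, symm_apply_apply]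

theorem prod_interval {ℓ m : ℕ} (h : ℓ + m ≤ N) (F : Fin N → ℝ) :
    ∏ i ∈ interval N ℓ m, F i = ∏ r : Fin m, F (intervalEquiv h r) := by
  rw [Finset.prod_subtype (p := (· ∈ interval N ℓ m)) _ (fun _ => Iff.rfl),
    ← Equiv.prod_comp (intervalEquiv h)]

/-- This is the Leibniz expansion of a Vandermonde determinant; summing over inverses turns `a ∘
w⁻¹` into `a ∘ w`. -/
theorem sum_sgn_mul_stairScalar {ℓ m : ℕ} (h : ℓ + m ≤ N) (a : Fin N → ℝ) :
    ∑ w : permGroup (interval N ℓ m), sgn (w : Perm (Fin N)) *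
        stairScalar ℓ m (a ∘ ((w : Perm (Fin N))⁻¹ : Perm (Fin N))) =
      ∏ i ∈ interval N ℓ m, ∏ j ∈ (interval N ℓ m).filter (fun j => i < j), (a i - a j) := by
  set b : Fin m → ℝ := fun r => a (intervalEquiv h r) with hb
  have hlt : ∀ r t : Fin m, (intervalEquiv h r : Fin N) < intervalEquiv h t ↔ r < t := by
    intro r t
    rw [Fin.lt_def, Fin.lt_def]
    simp [intervalEquiv]
  have h1 : ∏ i ∈ interval N ℓ m, ∏ j ∈ (interval N ℓ m).filter (fun j => i < j), (a i - a j) =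
      ∏ r, ∏ t ∈ Finset.Ioi r, (b r - b t) := by
    rw [prod_interval h]
    refine Finset.prod_congr rfl fun r _ => ?_
    rw [Finset.prod_filter, prod_interval h]
    simp only [hlt]
    rw [← Finset.prod_filter]
    refine Finset.prod_congr ?_ fun _ _ => rfl
    ext t
    simp
  -- With first vector `1` the exponents decrease along the columns, as in the staircase, and the
  -- factors come out as `b r - b t` for `r < t` without an extra sign.
  have h2 := Matrix.det_projVandermonde (fun _ => (1 : ℝ)) b
  simp only [one_mul] at h2
  rw [h1, ← h2, Matrix.det_apply', ← Equiv.sum_comp (Equiv.inv (permGroup (interval N ℓ m))),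
    ← Equiv.sum_comp (permGroupEquiv h)]
  refine Finset.sum_congr rfl fun σ _ => ?_
  simp only [Equiv.inv_apply, InvMemClass.coe_inv, inv_inv, sgn_inv, sgn_permGroupEquiv]
  congr 1
  rw [stairScalar, prod_interval h]
  refine Finset.prod_congr rfl fun r _ => ?_
  rw [Function.comp_apply, permGroupEquiv_apply, Matrix.projVandermonde_apply, one_pow, one_mul]
  congr 1
  simp [intervalEquiv, Fin.val_rev]
  omega

end Interval

/-! ### Independence of joint eigenvectors with distinct spectra -/

section JointEigenvectors

theorem linearIndependent_of_joint_eigenvectors {ι J V : Type*} [AddCommGroup V] [Module ℝ V]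
    (U : J → Module.End ℝ V) {x : ι → V} {κ : ι → J → ℝ} (hκ : Function.Injective κ)
    (hx : ∀ i, x i ≠ 0) (hU : ∀ i j, U j (x i) = κ i j • x i) : LinearIndependent ℝ x := by
  classical
  rw [linearIndependent_iff']
  intro s
  induction s using Finset.induction_on with
  | empty => simp
  | insert a s ha ih =>
    intro g hg
    rw [Finset.sum_insert ha] at hg
    have hs : ∀ b ∈ s, g b = 0 := by
      intro b hb
      obtain ⟨j, hj⟩ := Function.ne_iff.1 (hκ.ne (ne_of_mem_of_not_mem hb ha))
      have h1 : ∑ i ∈ s, (g i * (κ i j - κ a j)) • x i = 0 := by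
        have h2 := congrArg (fun y => U j y - κ a j • y) hg
        simp only [map_add, map_sum, map_smul, hU, map_zero, smul_zero, sub_zero, smul_add,
          Finset.smul_sum] at h2
        rw [← h2, smul_comm (g a), add_sub_add_left_eq_sub, ← Finset.sum_sub_distrib]
        refine Finset.sum_congr rfl fun i _ => ?_
        rw [smul_comm (κ a j), ← smul_sub, ← sub_smul, smul_smul]
      have h3 := ih _ h1 b hb
      exact (mul_eq_zero.1 h3).resolve_right (sub_ne_zero.2 hj)
    intro i hi
    rcases Finset.mem_insert.1 hi with rfl | hi
    · rw [Finset.sum_eq_zero (fun b hb => by rw [hs b hb, zero_smul]), add_zero] at hg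
      exact (smul_eq_zero.1 hg).resolve_right (hx i)
    · exact hs i hi

end JointEigenvectors

/-! ### The space `X`, its `S_I`-action and its two bases -/

section Orbit

variable {N : ℕ} {k : ℝ} {ℓ m : ℕ} {α : Fin N → ℕ}

theorem StrictOn.injOn {I : Finset (Fin N)} (hα : StrictOn I α) {i j : Fin N} (hi : i ∈ I)
    (hj : j ∈ I) (h : α i = α j) : i = j := by
  by_contra hne
  rcases lt_or_gt_of_ne hne with h1 | h1
  · exact absurd h (hα i hi j hj h1).ne'
  · exact absurd h (hα j hj i hi h1).ne

/-- Equal entries never lie at two positions of `I`. Because `I` is an interval, `w` preserves the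
order of a position in `I` relative to one outside, so `kappa_compAct` applies. -/
theorem kappa_compAct_permGroup (hα : StrictOn (interval N ℓ m) α) {w : Perm (Fin N)}
    (hw : w ∈ permGroup (interval N ℓ m)) (i : Fin N) :
    kappa k (compAct w α) (w i) = kappa k α i := by
  apply kappa_compAct
  have key : ∀ a b : Fin N, a ∈ interval N ℓ m → b ∉ interval N ℓ m →
      (a < b ↔ w a < w b) ∧ (b < a ↔ w b < w a) := by
    intro a b ha hb
    have hwa := apply_mem_of_mem_permGroup hw ha
    rw [hw b hb]
    rw [mem_interval] at ha hb hwa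
    simp only [Fin.lt_def]
    omega
  intro a b hab
  by_cases ha : a ∈ interval N ℓ m <;> by_cases hb : b ∈ interval N ℓ m
  · rw [hα.injOn ha hb hab]; simp
  · exact (key a b ha hb).1
  · exact (key b a hb ha).2
  · rw [hw a ha, hw b hb]

theorem kappa_compAct_permGroup' (hα : StrictOn (interval N ℓ m) α) {w : Perm (Fin N)}
    (hw : w ∈ permGroup (interval N ℓ m)) :
    kappa k (compAct w α) = kappa k α ∘ (w⁻¹ : Perm (Fin N)) := by
  funext i
  have := kappa_compAct_permGroup (k := k) hα hw (w⁻¹ i)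
  simpa using this

theorem compAct_injective (hα : StrictOn (interval N ℓ m) α) :
    Function.Injective fun w : permGroup (interval N ℓ m) => compAct (w : Perm (Fin N)) α := by
  intro v w h
  apply Subtype.ext
  apply inv_injective
  apply Equiv.ext
  intro i
  by_cases hi : i ∈ interval N ℓ m
  · exact hα.injOn (apply_mem_of_mem_permGroup (inv_mem v.2) hi)
      (apply_mem_of_mem_permGroup (inv_mem w.2) hi) (congrFun h i)
  · rw [mem_permGroup.1 (inv_mem v.2) i hi, mem_permGroup.1 (inv_mem w.2) i hi]

theorem smul_add_smul_sub_smul {V : Type*} [AddCommGroup V] [Module ℝ V] {a b c t : ℝ}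
    (h : c * a - c * b = t) (x z : V) : b • x + t • z - c • a • z = b • (x - c • z) := by
  subst h
  module

/-- The action of an adjacent transposition in `S_I` on the nonsymmetric Jack polynomials. -/
theorem permOp_swap_zeta (hk : 0 ≤ k) (hα : StrictOn (interval N ℓ m) α) {i j : Fin N}
    (hi : i ∈ interval N ℓ m) (hj : j ∈ interval N ℓ m) (hij : (j : ℕ) = i + 1)
    {w : Perm (Fin N)} (hw : w ∈ permGroup (interval N ℓ m)) :
    ∃ c d : ℝ, d ≠ 0 ∧ permOp (swap i j) (zeta k (compAct w α)) =
      c • zeta k (compAct w α) + d • zeta k (compAct (swap i j * w) α) := by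
  have hne : i ≠ j := fun e => by rw [e] at hij; omega
  have hsw := mul_mem (swap_mem_permGroup hi hj) hw
  have hκ : kappa k (compAct (swap i j * w) α) = kappa k (compAct w α) ∘ swap i j := by
    rw [kappa_compAct_permGroup' hα hw, kappa_compAct_permGroup' hα hsw, mul_inv_rev, swap_inv]
    rfl
  set β := compAct w α with hβ
  have hβne : β i ≠ β j := fun h => hne (w⁻¹.injective (hα.injOn
    (apply_mem_of_mem_permGroup (inv_mem hw) hi) (apply_mem_of_mem_permGroup (inv_mem hw) hj) h))
  have hsq : k ^ 2 < (kappa k β i - kappa k β j) ^ 2 := by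
    rcases lt_or_gt_of_ne hβne with h | h
    · have := lt_kappa_sub hk β h
      nlinarith
    · have := lt_kappa_sub hk β h
      nlinarith
  have hd : kappa k β i - kappa k β j ≠ 0 := fun h => by
    rw [h] at hsq
    nlinarith [sq_nonneg k]
  -- The value of `c` is dictated by the exchange relations: it makes `(i j) ζ_β - c ζ_β` an
  -- eigenvector with the eigenvalues at `i` and `j` swapped.
  set c := k / (kappa k β i - kappa k β j) with hc
  have hck : c * kappa k β i - c * kappa k β j = k := by
    rw [hc]; field_simp
  have hev := (zeta_spec hk β).1
  have hfe : ∀ l, opU k l (permOp (swap i j) (zeta k β) - c • zeta k β) =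
      kappa k (compAct (swap i j * w) α) l •
        (permOp (swap i j) (zeta k β) - c • zeta k β) := by
    intro l
    rw [hκ, Function.comp_apply, map_sub, map_smul, hev]
    rcases eq_or_ne l i with rfl | hi'
    · have h1 := permOp_opU_succ' k hij (zeta k β)
      rw [hev, map_smul] at h1
      rw [swap_apply_left, eq_add_of_sub_eq h1.symm]
      exact smul_add_smul_sub_smul hck _ _
    rcases eq_or_ne l j with rfl | hj'
    · have h1 := permOp_opU_succ k hij (zeta k β)
      rw [hev, map_smul] at h1
      rw [swap_apply_right, ← sub_eq_of_eq_add h1, sub_eq_add_neg (kappa k β i • _), ← neg_smul]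
      exact smul_add_smul_sub_smul (by linarith) _ _
    · rw [← permOp_opU_of_ne k hij hi' hj', hev, map_smul, swap_apply_of_ne_of_ne hi' hj',
        smul_sub, smul_comm c]
  obtain ⟨d, hd'⟩ := exists_smul_zeta hk (compAct (swap i j * w) α)
    (sub_mem (permOp_zeta_mem_span hk _ β) (Submodule.smul_mem _ c (zeta_mem_span hk β))) hfe
  refine ⟨c, d, ?_, by rw [← hd']; abel⟩
  -- If `d = 0`, then `(i j) ζ_β = c ζ_β` and so `c² = 1`, contradicting `hsq`.
  rintro rfl
  rw [zero_smul, sub_eq_zero] at hd'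
  have h2 := congrArg (permOp (swap i j)) hd'
  rw [permOp_swap_swap, map_smul, hd', smul_smul] at h2
  have h3 : (1 - c * c) • zeta k β = 0 := by rw [sub_smul, one_smul, ← h2, sub_self]
  have h4 := (smul_eq_zero.1 h3).resolve_right (zeta_ne_zero hk β)
  have h5 : c * (kappa k β i - kappa k β j) = k := by rw [hc]; field_simp
  nlinarith

theorem zeta_mem_spaceX {w : Perm (Fin N)} (hw : w ∈ permGroup (interval N ℓ m)) :
    zeta k (compAct w α) ∈ spaceX k (interval N ℓ m) α :=
  Submodule.subset_span ⟨⟨w, hw⟩, rfl⟩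

theorem permOp_mem_spaceX (hk : 0 ≤ k) (hα : StrictOn (interval N ℓ m) α) {w : Perm (Fin N)}
    (hw : w ∈ permGroup (interval N ℓ m)) :
    ∀ f ∈ spaceX k (interval N ℓ m) α, permOp w f ∈ spaceX k (interval N ℓ m) α := by
  refine permGroup_interval_induction (P := fun w => ∀ f ∈ spaceX k (interval N ℓ m) α,
    permOp w f ∈ spaceX k (interval N ℓ m) α) (fun f hf => by simpa using hf) ?_ hw
  intro i hi j hj hij v _ hv f hf
  rw [permOp_mul_apply]
  have hle : spaceX k (interval N ℓ m) α ≤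
      (spaceX k (interval N ℓ m) α).comap (permOp (swap i j)) := by
    rw [spaceX, Submodule.span_le]
    rintro _ ⟨u, rfl⟩
    obtain ⟨c, d, _, h⟩ := permOp_swap_zeta hk hα hi hj hij u.2
    rw [SetLike.mem_coe, Submodule.mem_comap, h]
    exact add_mem (Submodule.smul_mem _ _ (zeta_mem_spaceX u.2)) (Submodule.smul_mem _ _
      (zeta_mem_spaceX (mul_mem (swap_mem_permGroup hi hj) u.2)))
  exact hle (hv f hf)

theorem stairU_mem_spaceX (hk : 0 ≤ k) (hN : ℓ + m ≤ N) {f : Poly N}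
    (hf : f ∈ spaceX k (interval N ℓ m) α) :
    stairU N k ℓ m f ∈ spaceX k (interval N ℓ m) α := by
  have hle : spaceX k (interval N ℓ m) α ≤
      (spaceX k (interval N ℓ m) α).comap (stairU N k ℓ m) := by
    rw [spaceX, Submodule.span_le]
    rintro _ ⟨u, rfl⟩
    rw [SetLike.mem_coe, Submodule.mem_comap,
      stairU_apply_eigenvector k hN (zeta_spec hk (compAct (u : Perm (Fin N)) α)).1]
    exact Submodule.smul_mem _ _ (zeta_mem_spaceX u.2)
  exact hle hf

theorem skewOp_mem_spaceX (hk : 0 ≤ k) (hN : ℓ + m ≤ N) (hα : StrictOn (interval N ℓ m) α) :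
    ∀ f ∈ spaceX k (interval N ℓ m) α, skewOp k ℓ m hN f ∈ spaceX k (interval N ℓ m) α := by
  intro f hf
  rw [skewOp_eq_signedSum, signedSum, LinearMap.sum_apply]
  refine sum_mem fun w _ => ?_
  rw [signedConj]
  exact Submodule.smul_mem _ _ (permOp_mem_spaceX hk hα w.2 _ (stairU_mem_spaceX hk hN
    (permOp_mem_spaceX hk hα (inv_mem w.2) f hf)))

theorem elemG_mem_spaceX (hk : 0 ≤ k) (hα : StrictOn (interval N ℓ m) α)
    (w : permGroup (interval N ℓ m)) :
    elemG k (interval N ℓ m) α w ∈ spaceX k (interval N ℓ m) α := by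
  apply permOp_mem_spaceX hk hα w.2
  have := zeta_mem_spaceX (k := k) (α := α) (one_mem (permGroup (interval N ℓ m)))
  rwa [compAct_one] at this

/-- Since `d ≠ 0` in `permOp_swap_zeta`, each `ζ_{svα}` can be recovered from `ζ_{vα}` and its image
under `s`. -/
theorem zeta_mem_span_elemG (hk : 0 ≤ k) (hα : StrictOn (interval N ℓ m) α) {w : Perm (Fin N)}
    (hw : w ∈ permGroup (interval N ℓ m)) :
    zeta k (compAct w α) ∈ Submodule.span ℝ (Set.range (elemG k (interval N ℓ m) α)) := by
  refine permGroup_interval_induction (P := fun w => zeta k (compAct w α) ∈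
    Submodule.span ℝ (Set.range (elemG k (interval N ℓ m) α))) ?_ ?_ hw
  · refine Submodule.subset_span ⟨1, ?_⟩
    simp [elemG]
  · intro i hi j hj hij v hv ih
    obtain ⟨c, d, hd, h⟩ := permOp_swap_zeta hk hα hi hj hij hv
    have hs := swap_mem_permGroup hi hj
    have hle : Submodule.span ℝ (Set.range (elemG k (interval N ℓ m) α)) ≤
        (Submodule.span ℝ (Set.range (elemG k (interval N ℓ m) α))).comap
          (permOp (swap i j)) := by
      rw [Submodule.span_le]
      rintro _ ⟨u, rfl⟩
      refine Submodule.subset_span ⟨⟨swap i j, hs⟩ * u, ?_⟩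
      rw [elemG, elemG, ← permOp_mul_apply]
      rfl
    have e : zeta k (compAct (swap i j * v) α) =
        d⁻¹ • (permOp (swap i j) (zeta k (compAct v α)) - c • zeta k (compAct v α)) := by
      rw [h, add_sub_cancel_left, smul_smul, inv_mul_cancel₀ hd, one_smul]
    rw [e]
    exact Submodule.smul_mem _ _ (sub_mem (hle ih) (Submodule.smul_mem _ _ ih))

theorem finrank_spaceX (hk : 0 ≤ k) (hα : StrictOn (interval N ℓ m) α) :
    Module.finrank ℝ (spaceX k (interval N ℓ m) α) =
      Fintype.card (permGroup (interval N ℓ m)) := by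
  apply finrank_span_eq_card
  exact linearIndependent_of_joint_eigenvectors (opU k)
    ((kappa_injective hk).comp (compAct_injective hα)) (fun w => zeta_ne_zero hk _)
    (fun w j => (zeta_spec hk (compAct (w : Perm (Fin N)) α)).1 j)

theorem exists_basis_elemG (hk : 0 ≤ k) (hα : StrictOn (interval N ℓ m) α) :
    ∃ b : Module.Basis (permGroup (interval N ℓ m)) ℝ (spaceX k (interval N ℓ m) α),
      ∀ w, (b w : Poly N) = elemG k (interval N ℓ m) α w := by
  set g : permGroup (interval N ℓ m) → spaceX k (interval N ℓ m) α :=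
    fun w => ⟨elemG k (interval N ℓ m) α w, elemG_mem_spaceX hk hα w⟩ with hg
  have hspan : ⊤ ≤ Submodule.span ℝ (Set.range g) := by
    intro x _
    have h1 : (x : Poly N) ∈ Submodule.span ℝ (Set.range (elemG k (interval N ℓ m) α)) := by
      refine Submodule.span_le.2 ?_ x.2
      rintro _ ⟨w, rfl⟩
      exact zeta_mem_span_elemG hk hα w.2
    have h2 : Submodule.map (Submodule.subtype _) (Submodule.span ℝ (Set.range g)) =
        Submodule.span ℝ (Set.range (elemG k (interval N ℓ m) α)) := by
      rw [Submodule.map_span, ← Set.range_comp]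
      rfl
    rw [← h2] at h1
    obtain ⟨y, hy, hyx⟩ := h1
    rwa [← Subtype.ext hyx]
  refine ⟨basisOfTopLeSpanOfCardEqFinrank g hspan (finrank_spaceX hk hα).symm, fun w => ?_⟩
  rw [coe_basisOfTopLeSpanOfCardEqFinrank]

end Orbit

/-! ### Orthogonal projections and the matrix of `ψ_I` -/

section InnerProduct

variable {N : ℕ} {k : ℝ} {ℓ m : ℕ} {α : Fin N → ℕ} {B : LinearMap.BilinForm ℝ (Poly N)}

theorem IsPermissible.opU_selfAdjoint (hB : IsPermissible k B) (i : Fin N) (f g : Poly N) :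
    B (opU k i f) g = B f (opU k i g) := by
  have h1 : B (opD k i f) g = B f (opD k i g) := hB.selfAdjoint i f g
  rw [opU_apply, opU_apply]
  simp only [map_add, map_sub, map_smul, map_sum, LinearMap.add_apply, LinearMap.sub_apply,
    LinearMap.smul_apply, LinearMap.sum_apply, hB.invariant, swap_inv, h1]

theorem IsPermissible.zeta_orthogonal (hB : IsPermissible k B) (hk : 0 ≤ k) {β γ : Fin N → ℕ}
    (h : β ≠ γ) : B (zeta k β) (zeta k γ) = 0 := by
  obtain ⟨i, hi⟩ := Function.ne_iff.1 ((kappa_injective hk).ne h)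
  have h1 := hB.opU_selfAdjoint i (zeta k β) (zeta k γ)
  rw [(zeta_spec hk β).1, (zeta_spec hk γ).1, map_smul, LinearMap.smul_apply, map_smul,
    smul_eq_mul, smul_eq_mul] at h1
  have h2 : (kappa k β i - kappa k γ i) * B (zeta k β) (zeta k γ) = 0 := by linarith
  exact (mul_eq_zero.1 h2).resolve_left (sub_ne_zero.2 hi)

/-- The projection onto the line of `z`. -/
def projOn (B : LinearMap.BilinForm ℝ (Poly N)) (z : Poly N) : Module.End ℝ (Poly N) :=
  (B z).smulRight ((B z z)⁻¹ • z)

theorem projOn_apply (B : LinearMap.BilinForm ℝ (Poly N)) (z f : Poly N) :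
    projOn B z f = (B z f / B z z) • z := by
  rw [projOn, LinearMap.smulRight_apply, smul_smul, div_eq_mul_inv]

/-- The sum is the orthogonal projection onto the plane of `x` and `y`. Conjugation by an isometry
preserving the plane gives an orthogonal projection onto the same plane, and such a projection is
unique. -/
theorem IsPermissible.projOn_add_conj (hB : IsPermissible k B) {x y : Poly N} (hx : x ≠ 0)
    (hy : y ≠ 0) (hxy : B x y = 0) {v : Perm (Fin N)} (hv : v⁻¹ = v)
    (hvx : permOp v x ∈ Submodule.span ℝ {x, y}) (hvy : permOp v y ∈ Submodule.span ℝ {x, y}) :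
    permOp v * (projOn B x + projOn B y) * permOp v⁻¹ = projOn B x + projOn B y := by
  set E := projOn B x + projOn B y with hE
  set W := Submodule.span ℝ {x, y} with hW
  have hxW : x ∈ W := Submodule.subset_span (by simp)
  have hyW : y ∈ W := Submodule.subset_span (by simp)
  have hvW : ∀ u ∈ W, permOp v u ∈ W := by
    have : W ≤ W.comap (permOp v) := by
      rw [hW, Submodule.span_le]
      rintro u (rfl | rfl)
      · exact hvx
      · exact hvy
    exact this
  have hEW : ∀ f, E f ∈ W := by
    intro f
    rw [hE, LinearMap.add_apply, projOn_apply, projOn_apply]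
    exact add_mem (Submodule.smul_mem _ _ hxW) (Submodule.smul_mem _ _ hyW)
  have hEperp : ∀ f, ∀ u ∈ W, B u (f - E f) = 0 := by
    intro f u hu
    have hx0 := (hB.pos x hx).ne'
    have hy0 := (hB.pos y hy).ne'
    have hyx : B y x = 0 := by rw [hB.symm, hxy]
    induction hu using Submodule.span_induction with
    | mem u hu =>
      rcases hu with rfl | rfl
      · simp [hE, projOn_apply, hxy, hx0]
      · simp [hE, projOn_apply, hyx, hy0]
    | zero => simp
    | add a b _ _ ha hb => rw [map_add, LinearMap.add_apply, ha, hb, add_zero]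
    | smul c a _ ha => rw [map_smul, LinearMap.smul_apply, ha, smul_zero]
  apply LinearMap.ext
  intro f
  set h := permOp v (E (permOp v f)) - E f with hh
  have hmem : h ∈ W := sub_mem (hvW _ (hEW _)) (hEW _)
  have hz : B h h = 0 := by
    have h1 := hEperp f h hmem
    have h2 := hEperp (permOp v f) (permOp v h) (hvW h hmem)
    rw [hB.invariant, hv, map_sub (permOp v)] at h2
    have h3 : permOp v (permOp v f) = f := by
      have := permOp_inv_apply v f
      rwa [hv] at this
    rw [h3] at h2
    -- Both residuals are orthogonal to `h`, which lies in the plane; hence `h` is orthogonal to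
    -- itself.
    have e : h = (f - E f) - (f - permOp v (E (permOp v f))) := by rw [hh]; abel
    have h4 : B h h = B h ((f - E f) - (f - permOp v (E (permOp v f)))) := by rw [← e]
    rw [h4, map_sub, h1, h2, sub_zero]
  have h0 : h = 0 := by
    by_contra hne
    exact (hB.pos h hne).ne' hz
  rw [hv]
  exact sub_eq_zero.1 h0

/-- For adjacent `s`, the two projections attached to `v` and `s v` have an `s`-invariant sum, whose
skew-symmetrization equals its own negative. So each step by `s` changes the sign. -/
theorem IsPermissible.signedSum_projOn_zeta (hB : IsPermissible k B) (hk : 0 ≤ k)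
    (hα : StrictOn (interval N ℓ m) α) {w : Perm (Fin N)}
    (hw : w ∈ permGroup (interval N ℓ m)) :
    signedSum (interval N ℓ m) (projOn B (zeta k (compAct w α))) =
      sgn w • signedSum (interval N ℓ m) (projOn B (zeta k α)) := by
  refine permGroup_interval_induction (P := fun w =>
    signedSum (interval N ℓ m) (projOn B (zeta k (compAct w α))) =
      sgn w • signedSum (interval N ℓ m) (projOn B (zeta k α))) (by simp) ?_ hw
  intro i hi j hj hij v hv ih
  have hne : i ≠ j := fun e => by rw [e] at hij; omega
  have hs := swap_mem_permGroup hi hj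
  have hsv := mul_mem hs hv
  obtain ⟨c, d, _, h1⟩ := permOp_swap_zeta hk hα hi hj hij hv
  obtain ⟨c', d', _, h2⟩ := permOp_swap_zeta hk hα hi hj hij hsv
  rw [← mul_assoc, swap_mul_self, one_mul] at h2
  have hdist : compAct v α ≠ compAct (swap i j * v) α := by
    intro e
    have h3 := congrArg Subtype.val (compAct_injective hα (a₁ := ⟨v, hv⟩) (a₂ := ⟨_, hsv⟩) e)
    have h4 : swap i j = 1 := by simpa using h3.symm
    exact hne (swap_eq_refl_iff.1 h4)
  set x := zeta k (compAct v α)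
  set y := zeta k (compAct (swap i j * v) α)
  have hx : x ∈ Submodule.span ℝ {x, y} := Submodule.subset_span (by simp)
  have hy : y ∈ Submodule.span ℝ {x, y} := Submodule.subset_span (by simp)
  have h3 := hB.projOn_add_conj (x := x) (y := y) (zeta_ne_zero hk _) (zeta_ne_zero hk _)
    (hB.zeta_orthogonal hk hdist) (swap_inv i j)
    (by rw [h1]; exact add_mem (Submodule.smul_mem _ _ hx) (Submodule.smul_mem _ _ hy))
    (by rw [h2]; exact add_mem (Submodule.smul_mem _ _ hy) (Submodule.smul_mem _ _ hx))
  have h4 := signedSum_conj (interval N ℓ m) (projOn B x + projOn B y) hs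
  rw [h3, sgn_swap hne, signedSum_add, ih] at h4
  rw [sgn_mul, sgn_swap hne]
  apply LinearMap.ext
  intro f
  have h5 := LinearMap.congr_fun h4 f
  simp only [LinearMap.add_apply, LinearMap.smul_apply, smul_eq_C_mul, map_neg, map_mul,
    map_one] at h5 ⊢
  have h6 : (2 : Poly N) ≠ 0 := two_ne_zero
  apply mul_left_cancel₀ h6
  linear_combination h5

/-- The spectral decomposition of the staircase product on `X`, in the orthogonal eigenbasis of the
`ζ_{vα}`. -/
theorem IsPermissible.stairU_eq_sum_projOn (hB : IsPermissible k B) (hk : 0 ≤ k)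
    (hN : ℓ + m ≤ N) (hα : StrictOn (interval N ℓ m) α) {f : Poly N}
    (hf : f ∈ spaceX k (interval N ℓ m) α) :
    stairU N k ℓ m f = ∑ v : permGroup (interval N ℓ m),
      stairScalar ℓ m (kappa k α ∘ ((v : Perm (Fin N))⁻¹ : Perm (Fin N))) •
        projOn B (zeta k (compAct (v : Perm (Fin N)) α)) f := by
  rw [spaceX] at hf
  induction hf using Submodule.span_induction with
  | mem f hf =>
    obtain ⟨u, rfl⟩ := hf
    simp only
    rw [stairU_apply_eigenvector k hN (zeta_spec hk (compAct (u : Perm (Fin N)) α)).1,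
      kappa_compAct_permGroup' hα u.2, Fintype.sum_eq_single u]
    · rw [projOn_apply, div_self (hB.pos _ (zeta_ne_zero hk _)).ne', one_smul]
    · intro v hv
      rw [projOn_apply, hB.zeta_orthogonal hk ((compAct_injective hα).ne hv), zero_div, zero_smul,
        smul_zero]
  | zero => simp
  | add f g _ _ hf hg => simp only [map_add, hf, hg, smul_add, Finset.sum_add_distrib]
  | smul c f _ hf =>
    rw [map_smul, hf, Finset.smul_sum]
    simp only [map_smul, smul_comm c]

theorem IsPermissible.skewOp_apply (hB : IsPermissible k B) (hk : 0 ≤ k)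
    (hN : ℓ + m ≤ N) (hα : StrictOn (interval N ℓ m) α) {f : Poly N}
    (hf : f ∈ spaceX k (interval N ℓ m) α) :
    skewOp k ℓ m hN f = (∏ i ∈ interval N ℓ m, ∏ j ∈ (interval N ℓ m).filter (fun j => i < j),
      (kappa k α i - kappa k α j)) • signedSum (interval N ℓ m) (projOn B (zeta k α)) f := by
  have h1 : skewOp k ℓ m hN f = ∑ v : permGroup (interval N ℓ m),
      stairScalar ℓ m (kappa k α ∘ ((v : Perm (Fin N))⁻¹ : Perm (Fin N))) •
        signedSum (interval N ℓ m) (projOn B (zeta k (compAct (v : Perm (Fin N)) α))) f := by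
    rw [skewOp_eq_signedSum]
    simp only [signedSum, signedConj, LinearMap.sum_apply, LinearMap.smul_apply,
      Module.End.mul_apply, Finset.smul_sum]
    rw [Finset.sum_comm]
    refine Finset.sum_congr rfl fun w _ => ?_
    rw [hB.stairU_eq_sum_projOn hk hN hα (permOp_mem_spaceX hk hα (inv_mem w.2) f hf), map_sum,
      Finset.smul_sum]
    refine Finset.sum_congr rfl fun v _ => ?_
    rw [map_smul, smul_comm]
  rw [h1, ← sum_sgn_mul_stairScalar hN, Finset.sum_smul]
  refine Finset.sum_congr rfl fun v _ => ?_
  rw [hB.signedSum_projOn_zeta hk hα v.2, LinearMap.smul_apply, smul_smul, mul_comm]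

/-- By invariance of the form, the projection coefficient of `w⁻¹ g_u` along `ζ_α` is the Gram entry
for `w` and `u`, and `w` carries `ζ_α` to `g_w`. -/
theorem IsPermissible.signedSum_projOn_elemG (hB : IsPermissible k B)
    (I : Finset (Fin N)) (α : Fin N → ℕ) (u : permGroup I) :
    signedSum I (projOn B (zeta k α)) (elemG k I α u) =
      ∑ w : permGroup I, (sgn (w : Perm (Fin N)) * gramH k B I α w u) • elemG k I α w := by
  rw [signedSum, LinearMap.sum_apply]
  refine Finset.sum_congr rfl fun w _ => ?_
  simp only [signedConj, LinearMap.smul_apply, Module.End.mul_apply, projOn_apply, map_smul,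
    gramH, Matrix.of_apply, smul_smul]
  congr 3
  · rw [elemG, elemG, hB.invariant]
  · simp [elemG]

theorem parityP_mul_apply (I : Finset (Fin N))
    (A : Matrix (permGroup I) (permGroup I) ℝ) (w u : permGroup I) :
    (parityP I * A) w u = sgn (w : Perm (Fin N)) * A w u := by
  rw [Matrix.mul_apply, Fintype.sum_eq_single w]
  · simp [parityP, sgn]
  · intro v hv
    simp [parityP, hv.symm]

end InnerProduct

end NSJack

end

theorem theorem4p12 (N : ℕ) (k : ℝ) (hk : 0 ≤ k) (ℓ m : ℕ) (hm : 1 ≤ m) (hN : ℓ + m ≤ N)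
    (α : Fin N → ℕ) (hα : NSJack.StrictOn (NSJack.interval N ℓ m) α) :
    ∃ (b : Module.Basis (NSJack.permGroup (NSJack.interval N ℓ m)) ℝ
          (NSJack.spaceX k (NSJack.interval N ℓ m) α))
      (hX : ∀ f ∈ NSJack.spaceX k (NSJack.interval N ℓ m) α,
        NSJack.skewOp k ℓ m hN f ∈ NSJack.spaceX k (NSJack.interval N ℓ m) α),
      (∀ w, (b w : NSJack.Poly N) = NSJack.elemG k (NSJack.interval N ℓ m) α w) ∧
      ∀ B : LinearMap.BilinForm ℝ (NSJack.Poly N), NSJack.IsPermissible k B →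
        LinearMap.toMatrix b b ((NSJack.skewOp k ℓ m hN).restrict hX) =
          (∏ i ∈ NSJack.interval N ℓ m,
            ∏ j ∈ (NSJack.interval N ℓ m).filter (fun j => i < j),
              (NSJack.kappa k α i - NSJack.kappa k α j)) •
            (NSJack.parityP (NSJack.interval N ℓ m) *
              NSJack.gramH k B (NSJack.interval N ℓ m) α) := by
  obtain ⟨b, hb⟩ := NSJack.exists_basis_elemG hk hα
  refine ⟨b, NSJack.skewOp_mem_spaceX hk hN hα, hb, fun B hB => ?_⟩
  -- Comparing linear maps instead of matrices reduces the claim to the value of `ψ_I` on each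
  -- `g_u`.
  apply (Matrix.toLin b b).injective
  rw [Matrix.toLin_toMatrix]
  refine b.ext fun u => Subtype.ext ?_
  rw [LinearMap.coe_restrict_apply, hb, Matrix.toLin_self,
    hB.skewOp_apply hk hN hα (NSJack.elemG_mem_spaceX hk hα u), hB.signedSum_projOn_elemG,
    Finset.smul_sum, AddSubmonoidClass.coe_finsetSum]
  refine Finset.sum_congr rfl fun w _ => ?_
  rw [Submodule.coe_smul, hb, Matrix.smul_apply, NSJack.parityP_mul_apply, smul_eq_mul, smul_smul]
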